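/- **Conventions.** For $n\ge 1$ and $s\in(0,1)$ let $C_{n,s}=\dfrac{4^s\,\Gamma(\frac n2+s)}{\pi^{n/2}\,|\Gamma(-s)|}$ be the normalising constant of the fractional Laplacian $(-\Delta)^s$ on $\mathbb R^n$ (the one for which its Fourier symbol is $|\xi|^{2s}$), and put $$\mathcal E_{n,s}(u,v)=\frac{C_{n,s}}2\int_{\mathbb R^n}\int_{\mathbb R^n}\frac{(u(x)-u(y))(v(x)-v(y))}{|x-y|^{n+2s}}\,dx\,dy .$$ For an open set $\Omega\subset\mathbb R^n$ let $H^s_\Omega(\mathbb R^n)$ be the closure of $C_c^\infty(\Omega)$ (functions extended by zero) for the norm $\|u\|_{L^2}+\big(\iint\frac{|u(x)-u(y)|^2}{|x-y|^{n+2s}}\,dx\,dy\big)^{1/2}$, and let $$P^2_{n,s}(\Omega)=\inf_{0\ne u\in H^s_\Omega(\mathbb R^n)}\frac{\mathcal E_{n,s}(u,u)}{\int_\Omega u^2}.$$ A real number $\mu$ is a Dirichlet eigenvalue of $(-\Delta)^s$ on $\Omega$, with eigenfunction $u$, if $0\neq u\in H^s_\Omega(\mathbb R^n)$ and $\mathcal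 E_{n,s}(u,v)=\mu\int_\Omega uv$ for all $v\in H^s_\Omega(\mathbb R^n)$. The $k$-th eigenvalue $\lambda_k(\Omega)$, $k=1,2,\dots$, is the $k$-th one in increasing order counted with multiplicity, i.e. the least $t$ such that there are $k$ linearly independent eigenfunctions with eigenvalues at most $t$. **Theorem.** Let $1\le m<n$, let $\omega\subset\mathbb R^{n-m}$ be non-empty, bounded and open, let $s\in(0,1)$, and put $\Omega_\ell=(-\ell,\ell)^m\times\omega\subset\mathbb R^n$ for $\ell>0$. Let $k\ge 1$ be an integer. Then $\lambda_k(\Omega_\ell)$ exists for every $\ell>0$ and $$P^2_{n-m,s}(\omega)\le\lambda_k(\Omega_\ell)\qquad\text{for all }\ell>0 .$$ Moreover, for every $\ell_0>0$ there is a constant $A$, independent of $\ell$, such that $$\lambda_k(\Omega_\ell)\le P^2_{n-m,s}(\omega)+A\,\ell^{-s}\qquad\text{for all }\ell\ge\ell_0 .$$ In particular $\lambda_k(\Omega_\ell)\to P^2_{n-m,s}(\omega)$ as $\ell\to\infty$ for every $k$. -/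

import Mathlib

open MeasureTheory Set Filter Topology
open scoped ENNReal

noncomputable section

/-- The normalising constant `C_{n,s} = 4^s Γ(n/2 + s) / (π^{n/2} |Γ(-s)|)` of the fractional
Laplacian on `ℝⁿ`, i.e. the constant for which
`(-Δ)^s u(x) = C_{n,s} p.v. ∫ (u(x) - u(y)) / |x - y|^{n+2s} dy` has Fourier symbol `|ξ|^{2s}`. -/
def fracLaplaceConst (n : ℕ) (s : ℝ) : ℝ :=
  (4 : ℝ) ^ s * Real.Gamma ((n : ℝ) / 2 + s)
    / (Real.pi ^ ((n : ℝ) / 2) * |Real.Gamma (-s)|)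

section

variable {ι : Type} [Fintype ι]

/-- The squared Gagliardo seminorm `∫∫ |u(x) - u(y)|² / |x - y|^{n+2s} dx dy` over `ℝⁿ × ℝⁿ`, with
values in `[0, ∞]`. -/
def gagliardoSq (s : ℝ) (u : EuclideanSpace ℝ ι → ℝ) : ℝ≥0∞ :=
  ∫⁻ x, ∫⁻ y, ENNReal.ofReal
    ((u x - u y) ^ 2 / ‖x - y‖ ^ ((Fintype.card ι : ℝ) + 2 * s))

/-- The space `C_c^∞(Ω)`, its elements being extended by zero to `ℝⁿ`. -/
def IsTestFunction (Ω : Set (EuclideanSpace ℝ ι)) (φ : EuclideanSpace ℝ ι → ℝ) : Prop :=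
  ContDiff ℝ ((⊤ : ℕ∞) : WithTop ℕ∞) φ ∧ HasCompactSupport φ ∧ tsupport φ ⊆ Ω

/-- The space `H^s_Ω(ℝⁿ)`: the closure of `C_c^∞(Ω)` for the norm
`‖u‖_{L²} + (∫∫ |u(x) - u(y)|² / |x - y|^{n+2s} dx dy)^{1/2}`. -/
def fracSobolev (s : ℝ) (Ω : Set (EuclideanSpace ℝ ι)) :
    Set (Lp ℝ 2 (volume : Measure (EuclideanSpace ℝ ι))) :=
  {u | ∀ ε : ℝ≥0∞, 0 < ε → ∃ φ : EuclideanSpace ℝ ι → ℝ, IsTestFunction Ω φ ∧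
    eLpNorm (fun x => u x - φ x) 2 volume
      + gagliardoSq s (fun x => u x - φ x) ^ (1 / 2 : ℝ) < ε}

/-- The bilinear form of `(-Δ)^s` on `ℝⁿ`,
`(C_{n,s} / 2) ∫∫ (u(x) - u(y)) (v(x) - v(y)) / |x - y|^{n+2s} dx dy`. -/
def fracForm (s : ℝ) (u v : EuclideanSpace ℝ ι → ℝ) : ℝ :=
  fracLaplaceConst (Fintype.card ι) s / 2 *
    ∫ p : EuclideanSpace ℝ ι × EuclideanSpace ℝ ι,
      (u p.1 - u p.2) * (v p.1 - v p.2) / ‖p.1 - p.2‖ ^ ((Fintype.card ι : ℝ) + 2 * s)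

/-- The fractional Poincaré constant `P²_{n,s}(Ω)`: the infimum over `0 ≠ u ∈ H^s_Ω(ℝⁿ)` of the
Rayleigh quotient of `(-Δ)^s`. -/
def poincareConst (s : ℝ) (Ω : Set (EuclideanSpace ℝ ι)) : ℝ :=
  sInf {r | ∃ u ∈ fracSobolev s Ω, u ≠ 0 ∧ r = fracForm s u u / ∫ x in Ω, (u x) ^ 2}

/-- `u` is an eigenfunction, with eigenvalue `μ`, of `(-Δ)^s u = μ u` in `Ω`, `u = 0` outside `Ω`
(weak formulation). -/
def IsDirichletEigenfunction (s : ℝ) (Ω : Set (EuclideanSpace ℝ ι)) (μ : ℝ)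
    (u : Lp ℝ 2 (volume : Measure (EuclideanSpace ℝ ι))) : Prop :=
  u ∈ fracSobolev s Ω ∧ u ≠ 0 ∧
    ∀ v ∈ fracSobolev s Ω, fracForm s u v = μ * ∫ x in Ω, u x * v x

/-- The levels `t` such that at least `k` Dirichlet eigenvalues of `(-Δ)^s` on `Ω`, counted with
multiplicity, are at most `t`. -/
def eigenvalueLevels (s : ℝ) (Ω : Set (EuclideanSpace ℝ ι)) (k : ℕ) : Set ℝ :=
  {t | ∃ u : Fin k → Lp ℝ 2 (volume : Measure (EuclideanSpace ℝ ι)),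
    LinearIndependent ℝ u ∧ ∀ i, ∃ μ ≤ t, IsDirichletEigenfunction s Ω μ (u i)}

/-- The `k`-th Dirichlet eigenvalue of `(-Δ)^s` on `Ω` in increasing order with multiplicity
(`k = 1, 2, …`): the least level below which there are at least `k` eigenvalues. -/
def dirichletEigenvalue (s : ℝ) (Ω : Set (EuclideanSpace ℝ ι)) (k : ℕ) : ℝ :=
  sInf (eigenvalueLevels s Ω k)

end

/-- The cylinder `Ω_ℓ = (-ℓ, ℓ)^m × ω` in `ℝ^m × ℝ^d = ℝ^{m+d}`. -/
def longCylinder (m : ℕ) {d : ℕ} (ω : Set (EuclideanSpace ℝ (Fin d))) (ℓ : ℝ) :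
    Set (EuclideanSpace ℝ (Fin m ⊕ Fin d)) :=
  {x | (∀ i : Fin m, x (Sum.inl i) ∈ Ioo (-ℓ) ℓ) ∧
    WithLp.toLp 2 (fun j : Fin d => x (Sum.inr j)) ∈ ω}

end

/-! The proof compares energies in different dimensions through Gaussians. The kernel
$C_{n,s}|z|^{-n-2s}$ equals $\int_0^\infty \kappa\,a^{s-1}G_a(z)\,da$, where
$G_a(z)=(a/\pi)^{n/2}e^{-a|z|^2}$ is a probability density and the weight $\kappa a^{s-1}$,
$\kappa=4^s/|\Gamma(-s)|$, is the same in every dimension. It is therefore enough to compare the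
energies $E_a(f,g)=\iint (f(x)-g(y))^2G_a(x-y)$ at fixed $a$, and $G_a$ factorises over $\mathbb
R^m\times\mathbb R^{n-m}$.

Lower bound. Since $G_a$ is positive definite, $E_a(f,f)+E_a(g,g)\le 2E_a(f,g)$. Applied to two
slices $\varphi(x,\cdot)$, $\varphi(x',\cdot)$ and integrated against $G_a(x-x')$, this shows that
the energy of $\varphi$ dominates the integral of the energies of its slices
(`lintegral_fracEnergy_slice_le`). The slices of a test function of the cylinder are test functions
of $\omega$, so every Rayleigh quotient on $\Omega_\ell$ is at least $P^2(\omega)$.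

Upper bound. For products, the energy of $\Psi\otimes w$ is at most that of $\Psi$ times $\|w\|^2$
plus $\|\Psi\|^2$ times that of $w$ (`fracEnergy_tensorFun_le`). Take $w$ nearly optimal on $\omega$
and $\Psi$ in the span of $k$ fixed functions with disjoint supports, dilated by $\ell$. On this
$k$-dimensional space the Rayleigh quotient is at most $P^2(\omega)+\varepsilon+O(\ell^{-2s})$,
which is better than the rate needed.

Passing from quotients to eigenvalues requires the min-max principle. $H^s_\Omega$ is realised as a
closed subspace of $L^2\times L^2$, made of pairs ($u$, weighted difference of $u$). With
$c=C_{n,s}/2$ its inner product is the $L^2$ product plus $c^{-1}\mathcal E$, so a Dirichlet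
eigenvalue $\mu$ becomes $1+\mu/c$ relative to the embedding $J$ into $L^2$. For bounded $\Omega$
this $J$ is compact (`isCompactOperator_formEmbedding`), and the spectral theory of $J^*J$ gives
both the min-max bound and the discreteness of the spectrum. -/

noncomputable section

/-! ### Eigenvalues relative to a compact embedding, and the min-max principle -/

section SpectralTheory

open scoped InnerProductSpace

variable {K L : Type*} [NormedAddCommGroup K] [InnerProductSpace ℝ K]
  [NormedAddCommGroup L] [InnerProductSpace ℝ L]

/-- `u` is an eigenvector, with eigenvalue `μ`, of the inner product of `K` relative to the form
`⟪J u, J v⟫`. -/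
def IsFormEigenvector (J : K →L[ℝ] L) (μ : ℝ) (u : K) : Prop :=
  u ≠ 0 ∧ ∀ v, ⟪u, v⟫_ℝ = μ * ⟪J u, J v⟫_ℝ

theorem IsFormEigenvector.norm_sq {J : K →L[ℝ] L} {μ : ℝ} {u : K}
    (h : IsFormEigenvector J μ u) : ‖u‖ ^ 2 = μ * ‖J u‖ ^ 2 := by
  have := h.2 u
  rwa [real_inner_self_eq_norm_sq, real_inner_self_eq_norm_sq] at this

theorem IsFormEigenvector.pos {J : K →L[ℝ] L} {μ : ℝ} {u : K}
    (h : IsFormEigenvector J μ u) : 0 < μ := by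
  have h1 := h.norm_sq
  have h2 : 0 < ‖u‖ ^ 2 := by have := norm_pos_iff.mpr h.1; positivity
  by_contra! hμ
  nlinarith [sq_nonneg ‖J u‖]

theorem IsFormEigenvector.smul {J : K →L[ℝ] L} {μ : ℝ} {u : K}
    (h : IsFormEigenvector J μ u) {c : ℝ} (hc : c ≠ 0) : IsFormEigenvector J μ (c • u) := by
  refine ⟨smul_ne_zero hc h.1, fun v => ?_⟩
  rw [map_smul, real_inner_smul_left, real_inner_smul_left, h.2 v]
  ring

theorem IsFormEigenvector.inner_map_eq_zero {J : K →L[ℝ] L} {μ ν : ℝ} {u v : K}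
    (hu : IsFormEigenvector J μ u) (hv : IsFormEigenvector J ν v) (h : μ ≠ ν) :
    ⟪J u, J v⟫_ℝ = 0 := by
  have h1 := hu.2 v
  have h2 := hv.2 u
  rw [real_inner_comm, real_inner_comm (J u)] at h2
  have : (μ - ν) * ⟪J u, J v⟫_ℝ = 0 := by linarith
  exact (mul_eq_zero.mp this).resolve_left (sub_ne_zero.mpr h)

/-- Unit eigenvectors for distinct eigenvalues at most $t$ have orthogonal images of square norm at
least $1/t$. Infinitely many of them would form a sequence in a compact set with no Cauchy
subsequence. -/
theorem finite_formEigenvalues_le {J : K →L[ℝ] L} (hJ : IsCompactOperator J) (t : ℝ) :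
    {μ : ℝ | μ ≤ t ∧ ∃ u, IsFormEigenvector J μ u}.Finite := by
  by_contra hinf
  let f := Set.Infinite.natEmbedding _ hinf
  have hf : ∀ n, ∃ u : K, ‖u‖ = 1 ∧ IsFormEigenvector J (f n : ℝ) u := by
    intro n
    obtain ⟨u, hu⟩ := (f n).2.2
    have hn : ‖u‖ ≠ 0 := norm_ne_zero_iff.mpr hu.1
    refine ⟨‖u‖⁻¹ • u, ?_, hu.smul (inv_ne_zero hn)⟩
    rw [norm_smul, norm_inv, norm_norm, inv_mul_cancel₀ hn]
  choose u hu1 hu using hf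
  have ht : 0 < t := (hu 0).pos.trans_le (f 0).2.1
  obtain ⟨C, hC, hCs⟩ := hJ.image_closedBall_subset_compact 1
  have hmem : ∀ n, J (u n) ∈ C := fun n =>
    hCs ⟨u n, by simp [hu1 n], rfl⟩
  obtain ⟨a, -, φ, hφ, hlim⟩ := hC.tendsto_subseq hmem
  have hcau := hlim.cauchySeq
  rw [Metric.cauchySeq_iff] at hcau
  obtain ⟨N, hN⟩ := hcau (Real.sqrt (1 / t)) (Real.sqrt_pos.mpr (by positivity))
  have h1 := hN N le_rfl (N + 1) (Nat.le_succ N)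
  simp only [Function.comp] at h1
  have hne : (f (φ N) : ℝ) ≠ f (φ (N + 1)) := by
    intro h
    have := hφ.injective (f.injective (Subtype.ext h))
    omega
  have h0 := (hu (φ N)).inner_map_eq_zero (hu (φ (N + 1))) hne
  have h2 : dist (J (u (φ N))) (J (u (φ (N + 1)))) ^ 2
      = ‖J (u (φ N))‖ ^ 2 + ‖J (u (φ (N + 1)))‖ ^ 2 := by
    rw [dist_eq_norm, @norm_sub_sq_real, h0]; ring
  have h3 := (hu (φ N)).norm_sq
  rw [hu1] at h3
  have h4 : 1 / t ≤ ‖J (u (φ N))‖ ^ 2 := by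
    rw [div_le_iff₀ ht]
    have := (f (φ N)).2.1
    nlinarith [sq_nonneg ‖J (u (φ N))‖]
  have h5 : dist (J (u (φ N))) (J (u (φ (N + 1)))) ^ 2 < 1 / t := by
    calc _ < Real.sqrt (1 / t) ^ 2 := by gcongr
      _ = 1 / t := Real.sq_sqrt (by positivity)
  nlinarith [sq_nonneg ‖J (u (φ (N + 1)))‖]

variable [CompleteSpace K] [CompleteSpace L]

/-- A compact symmetric operator whose eigenvalues all lie in `[-δ, δ]` has norm at most `δ`. -/
theorem norm_le_of_eigenvalues_abs_le {S : K →L[ℝ] K} (hS : IsCompactOperator S)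
    (hsymm : (S : K →ₗ[ℝ] K).IsSymmetric) {δ : ℝ} (hδ : 0 ≤ δ)
    (h : ∀ α, Module.End.HasEigenvalue (S : Module.End ℝ K) α → |α| ≤ δ) : ‖S‖ ≤ δ := by
  have h1 : spectralRadius ℝ S ≤ ENNReal.ofReal δ := by
    refine iSup₂_le fun α hα => ?_
    by_cases h0 : α = 0
    · simp [h0]
    · have := h α ((hS.hasEigenvalue_iff_mem_spectrum h0).mpr hα)
      rw [← enorm_eq_nnnorm, Real.enorm_eq_ofReal_abs]
      exact ENNReal.ofReal_le_ofReal this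
  rw [S.spectralRadius_eq_nnnorm hsymm.isSelfAdjoint, ← enorm_eq_nnnorm,
    ← ofReal_norm] at h1
  exact (ENNReal.ofReal_le_ofReal_iff hδ).mp h1

-- The operator $T=J^*J$ preserves the orthogonal complement $W$ of the eigenvectors with eigenvalue
-- at most $t$. An eigenvalue $\alpha>1/t$ of $T|_W$ would make its eigenvector a form eigenvector
-- with eigenvalue $1/\alpha\le t$, hence orthogonal to itself. So $\|T|_W\|\le 1/t$, and
-- $\|Jx\|^2=\langle Tx,x\rangle$.
open ContinuousLinearMap in
theorem norm_map_sq_le_of_orthogonal_formEigenvectors {J : K →L[ℝ] L} (hJ : IsCompactOperator J)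
    {t : ℝ} (ht : 0 < t) {x : K}
    (hx : ∀ μ ≤ t, ∀ u, IsFormEigenvector J μ u → ⟪u, x⟫_ℝ = 0) :
    t * ‖J x‖ ^ 2 ≤ ‖x‖ ^ 2 := by
  let T : K →L[ℝ] K := (adjoint J) ∘L J
  have hTi : ∀ u v, ⟪T u, v⟫_ℝ = ⟪J u, J v⟫_ℝ := fun u v => adjoint_inner_left J v (J u)
  have hT : IsCompactOperator T := hJ.clm_comp (adjoint J)
  have hTs : (T : K →ₗ[ℝ] K).IsSymmetric := by
    intro u v
    change ⟪T u, v⟫_ℝ = ⟪u, T v⟫_ℝ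
    rw [hTi, real_inner_comm (T v), hTi, real_inner_comm]
  let E : Set K := {u | ∃ μ ≤ t, IsFormEigenvector J μ u}
  let W : Submodule ℝ K := (Submodule.span ℝ E)ᗮ
  have hWmem : ∀ y, y ∈ W ↔ ∀ u ∈ E, ⟪u, y⟫_ℝ = 0 := by
    intro y
    constructor
    · intro hy u hu
      exact (Submodule.mem_orthogonal _ _).mp hy u (Submodule.subset_span hu)
    · intro hy
      rw [Submodule.mem_orthogonal]
      intro u hu
      induction hu using Submodule.span_induction with
      | mem u hu => exact hy u hu
      | zero => simp
      | add a b _ _ ha hb => rw [inner_add_left, ha, hb, add_zero]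
      | smul c a _ ha => rw [real_inner_smul_left, ha, mul_zero]
  have hinv : ∀ y ∈ W, T y ∈ W := by
    intro y hy
    rw [hWmem] at hy ⊢
    rintro u ⟨μ, hμ, hu⟩
    have h1 := hy u ⟨μ, hμ, hu⟩
    have h2 := hu.2 y
    rw [real_inner_comm, hTi, real_inner_comm]
    rw [h1] at h2
    exact (mul_eq_zero.mp h2.symm).resolve_left hu.pos.ne'
  let S : W →L[ℝ] W := T.restrict hinv
  have hSc : IsCompactOperator S := hT.restrict' hinv
  have hSs : (S : W →ₗ[ℝ] W).IsSymmetric := hTs.restrict_invariant hinv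
  have hSn : ‖S‖ ≤ 1 / t := by
    refine norm_le_of_eigenvalues_abs_le hSc hSs (by positivity) fun α hα => ?_
    obtain ⟨⟨y, hyW⟩, hy⟩ := hα.exists_hasEigenvector
    have hy0 : y ≠ 0 := fun h => hy.2 (Subtype.ext h)
    have hTy : T y = α • y := by
      have := hy.apply_eq_smul
      exact congrArg Subtype.val this
    have hpos : 0 < ‖y‖ ^ 2 := by have := norm_pos_iff.mpr hy0; positivity
    have hαn : α * ‖y‖ ^ 2 = ‖J y‖ ^ 2 := by
      have := hTi y y
      rwa [hTy, real_inner_smul_left, real_inner_self_eq_norm_sq, real_inner_self_eq_norm_sq]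
        at this
    have hα0 : 0 ≤ α := by
      by_contra! h
      nlinarith [sq_nonneg ‖J y‖]
    rw [abs_of_nonneg hα0]
    by_contra! hlt
    have hαpos : 0 < α := lt_trans (by positivity) hlt
    have hEig : IsFormEigenvector J α⁻¹ y := by
      refine ⟨hy0, fun v => ?_⟩
      rw [← hTi, hTy, real_inner_smul_left, inv_mul_cancel_left₀ hαpos.ne']
    have hle : α⁻¹ ≤ t := by
      rw [inv_le_comm₀ hαpos ht, ← one_div]
      exact hlt.le
    have := (hWmem y).mp hyW y ⟨_, hle, hEig⟩
    rw [inner_self_eq_zero] at this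
    exact hy0 this
  have hxW : x ∈ W := (hWmem x).mpr fun u ⟨μ, hμ, hu⟩ => hx μ hμ u hu
  have h1 : ‖J x‖ ^ 2 = ⟪S ⟨x, hxW⟩, (⟨x, hxW⟩ : W)⟫_ℝ := by
    rw [← real_inner_self_eq_norm_sq, ← hTi]
    rfl
  have h2 : ⟪S ⟨x, hxW⟩, (⟨x, hxW⟩ : W)⟫_ℝ ≤ 1 / t * ‖x‖ ^ 2 := by
    calc _ ≤ ‖S ⟨x, hxW⟩‖ * ‖(⟨x, hxW⟩ : W)‖ := real_inner_le_norm _ _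
      _ ≤ (‖S‖ * ‖(⟨x, hxW⟩ : W)‖) * ‖(⟨x, hxW⟩ : W)‖ := by
          gcongr; exact S.le_opNorm _
      _ ≤ (1 / t * ‖(⟨x, hxW⟩ : W)‖) * ‖(⟨x, hxW⟩ : W)‖ := by gcongr
      _ = 1 / t * ‖x‖ ^ 2 := by
        change (1 / t * ‖x‖) * ‖x‖ = _
        ring
  rw [h1]
  calc _ ≤ t * (1 / t * ‖x‖ ^ 2) := by gcongr
    _ = ‖x‖ ^ 2 := by field_simp

/-- The min-max principle: a `k`-dimensional subspace on which the Rayleigh quotient is at most `t`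
provides `k` independent eigenvectors with eigenvalues at most `t'`, for every `t' > t`. -/
theorem exists_formEigenvectors_of_rayleigh_le {J : K →L[ℝ] L} (hJ : IsCompactOperator J)
    (hinj : Function.Injective J) {k : ℕ} {v : Fin k → K} (hv : LinearIndependent ℝ v)
    {t t' : ℝ} (ht' : 0 < t') (htt' : t < t')
    (hle : ∀ x ∈ Submodule.span ℝ (range v), ‖x‖ ^ 2 ≤ t * ‖J x‖ ^ 2) :
    ∃ u : Fin k → K, LinearIndependent ℝ u ∧ ∀ i, ∃ μ ≤ t', IsFormEigenvector J μ (u i) := by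
  let E : Set K := {u | ∃ μ ≤ t', IsFormEigenvector J μ u}
  -- Either a maximal independent family of eigenvectors below $t'$ has at least $k$ members, or its
  -- span has dimension less than $k$. In the second case some nonzero trial vector $x$ is
  -- orthogonal to it, so $t'\|Jx\|^2\le\|x\|^2\le t\|Jx\|^2$, which contradicts $t<t'$ because $J$
  -- is injective.
  obtain ⟨b, hbE, hbs, hbi⟩ := exists_linearIndependent ℝ E
  by_cases hcard : (k : ℕ∞) ≤ b.encard
  · obtain ⟨c, hcb, hck⟩ := Set.exists_subset_encard_eq hcard
    have hcfin : c.Finite := Set.finite_of_encard_eq_coe hck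
    have : Fintype c := hcfin.fintype
    have hcc : Fintype.card c = k := by
      have := hck
      rw [Set.encard_eq_coe_toFinset_card, Set.toFinset_card] at this
      exact_mod_cast this
    let e : Fin k ≃ c := (Fintype.equivFinOfCardEq hcc).symm
    refine ⟨fun i => (e i : K), ?_, fun i => hbE (hcb (e i).2)⟩
    have h1 : LinearIndependent ℝ ((↑) : c → K) :=
      hbi.comp (Set.inclusion hcb) (Set.inclusion_injective hcb)
    exact h1.comp e e.injective
  · exfalso
    push Not at hcard
    have hbfin : b.Finite := Set.finite_of_encard_le_coe hcard.le
    have hfd : FiniteDimensional ℝ (Submodule.span ℝ E) := by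
      rw [← hbs]
      exact FiniteDimensional.span_of_finite ℝ hbfin
    have hrank : Module.finrank ℝ (Submodule.span ℝ E) < k := by
      have : Fintype b := hbfin.fintype
      rw [← hbs, finrank_span_set_eq_card hbi]
      rw [Set.encard_eq_coe_toFinset_card] at hcard
      exact_mod_cast hcard
    let V := Submodule.span ℝ (range v)
    have hV : Module.finrank ℝ V = k := by
      rw [finrank_span_eq_card hv, Fintype.card_fin]
    have : FiniteDimensional ℝ V := FiniteDimensional.span_of_finite ℝ (finite_range v)
    let P : V →ₗ[ℝ] Submodule.span ℝ E :=
      ((Submodule.span ℝ E).orthogonalProjectionOnto : K →ₗ[ℝ] _) ∘ₗ V.subtype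
    have hker := LinearMap.ker_ne_bot_of_finrank_lt (f := P) (by rw [hV]; exact hrank)
    obtain ⟨x, hx, hx0⟩ := Submodule.exists_mem_ne_zero_of_ne_bot hker
    have hxo : (x : K) ∈ (Submodule.span ℝ E)ᗮ := by
      rw [← Submodule.orthogonalProjectionOnto_eq_zero_iff]
      exact hx
    have h1 := norm_map_sq_le_of_orthogonal_formEigenvectors hJ ht' (x := (x : K))
      fun μ hμ u hu => (Submodule.mem_orthogonal _ _).mp hxo u (Submodule.subset_span ⟨μ, hμ, hu⟩)
    have h2 := hle x x.2
    have hJx : J x ≠ 0 := by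
      intro h
      apply hx0
      apply Subtype.ext
      apply hinj
      simpa using h
    have : 0 < ‖J x‖ ^ 2 := by have := norm_pos_iff.mpr hJx; positivity
    nlinarith

/-- The levels below which there are `k` independent vectors satisfying an eigenvector-like
predicate have a least element when only finitely many eigenvalues lie below each level. -/
theorem isLeast_sInf_levels {V : Type*} [AddCommGroup V] [Module ℝ V] (P : ℝ → V → Prop)
    (hfin : ∀ t, {μ : ℝ | μ ≤ t ∧ ∃ u, P μ u}.Finite) {k : ℕ} (hk : 1 ≤ k)
    (hne : {t : ℝ | ∃ u : Fin k → V, LinearIndependent ℝ u ∧ ∀ i, ∃ μ ≤ t, P μ (u i)}.Nonempty) :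
    IsLeast {t : ℝ | ∃ u : Fin k → V, LinearIndependent ℝ u ∧ ∀ i, ∃ μ ≤ t, P μ (u i)}
      (sInf {t : ℝ | ∃ u : Fin k → V, LinearIndependent ℝ u ∧ ∀ i, ∃ μ ≤ t, P μ (u i)}) := by
  set S := {t : ℝ | ∃ u : Fin k → V, LinearIndependent ℝ u ∧ ∀ i, ∃ μ ≤ t, P μ (u i)} with hS
  have : Nonempty (Fin k) := ⟨⟨0, hk⟩⟩
  -- Every level can be lowered to the largest of the $k$ eigenvalues it uses, which is again a
  -- level and is itself an eigenvalue. The infimum is thus taken over a set with finitely many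
  -- points below any bound.
  have key : ∀ t ∈ S, ∃ r ∈ S, r ≤ t ∧ ∃ u, P r u := by
    rintro t ⟨u, hu, h⟩
    choose μ hμ hP using h
    obtain ⟨i, -, hi⟩ := Finset.exists_max_image Finset.univ μ Finset.univ_nonempty
    exact ⟨μ i, ⟨u, hu, fun j => ⟨μ j, hi j (Finset.mem_univ j), hP j⟩⟩, hμ i, u i, hP i⟩
  obtain ⟨t₀, ht₀⟩ := hne
  obtain ⟨r₀, hr₀, hr₀t, hr₀P⟩ := key t₀ ht₀
  have hF : ({μ : ℝ | μ ≤ t₀ ∧ ∃ u, P μ u} ∩ S).Finite := (hfin t₀).subset inter_subset_left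
  obtain ⟨r, hr, hmin⟩ := hF.exists_minimal ⟨r₀, ⟨hr₀t, hr₀P⟩, hr₀⟩
  have hleast : IsLeast S r := by
    refine ⟨hr.2, fun t ht => ?_⟩
    obtain ⟨q, hqS, hqt, hqP⟩ := key t ht
    by_cases hq : q ≤ t₀
    · rcases le_total r q with h | h
      · exact h.trans hqt
      · exact (hmin ⟨⟨hq, hqP⟩, hqS⟩ h).trans hqt
    · exact hr.1.1.trans ((not_le.mp hq).le.trans hqt)
  rwa [hleast.csInf_eq]

end SpectralTheory

/-! ### The Gagliardo seminorm as an $L^2$ norm of weighted differences -/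

section DifferenceQuotient

variable {ι : Type} [Fintype ι]

/-- The weighted difference `(u(x) - u(y)) / |x - y|^{(n+2s)/2}`, whose `L²` norm is the Gagliardo
seminorm. -/
def fracDiff (s : ℝ) (u : EuclideanSpace ℝ ι → ℝ)
    (p : EuclideanSpace ℝ ι × EuclideanSpace ℝ ι) : ℝ :=
  (u p.1 - u p.2) / ‖p.1 - p.2‖ ^ (((Fintype.card ι : ℝ) + 2 * s) / 2)

theorem norm_rpow_half_mul_self (z : EuclideanSpace ℝ ι) (r : ℝ) :
    ‖z‖ ^ (r / 2) * ‖z‖ ^ (r / 2) = ‖z‖ ^ r := by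
  rw [← sq, ← Real.rpow_natCast, ← Real.rpow_mul (norm_nonneg z)]
  norm_num

theorem fracDiff_mul (s : ℝ) (u v : EuclideanSpace ℝ ι → ℝ)
    (p : EuclideanSpace ℝ ι × EuclideanSpace ℝ ι) :
    fracDiff s u p * fracDiff s v p =
      (u p.1 - u p.2) * (v p.1 - v p.2) / ‖p.1 - p.2‖ ^ ((Fintype.card ι : ℝ) + 2 * s) := by
  rw [fracDiff, fracDiff, div_mul_div_comm, norm_rpow_half_mul_self]

theorem fracDiff_sq (s : ℝ) (u : EuclideanSpace ℝ ι → ℝ)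
    (p : EuclideanSpace ℝ ι × EuclideanSpace ℝ ι) :
    fracDiff s u p ^ 2 =
      (u p.1 - u p.2) ^ 2 / ‖p.1 - p.2‖ ^ ((Fintype.card ι : ℝ) + 2 * s) := by
  rw [sq, fracDiff_mul, ← sq]

theorem fracDiff_add (s : ℝ) (u v : EuclideanSpace ℝ ι → ℝ) :
    fracDiff s (fun x => u x + v x) = fun p => fracDiff s u p + fracDiff s v p := by
  ext p; simp only [fracDiff]; ring

theorem fracDiff_sub (s : ℝ) (u v : EuclideanSpace ℝ ι → ℝ) :
    fracDiff s (fun x => u x - v x) = fun p => fracDiff s u p - fracDiff s v p := by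
  ext p; simp only [fracDiff]; ring

theorem fracDiff_const_mul (s c : ℝ) (u : EuclideanSpace ℝ ι → ℝ) :
    fracDiff s (fun x => c * u x) = fun p => c * fracDiff s u p := by
  ext p; simp only [fracDiff]; ring

theorem ae_prod_of_ae {P : EuclideanSpace ℝ ι → Prop} (h : ∀ᵐ x, P x) :
    ∀ᵐ p : EuclideanSpace ℝ ι × EuclideanSpace ℝ ι, P p.1 ∧ P p.2 :=
  (Measure.quasiMeasurePreserving_fst.ae h).and (Measure.quasiMeasurePreserving_snd.ae h)

theorem fracDiff_congr_ae (s : ℝ) {u v : EuclideanSpace ℝ ι → ℝ} (h : u =ᵐ[volume] v) :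
    fracDiff s u =ᵐ[volume] fracDiff s v := by
  filter_upwards [ae_prod_of_ae h] with p hp
  rw [fracDiff, fracDiff, hp.1, hp.2]

theorem aestronglyMeasurable_fracDiff (s : ℝ) {u : EuclideanSpace ℝ ι → ℝ}
    (hu : AEStronglyMeasurable u volume) : AEStronglyMeasurable (fracDiff s u) volume := by
  have h1 : AEStronglyMeasurable (fun p : EuclideanSpace ℝ ι × EuclideanSpace ℝ ι => u p.1) volume :=
    hu.comp_fst
  have h2 : AEStronglyMeasurable (fun p : EuclideanSpace ℝ ι × EuclideanSpace ℝ ι => u p.2) volume :=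
    hu.comp_snd
  have h3 : Measurable (fun p : EuclideanSpace ℝ ι × EuclideanSpace ℝ ι =>
      ‖p.1 - p.2‖ ^ (((Fintype.card ι : ℝ) + 2 * s) / 2)) := by fun_prop
  exact ((h1.sub h2).aemeasurable.div h3.aemeasurable).aestronglyMeasurable

theorem gagliardoSq_eq_lintegral (s : ℝ) {u : EuclideanSpace ℝ ι → ℝ}
    (hu : AEStronglyMeasurable u volume) :
    gagliardoSq s u = ∫⁻ p, ENNReal.ofReal (fracDiff s u p ^ 2) := by
  rw [Measure.volume_eq_prod, lintegral_prod]
  · simp only [fracDiff_sq]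
    rfl
  · exact ((aestronglyMeasurable_fracDiff s hu).aemeasurable.pow_const 2).ennreal_ofReal

theorem lintegral_ofReal_sq_eq_eLpNorm_sq {α : Type*} [MeasurableSpace α] {μ : Measure α}
    (f : α → ℝ) : ∫⁻ x, ENNReal.ofReal (f x ^ 2) ∂μ = eLpNorm f 2 μ ^ 2 := by
  rw [eLpNorm_eq_lintegral_rpow_enorm_toReal (by norm_num) (by norm_num)]
  simp only [ENNReal.toReal_ofNat, ENNReal.rpow_ofNat]
  rw [← ENNReal.rpow_natCast, ← ENNReal.rpow_mul]
  norm_num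
  refine lintegral_congr fun x => ?_
  rw [Real.enorm_eq_ofReal_abs, ← ENNReal.ofReal_pow (abs_nonneg _), sq_abs]

theorem gagliardoSq_eq_eLpNorm_sq (s : ℝ) {u : EuclideanSpace ℝ ι → ℝ}
    (hu : AEStronglyMeasurable u volume) :
    gagliardoSq s u = eLpNorm (fracDiff s u) 2 volume ^ 2 := by
  rw [gagliardoSq_eq_lintegral s hu, lintegral_ofReal_sq_eq_eLpNorm_sq]

theorem sqrt_gagliardoSq (s : ℝ) {u : EuclideanSpace ℝ ι → ℝ}
    (hu : AEStronglyMeasurable u volume) :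
    gagliardoSq s u ^ (1 / 2 : ℝ) = eLpNorm (fracDiff s u) 2 volume := by
  rw [gagliardoSq_eq_eLpNorm_sq s hu, ← ENNReal.rpow_natCast, ← ENNReal.rpow_mul]
  norm_num

end DifferenceQuotient

/-! ### Test functions have finite energy -/

section TestFunctions

variable {ι : Type} [Fintype ι] {Ω : Set (EuclideanSpace ℝ ι)}

theorem IsTestFunction.continuous {φ : EuclideanSpace ℝ ι → ℝ} (h : IsTestFunction Ω φ) :
    Continuous φ := h.1.continuous

theorem IsTestFunction.memLp {φ : EuclideanSpace ℝ ι → ℝ} (h : IsTestFunction Ω φ) :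
    MemLp φ 2 volume :=
  h.continuous.memLp_of_hasCompactSupport h.2.1

theorem IsTestFunction.eq_zero {φ : EuclideanSpace ℝ ι → ℝ} (h : IsTestFunction Ω φ)
    {x : EuclideanSpace ℝ ι} (hx : x ∉ Ω) : φ x = 0 :=
  image_eq_zero_of_notMem_tsupport fun h' => hx (h.2.2 h')

theorem isTestFunction_zero : IsTestFunction Ω (fun _ => (0 : ℝ)) :=
  ⟨contDiff_const, HasCompactSupport.zero, by
    have : tsupport (fun _ : EuclideanSpace ℝ ι => (0 : ℝ)) = ∅ := tsupport_eq_empty_iff.mpr rfl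
    rw [this]; exact empty_subset _⟩

theorem IsTestFunction.add {φ ψ : EuclideanSpace ℝ ι → ℝ} (h : IsTestFunction Ω φ)
    (h' : IsTestFunction Ω ψ) : IsTestFunction Ω (fun x => φ x + ψ x) :=
  ⟨h.1.add h'.1, h.2.1.add h'.2.1,
    (tsupport_add φ ψ).trans (union_subset h.2.2 h'.2.2)⟩

theorem IsTestFunction.const_mul {φ : EuclideanSpace ℝ ι → ℝ} (h : IsTestFunction Ω φ) (c : ℝ) :
    IsTestFunction Ω (fun x => c * φ x) :=
  ⟨contDiff_const.mul h.1, h.2.1.mul_left, (tsupport_mul_subset_right).trans h.2.2⟩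

/-- The kernel `min (a |z|², b) / |z|^{n+2s}` is integrable for `0 < s < 1`. -/
theorem lintegral_min_sq_div_norm_rpow_lt_top [Nonempty ι] {s : ℝ} (hs0 : 0 < s) (hs1 : s < 1)
    {a b : ℝ} (ha : 0 ≤ a) (hb : 0 ≤ b) :
    ∫⁻ z : EuclideanSpace ℝ ι, ENNReal.ofReal
      (min (a * ‖z‖ ^ 2) b / ‖z‖ ^ ((Fintype.card ι : ℝ) + 2 * s)) < ∞ := by
  set n : ℝ := (Fintype.card ι : ℝ) with hnc
  have hn : (Module.finrank ℝ (EuclideanSpace ℝ ι) : ℝ) = n := by simp [hnc]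
  have hn1 : 1 ≤ Module.finrank ℝ (EuclideanSpace ℝ ι) := by
    rw [finrank_euclideanSpace]; exact Fintype.card_pos
  have hn0 : 0 < n := by rw [← hn]; exact_mod_cast hn1
  have hmeas : Measurable fun z : EuclideanSpace ℝ ι =>
      min (a * ‖z‖ ^ 2) b / ‖z‖ ^ (n + 2 * s) := by fun_prop
  have hmin : ∀ z : EuclideanSpace ℝ ι, 0 ≤ min (a * ‖z‖ ^ 2) b := fun z => by positivity
  -- Near the origin the kernel is at most $a|z|^{-(n+2s-2)}$, integrable since $s<1$; away from it
  -- the bound $b|z|^{-(n+2s)}$ is integrable since $s>0$.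
  have h1 : IntegrableOn (fun z : EuclideanSpace ℝ ι => min (a * ‖z‖ ^ 2) b / ‖z‖ ^ (n + 2 * s))
      (Metric.ball 0 1) := by
    refine integrableOn_ball_of_norm_le_rpow (μ := volume) hn1 (C := a) (α := n + 2 * s - 2)
      (by rw [hn]; linarith) ?_ hmeas.aestronglyMeasurable
    refine Eventually.of_forall fun z => ?_
    rw [Real.norm_of_nonneg (div_nonneg (hmin z) (by positivity))]
    by_cases hz : z = 0
    · subst hz
      simp only [norm_zero]
      rw [Real.zero_rpow (by positivity), div_zero]
      have := Real.rpow_nonneg (le_refl (0 : ℝ)) (-(n + 2 * s - 2))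
      positivity
    · have hz' : 0 < ‖z‖ := norm_pos_iff.mpr hz
      calc _ ≤ a * ‖z‖ ^ 2 / ‖z‖ ^ (n + 2 * s) := by gcongr; exact min_le_left _ _
        _ = a * ‖z‖ ^ (-(n + 2 * s - 2)) := by
          rw [mul_div_assoc, ← Real.rpow_natCast, ← Real.rpow_sub hz']
          congr 2
          push_cast; ring
  have h2 : IntegrableOn (fun z : EuclideanSpace ℝ ι => min (a * ‖z‖ ^ 2) b / ‖z‖ ^ (n + 2 * s))
      (Metric.ball 0 1)ᶜ := by
    have h3 : Integrable (fun z : EuclideanSpace ℝ ι => b * 2 ^ (n + 2 * s) *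
        (1 + ‖z‖) ^ (-(n + 2 * s))) :=
      (integrable_one_add_norm (by rw [hn]; linarith)).const_mul _
    refine Integrable.mono' h3.integrableOn hmeas.aestronglyMeasurable.restrict ?_
    refine (ae_restrict_iff' Metric.isOpen_ball.measurableSet.compl).mpr
      (Eventually.of_forall fun z hz => ?_)
    have hz1 : 1 ≤ ‖z‖ := by simpa using hz
    have hz0 : 0 < ‖z‖ := by linarith
    rw [Real.norm_of_nonneg (div_nonneg (hmin z) (by positivity)), Real.rpow_neg (by positivity),
      mul_assoc, ← div_eq_mul_inv, ← Real.div_rpow (by positivity) (by positivity)]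
    calc _ ≤ b / ‖z‖ ^ (n + 2 * s) := by gcongr; exact min_le_right _ _
      _ = b * (1 / ‖z‖) ^ (n + 2 * s) := by
        rw [Real.div_rpow zero_le_one hz0.le, Real.one_rpow]; ring
      _ ≤ b * (2 / (1 + ‖z‖)) ^ (n + 2 * s) := by
        gcongr ?_ * ?_ ^ _
        rw [div_le_div_iff₀ hz0 (by positivity)]
        linarith
  have h := (integrableOn_univ.mp (by simpa using h1.union h2)).lintegral_lt_top
  exact h

/-- Lipschitz continuity and boundedness give $(\varphi(x)-\varphi(y))^2\le\min(L^2|x-y|^2,(2M)^2)$,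
and the difference vanishes unless $x$ or $y$ lies in the support. The double integral is then at
most twice the measure of the support times the integral of the kernel above. -/
theorem IsTestFunction.gagliardoSq_lt_top [Nonempty ι] {s : ℝ} (hs0 : 0 < s) (hs1 : s < 1)
    {φ : EuclideanSpace ℝ ι → ℝ} (h : IsTestFunction Ω φ) : gagliardoSq s φ < ∞ := by
  obtain ⟨Lc, hL⟩ := ContDiff.lipschitzWith_of_hasCompactSupport (𝕂 := ℝ) h.2.1 h.1 (by simp)
  obtain ⟨M, hM⟩ := h.2.1.exists_bound_of_continuous h.continuous
  set r : ℝ := (Fintype.card ι : ℝ) + 2 * s with hr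
  let g : EuclideanSpace ℝ ι → ℝ≥0∞ := fun z =>
    ENNReal.ofReal (min ((Lc : ℝ) ^ 2 * ‖z‖ ^ 2) ((2 * M) ^ 2) / ‖z‖ ^ r)
  have hgm : Measurable g := by fun_prop
  have hg : ∫⁻ z, g z < ∞ := lintegral_min_sq_div_norm_rpow_lt_top hs0 hs1 (by positivity)
    (by positivity)
  let k : EuclideanSpace ℝ ι → ℝ≥0∞ := (tsupport φ).indicator 1
  have hk : ∫⁻ x, k x < ∞ := by
    rw [lintegral_indicator_one h.2.1.isCompact.measurableSet]
    exact h.2.1.isCompact.measure_lt_top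
  have hkm : Measurable k := measurable_one.indicator h.2.1.isCompact.measurableSet
  have hbd : ∀ x y, ENNReal.ofReal ((φ x - φ y) ^ 2 / ‖x - y‖ ^ r) ≤
      k x * g (x - y) + k y * g (x - y) := by
    intro x y
    have hle : ENNReal.ofReal ((φ x - φ y) ^ 2 / ‖x - y‖ ^ r) ≤ g (x - y) := by
      apply ENNReal.ofReal_le_ofReal
      gcongr
      apply le_min
      · rw [← mul_pow]
        rw [sq_le_sq, abs_of_nonneg (a := (Lc : ℝ) * _) (by positivity), ← Real.norm_eq_abs]
        simpa [dist_eq_norm] using hL.dist_le_mul x y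
      · have h1 := hM x
        have h2 := hM y
        have h3 : ‖φ x - φ y‖ ≤ 2 * M := (norm_sub_le _ _).trans (by linarith)
        rw [sq_le_sq, ← Real.norm_eq_abs]
        exact h3.trans (le_abs_self _)
    by_cases hx : x ∈ tsupport φ
    · simp only [k, indicator_of_mem hx, Pi.one_apply, one_mul]
      exact hle.trans le_self_add
    · by_cases hy : y ∈ tsupport φ
      · simp only [k, indicator_of_mem hy, Pi.one_apply, one_mul]
        exact hle.trans le_add_self
      · rw [image_eq_zero_of_notMem_tsupport hx, image_eq_zero_of_notMem_tsupport hy]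
        simp
  have hA : ∫⁻ x, ∫⁻ y, k x * g (x - y) = (∫⁻ x, k x) * ∫⁻ z, g z := by
    have : ∀ x, ∫⁻ y, k x * g (x - y) = k x * ∫⁻ z, g z := fun x => by
      rw [lintegral_const_mul _ (by fun_prop), lintegral_sub_left_eq_self (μ := volume) g x]
    simp_rw [this]
    rw [lintegral_mul_const _ hkm]
  have hB : ∫⁻ x, ∫⁻ y, k y * g (x - y) = (∫⁻ x, k x) * ∫⁻ z, g z := by
    rw [lintegral_lintegral_swap (by fun_prop)]
    have : ∀ y, ∫⁻ x, k y * g (x - y) = k y * ∫⁻ z, g z := fun y => by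
      rw [lintegral_const_mul _ (by fun_prop), lintegral_sub_right_eq_self (μ := volume) g y]
    simp_rw [this]
    rw [lintegral_mul_const _ hkm]
  calc gagliardoSq s φ ≤ ∫⁻ x, ∫⁻ y, (k x * g (x - y) + k y * g (x - y)) :=
        lintegral_mono fun x => lintegral_mono fun y => hbd x y
    _ = ∫⁻ x, (∫⁻ y, k x * g (x - y)) + ∫⁻ y, k y * g (x - y) := by
        refine lintegral_congr fun x => ?_
        rw [lintegral_add_left (by fun_prop)]
    _ = (∫⁻ x, k x) * (∫⁻ z, g z) + (∫⁻ x, k x) * ∫⁻ z, g z := by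
        rw [lintegral_add_left, hA, hB]
        fun_prop
    _ < ∞ := by
        have := ENNReal.mul_lt_top hk hg
        exact ENNReal.add_lt_top.mpr ⟨this, this⟩

theorem IsTestFunction.memLp_fracDiff [Nonempty ι] {s : ℝ} (hs0 : 0 < s) (hs1 : s < 1)
    {φ : EuclideanSpace ℝ ι → ℝ} (h : IsTestFunction Ω φ) : MemLp (fracDiff s φ) 2 volume := by
  refine ⟨aestronglyMeasurable_fracDiff s h.continuous.aestronglyMeasurable, ?_⟩
  have h1 := h.gagliardoSq_lt_top hs0 hs1
  rw [gagliardoSq_eq_eLpNorm_sq s h.continuous.aestronglyMeasurable] at h1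
  by_contra hc
  rw [not_lt, top_le_iff] at hc
  rw [hc] at h1
  simp at h1

end TestFunctions

/-! ### The space $H^s_\Omega$ as a closed graph in $L^2\times L^2$ -/

section FormDomain

open scoped InnerProductSpace

variable {ι : Type} [Fintype ι]

/-- The Hilbert space containing the graph of `u ↦ fracDiff s u`. -/
abbrev GraphSpace (ι : Type) [Fintype ι] : Type :=
  WithLp 2 (Lp ℝ 2 (volume : Measure (EuclideanSpace ℝ ι)) ×
    Lp ℝ 2 (volume : Measure (EuclideanSpace ℝ ι × EuclideanSpace ℝ ι)))

/-- The graph of `fracDiff s` over the test functions of `Ω`. -/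
def testGraph (s : ℝ) (Ω : Set (EuclideanSpace ℝ ι)) : Submodule ℝ (GraphSpace ι) where
  carrier := {z | ∃ φ, IsTestFunction Ω φ ∧ z.fst =ᵐ[volume] φ ∧ z.snd =ᵐ[volume] fracDiff s φ}
  add_mem' := by
    rintro z w ⟨φ, hφ, h1, h2⟩ ⟨ψ, hψ, h3, h4⟩
    refine ⟨_, hφ.add hψ, ?_, ?_⟩
    · filter_upwards [Lp.coeFn_add z.fst w.fst, h1, h3] with x hx h1 h3
      rw [WithLp.add_fst, hx, Pi.add_apply, h1, h3]
    · filter_upwards [Lp.coeFn_add z.snd w.snd, h2, h4] with x hx h2 h4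
      rw [WithLp.add_snd, hx, Pi.add_apply, h2, h4, fracDiff_add]
  zero_mem' := by
    refine ⟨_, isTestFunction_zero, ?_, ?_⟩
    · exact Lp.coeFn_zero _ _ _
    · refine (Lp.coeFn_zero ℝ 2 volume).trans (Eventually.of_forall fun p => ?_)
      simp [fracDiff]
  smul_mem' := by
    rintro c z ⟨φ, hφ, h1, h2⟩
    refine ⟨_, hφ.const_mul c, ?_, ?_⟩
    · filter_upwards [Lp.coeFn_smul c z.fst, h1] with x hx h1
      rw [WithLp.smul_fst, hx, Pi.smul_apply, h1, smul_eq_mul]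
    · filter_upwards [Lp.coeFn_smul c z.snd, h2] with x hx h2
      rw [WithLp.smul_snd, hx, Pi.smul_apply, h2, smul_eq_mul, fracDiff_const_mul]

/-- The form domain `H^s_Ω`, as the closure of the graph of `fracDiff s` over the test functions. -/
def formDomain (s : ℝ) (Ω : Set (EuclideanSpace ℝ ι)) : Submodule ℝ (GraphSpace ι) :=
  (testGraph s Ω).topologicalClosure

variable {s : ℝ} {Ω : Set (EuclideanSpace ℝ ι)}

instance : CompleteSpace (formDomain s Ω) :=
  (Submodule.isClosed_topologicalClosure _).completeSpace_coe

/-- The map `fracDiff s` is closable: along a subsequence both components converge almost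
everywhere, and differences pass to the limit pointwise. Vanishing outside $\Omega$ passes to the
limit in the same way. -/
theorem ae_eq_of_mem_formDomain {z : GraphSpace ι} (hz : z ∈ formDomain s Ω) :
    z.snd =ᵐ[volume] fracDiff s z.fst ∧ ∀ᵐ x, x ∉ Ω → z.fst x = 0 := by
  obtain ⟨w, hw, hlim⟩ := mem_closure_iff_seq_limit.mp hz
  choose φ hφ h1 h2 using hw
  have hfst : Tendsto (fun n => (w n).fst) atTop (𝓝 z.fst) :=
    ((WithLp.fstL 2 ℝ _ _).continuous.tendsto z).comp hlim
  obtain ⟨a, ha, ha'⟩ := (tendstoInMeasure_of_tendsto_Lp hfst).exists_seq_tendsto_ae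
  have hsnd : Tendsto (fun n => (w (a n)).snd) atTop (𝓝 z.snd) :=
    ((WithLp.sndL 2 ℝ _ _).continuous.tendsto z).comp (hlim.comp ha.tendsto_atTop)
  obtain ⟨b, hb, hb'⟩ := (tendstoInMeasure_of_tendsto_Lp hsnd).exists_seq_tendsto_ae
  have h1' : ∀ᵐ x, ∀ n, (w n).fst x = φ n x := ae_all_iff.mpr h1
  have h2' : ∀ᵐ p, ∀ n, (w n).snd p = fracDiff s (φ n) p := ae_all_iff.mpr h2
  have hφlim : ∀ᵐ x, Tendsto (fun i => φ (a i) x) atTop (𝓝 (z.fst x)) := by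
    filter_upwards [ha', h1'] with x hx h1x
    simpa only [h1x] using hx
  refine ⟨?_, ?_⟩
  · filter_upwards [hb', h2', ae_prod_of_ae hφlim] with p hp h2p hφp
    simp only [h2p] at hp
    refine tendsto_nhds_unique hp ?_
    exact ((hφp.1.sub hφp.2).div_const _).comp hb.tendsto_atTop
  · filter_upwards [hφlim] with x hx hxΩ
    refine tendsto_nhds_unique hx ?_
    simp only [(hφ _).eq_zero hxΩ]
    exact tendsto_const_nhds

theorem GraphSpace.norm_le_fst_add_snd (z : GraphSpace ι) : ‖z‖ ≤ ‖z.fst‖ + ‖z.snd‖ := by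
  have := WithLp.prod_norm_sq_eq_of_L2 z
  refine le_of_sq_le_sq ?_ (by positivity)
  nlinarith [norm_nonneg z.fst, norm_nonneg z.snd]

theorem GraphSpace.norm_fst_le (z : GraphSpace ι) : ‖z.fst‖ ≤ ‖z‖ := by
  have := WithLp.prod_norm_sq_eq_of_L2 z
  refine le_of_sq_le_sq ?_ (by positivity)
  nlinarith [sq_nonneg ‖z.snd‖]

theorem GraphSpace.norm_snd_le (z : GraphSpace ι) : ‖z.snd‖ ≤ ‖z‖ := by
  have := WithLp.prod_norm_sq_eq_of_L2 z
  refine le_of_sq_le_sq ?_ (by positivity)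
  nlinarith [sq_nonneg ‖z.fst‖]

/-- The element of the form domain given by a test function. -/
def IsTestFunction.toGraph [Nonempty ι] (hs0 : 0 < s) (hs1 : s < 1) {φ : EuclideanSpace ℝ ι → ℝ}
    (h : IsTestFunction Ω φ) : GraphSpace ι :=
  WithLp.toLp 2 (h.memLp.toLp φ, (h.memLp_fracDiff hs0 hs1).toLp _)

theorem IsTestFunction.toGraph_mem_testGraph [Nonempty ι] (hs0 : 0 < s) (hs1 : s < 1)
    {φ : EuclideanSpace ℝ ι → ℝ} (h : IsTestFunction Ω φ) :
    h.toGraph hs0 hs1 ∈ testGraph s Ω :=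
  ⟨φ, h, h.memLp.coeFn_toLp, (h.memLp_fracDiff hs0 hs1).coeFn_toLp⟩

theorem IsTestFunction.toGraph_mem [Nonempty ι] (hs0 : 0 < s) (hs1 : s < 1)
    {φ : EuclideanSpace ℝ ι → ℝ} (h : IsTestFunction Ω φ) :
    h.toGraph hs0 hs1 ∈ formDomain s Ω :=
  Submodule.le_topologicalClosure _ (h.toGraph_mem_testGraph hs0 hs1)

/-- The norm defining $H^s_\Omega$ is $\|u\|_{L^2}+\|$`fracDiff s u`$\|_{L^2}$, which is equivalent
to the graph norm. For a member $u$ of `fracSobolev`, `fracDiff s u` is square integrable because it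
differs from that of some test function by a square integrable function. -/
theorem mem_fracSobolev_iff [Nonempty ι] (hs0 : 0 < s) (hs1 : s < 1)
    {u : Lp ℝ 2 (volume : Measure (EuclideanSpace ℝ ι))} :
    u ∈ fracSobolev s Ω ↔ ∃ z ∈ formDomain s Ω, z.fst = u := by
  have hmeas : ∀ {φ : EuclideanSpace ℝ ι → ℝ}, IsTestFunction Ω φ →
      AEStronglyMeasurable (fun x => u x - φ x) volume := fun h =>
    (Lp.aestronglyMeasurable u).sub h.continuous.aestronglyMeasurable
  constructor
  · intro hu
    have hD : MemLp (fracDiff s u) 2 volume := by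
      obtain ⟨φ, hφ, hlt⟩ := hu 1 one_pos
      rw [sqrt_gagliardoSq s (hmeas hφ)] at hlt
      have h1 : MemLp (fracDiff s (fun x => u x - φ x)) 2 volume :=
        ⟨aestronglyMeasurable_fracDiff s (hmeas hφ),
          (le_add_self.trans_lt hlt).trans ENNReal.one_lt_top⟩
      have h2 := h1.add (hφ.memLp_fracDiff hs0 hs1)
      refine h2.congr_norm (aestronglyMeasurable_fracDiff s (Lp.aestronglyMeasurable u))
        (Eventually.of_forall fun p => ?_)
      rw [fracDiff_sub]
      simp
    refine ⟨WithLp.toLp 2 (u, hD.toLp _), ?_, rfl⟩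
    refine Metric.mem_closure_iff.mpr fun ε hε => ?_
    obtain ⟨φ, hφ, hlt⟩ := hu (ENNReal.ofReal ε) (ENNReal.ofReal_pos.mpr hε)
    refine ⟨hφ.toGraph hs0 hs1, hφ.toGraph_mem_testGraph hs0 hs1, ?_⟩
    rw [sqrt_gagliardoSq s (hmeas hφ)] at hlt
    rw [dist_eq_norm]
    refine (GraphSpace.norm_le_fst_add_snd _).trans_lt ?_
    have e1 : ENNReal.ofReal ‖u - hφ.memLp.toLp φ‖ =
        eLpNorm (fun x => u x - φ x) 2 volume := by
      rw [ofReal_norm, Lp.enorm_def]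
      refine eLpNorm_congr_ae ?_
      filter_upwards [Lp.coeFn_sub u (hφ.memLp.toLp φ), hφ.memLp.coeFn_toLp] with x h1 h2
      rw [h1, Pi.sub_apply, h2]
    have e2 : ENNReal.ofReal ‖hD.toLp _ - (hφ.memLp_fracDiff hs0 hs1).toLp _‖ =
        eLpNorm (fracDiff s (fun x => u x - φ x)) 2 volume := by
      rw [ofReal_norm, ← MemLp.toLp_sub, Lp.enorm_toLp, fracDiff_sub]
      rfl
    rw [← e1, ← e2, ← ENNReal.ofReal_add (norm_nonneg _) (norm_nonneg _)] at hlt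
    exact (ENNReal.ofReal_lt_ofReal_iff hε).mp hlt
  · rintro ⟨z, hz, rfl⟩ ε hε
    obtain ⟨δ, hδ0, hδ⟩ : ∃ δ : ℝ, 0 < δ ∧ ENNReal.ofReal δ + ENNReal.ofReal δ < ε := by
      obtain ⟨r, hr0, hr⟩ := ENNReal.lt_iff_exists_nnreal_btwn.mp hε
      refine ⟨(r : ℝ) / 2, by have : (0 : ℝ) < r := by exact_mod_cast hr0
                              positivity, ?_⟩
      rw [← ENNReal.ofReal_add (by positivity) (by positivity), add_halves,
        ENNReal.ofReal_coe_nnreal]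
      exact hr
    obtain ⟨w, ⟨φ, hφ, h1, h2⟩, hw⟩ := Metric.mem_closure_iff.mp hz δ hδ0
    refine ⟨φ, hφ, ?_⟩
    rw [sqrt_gagliardoSq s (hmeas hφ)]
    rw [dist_eq_norm] at hw
    refine (add_le_add ?_ ?_).trans_lt hδ
    · have e1 : eLpNorm (fun x => z.fst x - φ x) 2 volume = ENNReal.ofReal ‖(z - w).fst‖ := by
        rw [ofReal_norm, Lp.enorm_def]
        refine eLpNorm_congr_ae ?_
        filter_upwards [Lp.coeFn_sub z.fst w.fst, h1] with x h3 h4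
        rw [WithLp.sub_fst, h3, Pi.sub_apply, h4]
      rw [e1]
      exact ENNReal.ofReal_le_ofReal ((GraphSpace.norm_fst_le _).trans hw.le)
    · have e2 : eLpNorm (fracDiff s (fun x => z.fst x - φ x)) 2 volume =
          ENNReal.ofReal ‖(z - w).snd‖ := by
        rw [ofReal_norm, Lp.enorm_def]
        refine eLpNorm_congr_ae ?_
        filter_upwards [Lp.coeFn_sub z.snd w.snd, h2, (ae_eq_of_mem_formDomain hz).1]
          with p h3 h4 h5
        rw [WithLp.sub_snd, h3, Pi.sub_apply, h4, h5, fracDiff_sub]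
      rw [e2]
      exact ENNReal.ofReal_le_ofReal ((GraphSpace.norm_snd_le _).trans hw.le)

theorem fracForm_eq_inner {z w : GraphSpace ι} (hz : z ∈ formDomain s Ω)
    (hw : w ∈ formDomain s Ω) :
    fracForm s z.fst w.fst = fracLaplaceConst (Fintype.card ι) s / 2 * ⟪z.snd, w.snd⟫_ℝ := by
  rw [fracForm, L2.inner_def]
  congr 1
  refine integral_congr_ae ?_
  filter_upwards [(ae_eq_of_mem_formDomain hz).1, (ae_eq_of_mem_formDomain hw).1] with p h1 h2
  rw [h1, h2, ← fracDiff_mul]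
  exact mul_comm _ _

theorem setIntegral_mul_eq_inner {z w : GraphSpace ι} (hz : z ∈ formDomain s Ω) :
    ∫ x in Ω, z.fst x * w.fst x = ⟪z.fst, w.fst⟫_ℝ := by
  rw [L2.inner_def, setIntegral_eq_integral_of_ae_compl_eq_zero]
  · refine integral_congr_ae (Eventually.of_forall fun x => ?_)
    simp [mul_comm]
  · filter_upwards [(ae_eq_of_mem_formDomain hz).2] with x hx hxΩ
    rw [hx hxΩ, zero_mul]

/-- The embedding of the form domain into `L²`. -/
def formEmbedding (s : ℝ) (Ω : Set (EuclideanSpace ℝ ι)) :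
    formDomain s Ω →L[ℝ] Lp ℝ 2 (volume : Measure (EuclideanSpace ℝ ι)) :=
  (WithLp.fstL 2 ℝ _ _).comp (formDomain s Ω).subtypeL

theorem formEmbedding_apply (z : formDomain s Ω) : formEmbedding s Ω z = (z : GraphSpace ι).fst :=
  rfl

/-- Closability again: the second component is determined by the first. -/
theorem formEmbedding_injective : Function.Injective (formEmbedding s Ω) := by
  rintro ⟨z, hz⟩ ⟨w, hw⟩ h
  apply Subtype.ext
  change z.fst = w.fst at h
  have h2 : z.snd = w.snd := by
    apply Lp.ext
    filter_upwards [(ae_eq_of_mem_formDomain hz).1, (ae_eq_of_mem_formDomain hw).1] with p h1 h2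
    rw [h1, h2, h]
  exact (WithLp.ofLp_injective 2) (Prod.ext h h2)

theorem fracLaplaceConst_pos (n : ℕ) {s : ℝ} (hs0 : 0 < s) (hs1 : s < 1) :
    0 < fracLaplaceConst n s := by
  have h1 : 0 < Real.Gamma ((n : ℝ) / 2 + s) := Real.Gamma_pos_of_pos (by positivity)
  have h2 : Real.Gamma (-s) ≠ 0 := by
    refine Real.Gamma_ne_zero fun m hm => ?_
    have : s = m := by linarith
    rw [this] at hs0 hs1
    have h3 : 0 < m := by exact_mod_cast hs0
    have h4 : m < 1 := by exact_mod_cast hs1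
    omega
  rw [fracLaplaceConst]
  have := abs_pos.mpr h2
  positivity

/-- Dirichlet eigenfunctions correspond to eigenvectors relative to the embedding of the form
domain into `L²`, after an affine change of the eigenvalue. -/
theorem isDirichletEigenfunction_iff [Nonempty ι] (hs0 : 0 < s) (hs1 : s < 1) {μ : ℝ}
    {u : Lp ℝ 2 (volume : Measure (EuclideanSpace ℝ ι))} :
    IsDirichletEigenfunction s Ω μ u ↔ ∃ z : formDomain s Ω, formEmbedding s Ω z = u ∧
      IsFormEigenvector (formEmbedding s Ω)
        (1 + μ / (fracLaplaceConst (Fintype.card ι) s / 2)) z := by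
  set c := fracLaplaceConst (Fintype.card ι) s / 2 with hcdef
  have hc : 0 < c := half_pos (fracLaplaceConst_pos _ hs0 hs1)
  -- The graph inner product is $\langle u,v\rangle_{L^2}+c^{-1}\mathcal E(u,v)$, so $\mathcal
  -- E(u,v)=\mu\langle u,v\rangle$ amounts to an eigenvalue $1+\mu/c$.
  have key : ∀ z w : formDomain s Ω,
      (⟪z, w⟫_ℝ = (1 + μ / c) * ⟪formEmbedding s Ω z, formEmbedding s Ω w⟫_ℝ ↔
      fracForm s (formEmbedding s Ω z) (formEmbedding s Ω w) =
        μ * ∫ x in Ω, formEmbedding s Ω z x * formEmbedding s Ω w x) := by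
    intro z w
    have e1 : ⟪z, w⟫_ℝ = ⟪(z : GraphSpace ι).fst, (w : GraphSpace ι).fst⟫_ℝ +
      ⟪(z : GraphSpace ι).snd, (w : GraphSpace ι).snd⟫_ℝ := rfl
    rw [formEmbedding_apply, formEmbedding_apply, fracForm_eq_inner z.2 w.2,
      setIntegral_mul_eq_inner z.2, e1, ← hcdef]
    constructor
    · intro h
      have : ⟪(z : GraphSpace ι).snd, (w : GraphSpace ι).snd⟫_ℝ =
        μ / c * ⟪(z : GraphSpace ι).fst, (w : GraphSpace ι).fst⟫_ℝ := by linarith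
      rw [this]; field_simp
    · intro h
      rw [add_mul, one_mul, add_right_inj, div_mul_eq_mul_div, ← h]
      field_simp
  constructor
  · rintro ⟨hu, hu0, h⟩
    obtain ⟨z, hz, rfl⟩ := (mem_fracSobolev_iff hs0 hs1).mp hu
    refine ⟨⟨z, hz⟩, rfl, ?_, fun w => (key _ w).mpr (h _ ?_)⟩
    · intro h0
      apply hu0
      have := congrArg (formEmbedding s Ω) h0
      rwa [map_zero] at this
    · exact (mem_fracSobolev_iff hs0 hs1).mpr ⟨w, w.2, rfl⟩
  · rintro ⟨z, rfl, hz0, h⟩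
    refine ⟨(mem_fracSobolev_iff hs0 hs1).mpr ⟨z, z.2, rfl⟩, ?_, ?_⟩
    · intro h0
      exact hz0 (formEmbedding_injective (h0.trans (map_zero _).symm))
    · intro v hv
      obtain ⟨w, hw, rfl⟩ := (mem_fracSobolev_iff hs0 hs1).mp hv
      exact (key z ⟨w, hw⟩).mp (h ⟨w, hw⟩)

end FormDomain

/-! ### Averaging over finitely many sets, a finite rank operator -/

section Averaging

open scoped InnerProductSpace

variable {X : Type*} [MeasurableSpace X] {μ : Measure X}

/-- Jensen's inequality for the mean over a set of finite measure `V`. -/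
theorem ofReal_sub_average_sq_le {Q : Set X} {V : ℝ} (hV : 0 < V) (hQ : μ Q = ENNReal.ofReal V)
    {u : X → ℝ} (hu : MemLp u 2 (μ.restrict Q)) (c : ℝ) :
    ENNReal.ofReal ((c - V⁻¹ * ∫ y in Q, u y ∂μ) ^ 2) ≤
      ENNReal.ofReal V⁻¹ * ∫⁻ y in Q, ENNReal.ofReal ((c - u y) ^ 2) ∂μ := by
  have hfin : IsFiniteMeasure (μ.restrict Q) :=
    ⟨by rw [Measure.restrict_apply_univ, hQ]; exact ENNReal.ofReal_lt_top⟩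
  have hreal : (μ.restrict Q).real univ = V := by
    rw [measureReal_def, Measure.restrict_apply_univ, hQ, ENNReal.toReal_ofReal hV.le]
  have hf : MemLp (fun y => c - u y) 2 (μ.restrict Q) := (memLp_const c).sub hu
  have hf1 : Integrable (fun y => c - u y) (μ.restrict Q) := hf.integrable (by norm_num)
  have hf2 : Integrable (fun y => (c - u y) ^ 2) (μ.restrict Q) := hf.integrable_sq
  have hu1 : Integrable u (μ.restrict Q) := hu.integrable (by norm_num)
  rw [← ofReal_integral_eq_lintegral_ofReal hf2 (Eventually.of_forall fun y => sq_nonneg _),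
    ← ENNReal.ofReal_mul (by positivity)]
  apply ENNReal.ofReal_le_ofReal
  set m := V⁻¹ * ∫ y in Q, (c - u y) ∂μ with hm
  have hmean : c - V⁻¹ * ∫ y in Q, u y ∂μ = m := by
    rw [hm, integral_sub (integrable_const c) hu1, integral_const, hreal, smul_eq_mul]
    field_simp
  have hI : ∫ y in Q, (c - u y) ∂μ = V * m := by rw [hm]; field_simp
  -- The variance of $c-u$ about its mean $m$ is nonnegative; expanding it gives
  -- $Vm^2\le\int_Q(c-u)^2$.
  have h0 : 0 ≤ ∫ y in Q, (c - u y - m) ^ 2 ∂μ := integral_nonneg fun y => sq_nonneg _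
  have h1 : ∫ y in Q, (c - u y - m) ^ 2 ∂μ =
      ∫ y in Q, ((c - u y) ^ 2 - 2 * m * (c - u y) + m ^ 2) ∂μ := by
    congr 1; ext y; ring
  have h2 : Integrable (fun y => (c - u y) ^ 2 - 2 * m * (c - u y)) (μ.restrict Q) :=
    hf2.sub (hf1.const_mul _)
  rw [h1, integral_add h2 (integrable_const _),
    integral_sub hf2 (hf1.const_mul _), integral_const_mul, hI, integral_const, hreal,
    smul_eq_mul] at h0
  rw [hmean, inv_mul_eq_div, le_div_iff₀ hV]
  linarith

/-- The finite rank operator replacing a function by `V⁻¹` times its integral on each of the sets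
`Q a`, `a ∈ F`. -/
def averaging {α : Type*} (F : Finset α) {Q : α → Set X} (hm : ∀ a, MeasurableSet (Q a))
    (hfin : ∀ a, μ (Q a) ≠ ∞) (V : ℝ) : Lp ℝ 2 μ →L[ℝ] Lp ℝ 2 μ :=
  ∑ a ∈ F, V⁻¹ • (innerSL ℝ (indicatorConstLp 2 (hm a) (hfin a) (1 : ℝ))).smulRight
    (indicatorConstLp 2 (hm a) (hfin a) (1 : ℝ))

theorem isCompactOperator_averaging {α : Type*} (F : Finset α) {Q : α → Set X}
    (hm : ∀ a, MeasurableSet (Q a)) (hfin : ∀ a, μ (Q a) ≠ ∞) (V : ℝ) :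
    IsCompactOperator (averaging F hm hfin V) := by
  classical
  unfold averaging
  induction F using Finset.induction_on with
  | empty => simpa using isCompactOperator_zero
  | insert a F ha ih =>
    rw [Finset.sum_insert ha]
    refine IsCompactOperator.add ?_ ih
    refine IsCompactOperator.smul ?_ _
    exact (isCompactOperator_of_locallyCompactSpace_rng
      (ContinuousLinearMap.toSpanSingleton ℝ _)).comp_clm
        (innerSL ℝ (indicatorConstLp 2 (hm a) (hfin a) (1 : ℝ)))

theorem averaging_coeFn {α : Type*} (F : Finset α) {Q : α → Set X}
    (hm : ∀ a, MeasurableSet (Q a)) (hfin : ∀ a, μ (Q a) ≠ ∞) (V : ℝ) (u : Lp ℝ 2 μ) :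
    averaging F hm hfin V u =ᵐ[μ]
      fun x => ∑ a ∈ F, (Q a).indicator (fun _ => V⁻¹ * ∫ y in Q a, u y ∂μ) x := by
  classical
  unfold averaging
  induction F using Finset.induction_on with
  | empty =>
    simp only [Finset.sum_empty]
    exact Lp.coeFn_zero ℝ 2 μ
  | insert a F ha ih =>
    rw [Finset.sum_insert ha, _root_.add_apply]
    refine (Lp.coeFn_add _ _).trans ?_
    rw [_root_.smul_apply, ContinuousLinearMap.smulRight_apply, innerSL_apply_apply,
      L2.inner_indicatorConstLp_one, smul_smul]
    filter_upwards [ih, Lp.coeFn_smul (V⁻¹ * ∫ y in Q a, u y ∂μ)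
      (indicatorConstLp 2 (hm a) (hfin a) (1 : ℝ)),
      indicatorConstLp_coeFn (p := 2) (hs := hm a) (hμs := hfin a) (c := (1 : ℝ))]
      with x h1 h2 h3
    rw [Pi.add_apply, h1, h2, Pi.smul_apply, h3, Finset.sum_insert ha]
    congr 1
    by_cases hx : x ∈ Q a <;> simp [hx]

end Averaging

/-! ### Rellich's theorem by averaging over the cells of a grid -/

section CompactEmbedding

variable {ι : Type} [Fintype ι] {s : ℝ} {Ω : Set (EuclideanSpace ℝ ι)}

/-- By Jensen, $|u(x)-\bar u|^2$ is at most the mean of $|u(x)-u(y)|^2$ over the cell of $x$. There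
$|x-y|\le D$, so inserting the factor $D^{n+2s}/|x-y|^{n+2s}\ge1$ bounds this by the singular
integrand; the cells are disjoint, so the sum is at most the full Gagliardo integral. -/
theorem norm_sub_averaging_sq_le (hs0 : 0 < s) {α : Type*} (F : Finset α)
    {Q : α → Set (EuclideanSpace ℝ ι)} (hm : ∀ a, MeasurableSet (Q a)) {V : ℝ} (hV : 0 < V)
    (hQ : ∀ a, volume (Q a) = ENNReal.ofReal V) (hfin : ∀ a, volume (Q a) ≠ ∞)
    (hdis : ∀ a b, a ≠ b → Disjoint (Q a) (Q b)) {D : ℝ}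
    (hD0 : 0 ≤ D) (hD : ∀ a, ∀ x ∈ Q a, ∀ y ∈ Q a, ‖x - y‖ ≤ D) (hcov : Ω ⊆ ⋃ a ∈ F, Q a)
    {z : GraphSpace ι} (hz : z ∈ formDomain s Ω) :
    ‖z.fst - averaging F hm hfin V z.fst‖ ^ 2 ≤
      V⁻¹ * D ^ ((Fintype.card ι : ℝ) + 2 * s) * ‖z.snd‖ ^ 2 := by
  classical
  set u := z.fst with hu
  set r : ℝ := (Fintype.card ι : ℝ) + 2 * s with hr
  have hr0 : 0 < r := by positivity
  obtain ⟨hz1, hz2⟩ := ae_eq_of_mem_formDomain hz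
  have hmean : ∀ a ∈ F, ∀ x ∈ Q a, ∑ b ∈ F, (Q b).indicator (fun _ => V⁻¹ * ∫ y in Q b, u y) x
      = V⁻¹ * ∫ y in Q a, u y := by
    intro a ha x hx
    rw [Finset.sum_eq_single_of_mem a ha, indicator_of_mem hx]
    intro b _ hb
    exact indicator_of_notMem (fun hxb => (hdis b a hb).le_bot ⟨hxb, hx⟩) _
  set U := ⋃ a ∈ F, Q a with hUdef
  have hUm : MeasurableSet U := F.measurableSet_biUnion fun a _ => hm a
  let g : EuclideanSpace ℝ ι → ℝ := fun x => u x - ∑ b ∈ F,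
    (Q b).indicator (fun _ => V⁻¹ * ∫ y in Q b, u y) x
  have hg : ⇑(u - averaging F hm hfin V u) =ᵐ[volume] g := by
    filter_upwards [Lp.coeFn_sub u (averaging F hm hfin V u), averaging_coeFn F hm hfin V u]
      with x h1 h2
    rw [h1, Pi.sub_apply, h2]
  have hg0 : ∀ᵐ x, x ∈ Uᶜ → g x = 0 := by
    filter_upwards [hz2] with x hx hxU
    have h1 : ∀ b ∈ F, x ∉ Q b := fun b hb hxb => hxU (mem_biUnion hb hxb)
    simp only [g]
    rw [hx fun h => hxU (hcov h), Finset.sum_eq_zero fun b hb => indicator_of_notMem (h1 b hb) _,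
      sub_zero]
  have hDu : ∀ p, ENNReal.ofReal (fracDiff s u p ^ 2) =
      ENNReal.ofReal ((u p.1 - u p.2) ^ 2 / ‖p.1 - p.2‖ ^ r) := fun p => by rw [fracDiff_sq]
  have hbound : ∀ a ∈ F, ∫⁻ x in Q a, ENNReal.ofReal (g x ^ 2) ≤
      ENNReal.ofReal (V⁻¹ * D ^ r) * ∫⁻ x in Q a, ∫⁻ y,
        ENNReal.ofReal ((u x - u y) ^ 2 / ‖x - y‖ ^ r) := by
    intro a ha
    rw [← lintegral_const_mul' _ _ ENNReal.ofReal_ne_top]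
    refine setLIntegral_mono' (hm a) fun x hx => ?_
    have h1 : g x = u x - V⁻¹ * ∫ y in Q a, u y := by simp only [g]; rw [hmean a ha x hx]
    rw [h1]
    refine (ofReal_sub_average_sq_le hV (hQ a) ((Lp.memLp u).restrict _) (u x)).trans ?_
    rw [ENNReal.ofReal_mul (by positivity), mul_assoc]
    gcongr
    rw [← lintegral_const_mul' _ _ ENNReal.ofReal_ne_top]
    refine (setLIntegral_mono' (hm a) fun y hy => ?_).trans (setLIntegral_le_lintegral _ _)
    rw [← ENNReal.ofReal_mul (by positivity)]
    apply ENNReal.ofReal_le_ofReal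
    by_cases hxy : x = y
    · subst hxy; simp
    · have h2 : 0 < ‖x - y‖ := norm_pos_iff.mpr (sub_ne_zero.mpr hxy)
      have h3 : ‖x - y‖ ^ r ≤ D ^ r := by
        gcongr; exact hD a x hx y hy
      have h4 : 0 < ‖x - y‖ ^ r := by positivity
      rw [mul_div_assoc', le_div_iff₀ h4, mul_comm (D ^ r)]
      gcongr
  have hsum : ∫⁻ x, ENNReal.ofReal (g x ^ 2) ≤
      ENNReal.ofReal (V⁻¹ * D ^ r) * gagliardoSq s u := by
    have h1 : ∫⁻ x in Uᶜ, ENNReal.ofReal (g x ^ 2) = 0 := by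
      rw [setLIntegral_congr_fun_ae hUm.compl (g := fun _ => 0)]
      · simp
      · filter_upwards [hg0] with x hx hxU
        simp [hx hxU]
    rw [← lintegral_add_compl _ hUm, h1, add_zero, hUdef,
      lintegral_biUnion_finset (fun a _ b _ hab => hdis a b hab) fun a _ => hm a]
    calc _ ≤ ∑ a ∈ F, ENNReal.ofReal (V⁻¹ * D ^ r) * ∫⁻ x in Q a, ∫⁻ y,
          ENNReal.ofReal ((u x - u y) ^ 2 / ‖x - y‖ ^ r) := Finset.sum_le_sum hbound
      _ = ENNReal.ofReal (V⁻¹ * D ^ r) * ∫⁻ x in U, ∫⁻ y,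
          ENNReal.ofReal ((u x - u y) ^ 2 / ‖x - y‖ ^ r) := by
        rw [hUdef, lintegral_biUnion_finset (fun a _ b _ hab => hdis a b hab) fun a _ => hm a,
          Finset.mul_sum]
      _ ≤ _ := by
        gcongr
        exact setLIntegral_le_lintegral _ _
  have e1 : ENNReal.ofReal (‖u - averaging F hm hfin V u‖ ^ 2) =
      ∫⁻ x, ENNReal.ofReal (g x ^ 2) := by
    rw [lintegral_ofReal_sq_eq_eLpNorm_sq, ← eLpNorm_congr_ae hg, ← Lp.enorm_def,
      ENNReal.ofReal_pow (norm_nonneg _), ofReal_norm]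
  have e2 : gagliardoSq s u = ENNReal.ofReal (‖z.snd‖ ^ 2) := by
    rw [gagliardoSq_eq_eLpNorm_sq s (Lp.aestronglyMeasurable u), ← eLpNorm_congr_ae hz1,
      ← Lp.enorm_def, ENNReal.ofReal_pow (norm_nonneg _), ofReal_norm]
  rw [← e1, e2] at hsum
  rw [← ENNReal.ofReal_mul (by positivity)] at hsum
  exact (ENNReal.ofReal_le_ofReal_iff (by positivity)).mp hsum

/-- The cell with index `a` of the cubic grid of mesh `h`. -/
def gridCell (h : ℝ) (a : ι → ℤ) : Set (EuclideanSpace ℝ ι) :=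
  {x | ∀ i, x i ∈ Ico (a i * h) ((a i + 1) * h)}

theorem gridCell_eq_preimage {ι : Type} (h : ℝ) (a : ι → ℤ) :
    gridCell h a = (WithLp.ofLp : EuclideanSpace ℝ ι → ι → ℝ) ⁻¹'
      pi univ fun i => Ico (a i * h) ((a i + 1) * h) := by
  ext x; simp [gridCell]

theorem measurableSet_gridCell (h : ℝ) (a : ι → ℤ) : MeasurableSet (gridCell h a) := by
  rw [gridCell_eq_preimage]
  exact (PiLp.volume_preserving_ofLp ι).measurable
    (MeasurableSet.univ_pi fun i => measurableSet_Ico)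

theorem volume_gridCell {h : ℝ} (hh : 0 < h) (a : ι → ℤ) :
    volume (gridCell h a) = ENNReal.ofReal (h ^ Fintype.card ι) := by
  rw [gridCell_eq_preimage, (PiLp.volume_preserving_ofLp ι).measure_preimage
    (MeasurableSet.univ_pi fun i => measurableSet_Ico).nullMeasurableSet, Real.volume_pi_Ico]
  have : ∀ i, ((a i : ℝ) + 1) * h - a i * h = h := fun i => by ring
  simp only [this, Finset.prod_const, Finset.card_univ, ENNReal.ofReal_pow hh.le]

theorem mem_Ico_mul_iff {h : ℝ} (hh : 0 < h) (n : ℤ) (t : ℝ) :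
    t ∈ Ico ((n : ℝ) * h) ((n + 1) * h) ↔ ⌊t / h⌋ = n := by
  rw [Int.floor_eq_iff, mem_Ico, le_div_iff₀ hh, div_lt_iff₀ hh]

theorem disjoint_gridCell {ι : Type} {h : ℝ} (hh : 0 < h) {a b : ι → ℤ} (hab : a ≠ b) :
    Disjoint (gridCell h a) (gridCell h b) := by
  rw [Set.disjoint_left]
  intro x hxa hxb
  apply hab
  ext i
  rw [← (mem_Ico_mul_iff hh _ _).mp (hxa i), (mem_Ico_mul_iff hh _ _).mp (hxb i)]

theorem norm_sub_le_of_mem_gridCell [Nonempty ι] {h : ℝ} (hh : 0 < h) (a : ι → ℤ)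
    {x y : EuclideanSpace ℝ ι} (hx : x ∈ gridCell h a) (hy : y ∈ gridCell h a) :
    ‖x - y‖ ≤ Fintype.card ι * h := by
  have h1 : (1 : ℝ) ≤ Fintype.card ι := by exact_mod_cast Fintype.card_pos (α := ι)
  refine le_of_sq_le_sq ?_ (by positivity)
  rw [EuclideanSpace.norm_sq_eq]
  calc _ ≤ ∑ _i : ι, h ^ 2 := by
        refine Finset.sum_le_sum fun i _ => ?_
        have h2 := hx i
        have h3 := hy i
        rw [PiLp.sub_apply, Real.norm_eq_abs]
        have : |x i - y i| ≤ h := by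
          rw [abs_le]
          constructor <;> nlinarith [h2.1, h2.2, h3.1, h3.2]
        gcongr
    _ = Fintype.card ι * h ^ 2 := by simp
    _ ≤ (Fintype.card ι * h) ^ 2 := by
        rw [mul_pow]
        gcongr
        nlinarith

theorem exists_gridCell_cover (hΩ : Bornology.IsBounded Ω) {h : ℝ} (hh : 0 < h) :
    ∃ F : Finset (ι → ℤ), Ω ⊆ ⋃ a ∈ F, gridCell h a := by
  classical
  obtain ⟨R, hR⟩ := hΩ.subset_closedBall 0
  refine ⟨Fintype.piFinset fun _ => Finset.Icc ⌊-R / h⌋ ⌊R / h⌋, fun x hx => ?_⟩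
  have h1 : ‖x‖ ≤ R := by simpa using hR hx
  refine mem_biUnion (x := fun i => ⌊x i / h⌋) ?_ fun i => (mem_Ico_mul_iff hh _ _).mpr rfl
  simp only [SetLike.mem_coe, Fintype.mem_piFinset, Finset.mem_Icc]
  intro i
  have h2 : |x i| ≤ R := by
    have := PiLp.norm_apply_le x i
    rw [Real.norm_eq_abs] at this
    exact this.trans h1
  rw [abs_le] at h2
  constructor <;> · apply Int.floor_le_floor; gcongr; first | exact h2.1 | exact h2.2

/-- The Rellich theorem: the embedding of `H^s_Ω` into `L²` is compact for bounded `Ω`. -/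
theorem isCompactOperator_formEmbedding [Nonempty ι] (hs0 : 0 < s)
    (hΩ : Bornology.IsBounded Ω) : IsCompactOperator (formEmbedding s Ω) := by
  set n := Fintype.card ι with hn
  let h : ℕ → ℝ := fun N => 1 / ((N : ℝ) + 1)
  have hh : ∀ N, 0 < h N := fun N => Nat.one_div_pos_of_nat
  have hfin : ∀ N (a : ι → ℤ), volume (gridCell (h N) a) ≠ ∞ := fun N a => by
    rw [volume_gridCell (hh N)]; exact ENNReal.ofReal_ne_top
  choose F hF using fun N => exists_gridCell_cover (Ω := Ω) hΩ (hh N)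
  let A : ℕ → formDomain s Ω →L[ℝ] Lp ℝ 2 (volume : Measure (EuclideanSpace ℝ ι)) := fun N =>
    (averaging (F N) (measurableSet_gridCell (h N)) (hfin N) (h N ^ n)).comp (formEmbedding s Ω)
  have hA : ∀ N, IsCompactOperator (A N) := fun N =>
    (isCompactOperator_averaging (F N) (measurableSet_gridCell (h N)) (hfin N) (h N ^ n)).comp_clm
      (formEmbedding s Ω)
  set c : ℝ := (n : ℝ) ^ (((n : ℝ) + 2 * s) / 2) with hc
  have hc0 : 0 ≤ c := by positivity
  -- With cell volume $h^n$ and the crude diameter bound $nh$, the constant $V^{-1}D^{n+2s}$ equals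
  -- $n^{n+2s}h^{2s}$, which is the square of $c\,h^s$. The embedding is therefore a norm limit of
  -- finite rank operators.
  have hnorm : ∀ N, ‖A N - formEmbedding s Ω‖ ≤ c * h N ^ s := by
    intro N
    have hhN := hh N
    refine ContinuousLinearMap.opNorm_le_bound _ (by positivity) fun z => ?_
    have h1 := norm_sub_averaging_sq_le hs0 (F N) (measurableSet_gridCell (h N))
      (V := h N ^ n) (by positivity) (fun a => volume_gridCell (hh N) a) (hfin N)
      (fun a b hab => disjoint_gridCell (hh N) hab) (by positivity)
      (fun a x hx y hy => norm_sub_le_of_mem_gridCell (hh N) a hx hy) (hF N) z.2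
    have h2 : (A N - formEmbedding s Ω) z = -((z : GraphSpace ι).fst -
        averaging (F N) (measurableSet_gridCell (h N)) (hfin N) (h N ^ n)
          (z : GraphSpace ι).fst) := by
      rw [neg_sub]; rfl
    rw [h2, norm_neg]
    refine le_of_sq_le_sq (h1.trans ?_) (by positivity)
    rw [mul_pow, mul_pow]
    have h3 : (h N ^ n)⁻¹ * ((n : ℝ) * h N) ^ ((n : ℝ) + 2 * s) = c ^ 2 * (h N ^ s) ^ 2 := by
      rw [Real.mul_rpow (by positivity) hhN.le, Real.rpow_add hhN, Real.rpow_natCast, hc,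
        ← Real.rpow_natCast (_ ^ (_ / 2)), ← Real.rpow_mul (by positivity),
        ← Real.rpow_natCast (_ ^ s), ← Real.rpow_mul hhN.le]
      have : h N ^ n ≠ 0 := by positivity
      field_simp
      norm_num
      left
      ring_nf
    rw [h3]
    gcongr
    exact GraphSpace.norm_snd_le _
  have hlim : Tendsto A atTop (𝓝 (formEmbedding s Ω)) := by
    refine (tendsto_iff_norm_sub_tendsto_zero (E := formDomain s Ω →L[ℝ]
      Lp ℝ 2 (volume : Measure (EuclideanSpace ℝ ι)))).mpr ?_
    refine squeeze_zero (fun N => norm_nonneg (A N - formEmbedding s Ω)) hnorm ?_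
    have h1 : Tendsto h atTop (𝓝 0) := tendsto_one_div_add_atTop_nhds_zero_nat
    have h2 := (h1.rpow_const (p := s) (Or.inr hs0.le)).const_mul c
    rwa [Real.zero_rpow hs0.ne', mul_zero] at h2
  exact isCompactOperator_of_tendsto hlim (Eventually.of_forall hA)

end CompactEmbedding

/-! ### The fractional kernel as a superposition of Gaussians -/

section GaussianKernel

variable {ι : Type} [Fintype ι]

/-- The probability density `(a/π)^{n/2} exp (-a |z|²)`. -/
def gaussKernel (a : ℝ) (z : EuclideanSpace ℝ ι) : ℝ :=
  (a / Real.pi) ^ ((Fintype.card ι : ℝ) / 2) * Real.exp (-a * ‖z‖ ^ 2)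

theorem gaussKernel_nonneg {a : ℝ} (ha : 0 < a) (z : EuclideanSpace ℝ ι) :
    0 ≤ gaussKernel a z := by
  unfold gaussKernel
  positivity

theorem continuous_gaussKernel (a : ℝ) :
    Continuous (gaussKernel a : EuclideanSpace ℝ ι → ℝ) := by
  unfold gaussKernel
  fun_prop

theorem measurable_gaussKernel (a : ℝ) :
    Measurable (gaussKernel a : EuclideanSpace ℝ ι → ℝ) :=
  (continuous_gaussKernel a).measurable

theorem measurable_gaussKernel_uncurry :
    Measurable (fun p : ℝ × EuclideanSpace ℝ ι => gaussKernel p.1 p.2) := by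
  unfold gaussKernel
  fun_prop

theorem gaussKernel_neg (a : ℝ) (z : EuclideanSpace ℝ ι) : gaussKernel a (-z) = gaussKernel a z := by
  simp [gaussKernel]

theorem gaussKernel_sub_comm (a : ℝ) (x y : EuclideanSpace ℝ ι) :
    gaussKernel a (x - y) = gaussKernel a (y - x) := by
  rw [← gaussKernel_neg, neg_sub]

theorem integral_exp_neg_mul_norm_sq {b : ℝ} (hb : 0 < b) :
    ∫ z : EuclideanSpace ℝ ι, Real.exp (-b * ‖z‖ ^ 2) =
      (Real.pi / b) ^ ((Fintype.card ι : ℝ) / 2) := by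
  rw [GaussianFourier.integral_rexp_neg_mul_sq_norm hb, finrank_euclideanSpace]

theorem integral_gaussKernel {a : ℝ} (ha : 0 < a) :
    ∫ z : EuclideanSpace ℝ ι, gaussKernel a z = 1 := by
  unfold gaussKernel
  have := Real.pi_pos
  rw [integral_const_mul, integral_exp_neg_mul_norm_sq ha, ← Real.mul_rpow (by positivity)
    (by positivity), div_mul_div_comm, mul_comm, div_self (by positivity), Real.one_rpow]

theorem integrable_gaussKernel {a : ℝ} (ha : 0 < a) :
    Integrable (gaussKernel a : EuclideanSpace ℝ ι → ℝ) :=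
  Integrable.of_integral_ne_zero (by rw [integral_gaussKernel ha]; exact one_ne_zero)

theorem lintegral_gaussKernel {a : ℝ} (ha : 0 < a) :
    ∫⁻ z : EuclideanSpace ℝ ι, ENNReal.ofReal (gaussKernel a z) = 1 := by
  rw [← ofReal_integral_eq_lintegral_ofReal (integrable_gaussKernel ha)
    (Eventually.of_forall fun z => gaussKernel_nonneg ha z), integral_gaussKernel ha,
    ENNReal.ofReal_one]

theorem lintegral_gaussKernel_sub_left {a : ℝ} (ha : 0 < a) (x : EuclideanSpace ℝ ι) :
    ∫⁻ y, ENNReal.ofReal (gaussKernel a (x - y)) = 1 := by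
  rw [lintegral_sub_left_eq_self (μ := volume) (fun z => ENNReal.ofReal (gaussKernel a z)) x,
    lintegral_gaussKernel ha]

theorem lintegral_gaussKernel_sub_right {a : ℝ} (ha : 0 < a) (y : EuclideanSpace ℝ ι) :
    ∫⁻ x, ENNReal.ofReal (gaussKernel a (x - y)) = 1 := by
  rw [lintegral_sub_right_eq_self (μ := volume) (fun z => ENNReal.ofReal (gaussKernel a z)) y,
    lintegral_gaussKernel ha]

/-- The kernel of the fractional Laplacian is a superposition of Gaussian densities whose weight
does not depend on the dimension. -/
theorem ofReal_fracLaplaceConst_div_norm_rpow {s : ℝ} (hs0 : 0 < s) {z : EuclideanSpace ℝ ι}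
    (hz : z ≠ 0) :
    ENNReal.ofReal (fracLaplaceConst (Fintype.card ι) s /
        ‖z‖ ^ ((Fintype.card ι : ℝ) + 2 * s)) =
      ∫⁻ a in Ioi (0 : ℝ), ENNReal.ofReal ((4 : ℝ) ^ s / |Real.Gamma (-s)| * a ^ (s - 1)) *
        ENNReal.ofReal (gaussKernel a z) := by
  have hπ := Real.pi_pos
  have hz' : 0 < ‖z‖ := norm_pos_iff.mpr hz
  set b : ℝ := (Fintype.card ι : ℝ) / 2 with hb
  have hb0 : 0 ≤ b := by positivity
  set κ : ℝ := (4 : ℝ) ^ s / |Real.Gamma (-s)| with hκ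
  have hκ0 : 0 ≤ κ := by positivity
  -- Euler's integral $\int_0^\infty a^{n/2+s-1}e^{-a|z|^2}\,da=\Gamma(\frac n2+s)\,|z|^{-n-2s}$.
  -- The normalisation of the Gaussian absorbs $a^{n/2}$ and $\pi^{-n/2}$, leaving a weight free of
  -- $n$.
  have hint := Real.integral_rpow_mul_exp_neg_mul_Ioi (a := b + s) (r := ‖z‖ ^ 2)
    (by positivity) (by positivity)
  have hΓ : 0 < Real.Gamma (b + s) := Real.Gamma_pos_of_pos (by positivity)
  have hI : IntegrableOn (fun t : ℝ => t ^ (b + s - 1) * Real.exp (-(‖z‖ ^ 2 * t))) (Ioi 0) := by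
    refine Integrable.of_integral_ne_zero ?_
    rw [hint]
    positivity
  have hpt : ∀ a ∈ Ioi (0 : ℝ), ENNReal.ofReal (κ * a ^ (s - 1)) *
      ENNReal.ofReal (gaussKernel a z) = ENNReal.ofReal (κ / Real.pi ^ b *
        (a ^ (b + s - 1) * Real.exp (-(‖z‖ ^ 2 * a)))) := by
    intro a ha
    have ha' : 0 < a := ha
    rw [← ENNReal.ofReal_mul (by positivity)]
    congr 1
    rw [gaussKernel, ← hb, Real.div_rpow ha'.le hπ.le,
      show b + s - 1 = b + (s - 1) by ring, Real.rpow_add ha',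
      show -(‖z‖ ^ 2 * a) = -a * ‖z‖ ^ 2 by ring]
    ring
  rw [setLIntegral_congr_fun measurableSet_Ioi hpt, ← ofReal_integral_eq_lintegral_ofReal
    (hI.const_mul _)]
  · congr 1
    rw [integral_const_mul, hint, fracLaplaceConst, ← hb, hκ,
      show (Fintype.card ι : ℝ) + 2 * s = 2 * (b + s) by rw [hb]; ring, one_div,
      Real.inv_rpow (by positivity), ← Real.rpow_natCast, ← Real.rpow_mul hz'.le]
    push_cast
    field_simp
  · refine (ae_restrict_iff' measurableSet_Ioi).mpr (Eventually.of_forall fun a ha => ?_)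
    have ha' : 0 < a := ha
    simp only [Pi.zero_apply]
    positivity

/-- The energy `∫∫ (f(x) - g(y))² G_a(x - y) dx dy`. -/
def gaussEnergy (a : ℝ) (f g : EuclideanSpace ℝ ι → ℝ) : ℝ≥0∞ :=
  ∫⁻ x, ∫⁻ y, ENNReal.ofReal ((f x - g y) ^ 2) * ENNReal.ofReal (gaussKernel a (x - y))

/-- The Gagliardo seminorm with the normalisation of the fractional Laplacian. -/
def fracEnergy (s : ℝ) (f : EuclideanSpace ℝ ι → ℝ) : ℝ≥0∞ :=
  ENNReal.ofReal (fracLaplaceConst (Fintype.card ι) s) * gagliardoSq s f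

/-- Tonelli applied to the kernel formula; on the diagonal both integrands vanish. Through this
identity, inequalities between energies in different dimensions reduce to inequalities at each fixed
$a$. -/
theorem fracEnergy_eq_lintegral_gaussEnergy {s : ℝ} (hs0 : 0 < s) (hs1 : s < 1)
    {f : EuclideanSpace ℝ ι → ℝ} (hf : Measurable f) :
    fracEnergy s f = ∫⁻ a in Ioi (0 : ℝ),
      ENNReal.ofReal ((4 : ℝ) ^ s / |Real.Gamma (-s)| * a ^ (s - 1)) * gaussEnergy a f f := by
  have hC := (fracLaplaceConst_pos (Fintype.card ι) hs0 hs1).le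
  have hK := measurable_gaussKernel_uncurry (ι := ι)
  have hw : Measurable fun a : ℝ =>
      ENNReal.ofReal ((4 : ℝ) ^ s / |Real.Gamma (-s)| * a ^ (s - 1)) := by fun_prop
  set w : ℝ → ℝ≥0∞ := fun a =>
    ENNReal.ofReal ((4 : ℝ) ^ s / |Real.Gamma (-s)| * a ^ (s - 1)) with hwdef
  have hpt : ∀ x y, ENNReal.ofReal (fracLaplaceConst (Fintype.card ι) s) *
      ENNReal.ofReal ((f x - f y) ^ 2 / ‖x - y‖ ^ ((Fintype.card ι : ℝ) + 2 * s)) =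
      ∫⁻ a in Ioi (0 : ℝ), w a *
        (ENNReal.ofReal ((f x - f y) ^ 2) * ENNReal.ofReal (gaussKernel a (x - y))) := by
    intro x y
    by_cases hxy : x = y
    · subst hxy; simp
    · have h1 := ofReal_fracLaplaceConst_div_norm_rpow hs0 (sub_ne_zero.mpr hxy)
      rw [← ENNReal.ofReal_mul hC]
      calc _ = ENNReal.ofReal ((f x - f y) ^ 2) * ENNReal.ofReal
            (fracLaplaceConst (Fintype.card ι) s /
              ‖x - y‖ ^ ((Fintype.card ι : ℝ) + 2 * s)) := by
            rw [← ENNReal.ofReal_mul (sq_nonneg _)]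
            congr 1; ring
        _ = _ := by
            rw [h1, ← lintegral_const_mul' _ _ ENNReal.ofReal_ne_top]
            refine lintegral_congr fun a => ?_
            ring
  have hjoint : Measurable fun q : (EuclideanSpace ℝ ι × EuclideanSpace ℝ ι) × ℝ =>
      w q.2 * (ENNReal.ofReal ((f q.1.1 - f q.1.2) ^ 2) *
        ENNReal.ofReal (gaussKernel q.2 (q.1.1 - q.1.2))) := by
    have h1 : Measurable fun q : (EuclideanSpace ℝ ι × EuclideanSpace ℝ ι) × ℝ =>
        ENNReal.ofReal ((f q.1.1 - f q.1.2) ^ 2) := by fun_prop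
    have h2 : Measurable fun q : (EuclideanSpace ℝ ι × EuclideanSpace ℝ ι) × ℝ =>
        (q.2, q.1.1 - q.1.2) := by fun_prop
    exact (hw.comp measurable_snd).mul (h1.mul (hK.comp h2).ennreal_ofReal)
  calc fracEnergy s f = ∫⁻ x, ∫⁻ y, ∫⁻ a in Ioi (0 : ℝ), w a *
        (ENNReal.ofReal ((f x - f y) ^ 2) * ENNReal.ofReal (gaussKernel a (x - y))) := by
        rw [fracEnergy, gagliardoSq, ← lintegral_const_mul' _ _ ENNReal.ofReal_ne_top]
        refine lintegral_congr fun x => ?_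
        rw [← lintegral_const_mul' _ _ ENNReal.ofReal_ne_top]
        exact lintegral_congr fun y => hpt x y
    _ = ∫⁻ p : EuclideanSpace ℝ ι × EuclideanSpace ℝ ι, ∫⁻ a in Ioi (0 : ℝ), w a *
        (ENNReal.ofReal ((f p.1 - f p.2) ^ 2) *
          ENNReal.ofReal (gaussKernel a (p.1 - p.2))) := by
        rw [Measure.volume_eq_prod, lintegral_prod _ hjoint.lintegral_prod_right'.aemeasurable]
    _ = ∫⁻ a in Ioi (0 : ℝ), ∫⁻ p : EuclideanSpace ℝ ι × EuclideanSpace ℝ ι, w a *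
        (ENNReal.ofReal ((f p.1 - f p.2) ^ 2) *
          ENNReal.ofReal (gaussKernel a (p.1 - p.2))) :=
        lintegral_lintegral_swap hjoint.aemeasurable
    _ = _ := by
        refine lintegral_congr fun a => ?_
        have h2 : Measurable fun p : EuclideanSpace ℝ ι × EuclideanSpace ℝ ι =>
          ENNReal.ofReal ((f p.1 - f p.2) ^ 2) * ENNReal.ofReal (gaussKernel a (p.1 - p.2)) := by
          have := measurable_gaussKernel (ι := ι) a
          fun_prop
        rw [lintegral_const_mul' _ _ ENNReal.ofReal_ne_top, gaussEnergy, Measure.volume_eq_prod,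
          lintegral_prod _ h2.aemeasurable]

end GaussianKernel

/-! ### Positive definiteness of the Gaussian -/

section PositiveDefinite

variable {ι : Type} [Fintype ι]

theorem norm_sub_sq_add_norm_sub_sq (x y w : EuclideanSpace ℝ ι) :
    ‖x - w‖ ^ 2 + ‖y - w‖ ^ 2 = ‖x - y‖ ^ 2 / 2 + 2 * ‖w - (1 / 2 : ℝ) • (x + y)‖ ^ 2 := by
  have h := parallelogram_law_with_norm ℝ (x - w) (y - w)
  have h1 : x - w - (y - w) = x - y := by abel
  have h2 : x - w + (y - w) = (-2 : ℝ) • (w - (1 / 2 : ℝ) • (x + y)) := by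
    module
  have h3 : ‖(-2 : ℝ)‖ = 2 := by norm_num
  rw [h1, h2, norm_smul, h3] at h
  linarith

/-- A Gaussian is, up to a constant, the convolution square of a narrower one: by the parallelogram
law about the midpoint, the product of the two exponentials is $e^{-a|x-y|^2}$ times a Gaussian in
$w$ centred at the midpoint. -/
theorem integral_exp_mul_exp {a : ℝ} (x y : EuclideanSpace ℝ ι) :
    ∫ w, Real.exp (-(2 * a) * ‖x - w‖ ^ 2) * Real.exp (-(2 * a) * ‖y - w‖ ^ 2) =
      Real.exp (-a * ‖x - y‖ ^ 2) *
        ∫ w : EuclideanSpace ℝ ι, Real.exp (-(4 * a) * ‖w‖ ^ 2) := by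
  have h1 : ∀ w, Real.exp (-(2 * a) * ‖x - w‖ ^ 2) * Real.exp (-(2 * a) * ‖y - w‖ ^ 2) =
      Real.exp (-a * ‖x - y‖ ^ 2) *
        Real.exp (-(4 * a) * ‖w - (1 / 2 : ℝ) • (x + y)‖ ^ 2) := fun w => by
    rw [← Real.exp_add, ← Real.exp_add]
    congr 1
    have := norm_sub_sq_add_norm_sub_sq x y w
    linear_combination (-(2 * a)) * this
  simp_rw [h1]
  rw [integral_const_mul, integral_sub_right_eq_self
    (fun w : EuclideanSpace ℝ ι => Real.exp (-(4 * a) * ‖w‖ ^ 2))]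

theorem integrable_mul_mul_gaussKernel {a : ℝ} {f g : EuclideanSpace ℝ ι → ℝ}
    (hf : Continuous f) (hf' : HasCompactSupport f) (hg : Continuous g)
    (hg' : HasCompactSupport g) :
    Integrable fun p : EuclideanSpace ℝ ι × EuclideanSpace ℝ ι =>
      f p.1 * g p.2 * gaussKernel a (p.1 - p.2) := by
  refine Continuous.integrable_of_hasCompactSupport ?_ ?_
  · have := continuous_gaussKernel (ι := ι) a
    fun_prop
  · refine HasCompactSupport.of_support_subset_isCompact (hf'.isCompact.prod hg'.isCompact) ?_
    intro p hp
    rw [Function.mem_support] at hp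
    exact ⟨subset_tsupport _ fun h => hp (by rw [h]; ring),
      subset_tsupport _ fun h => hp (by rw [h]; ring)⟩

/-- The Gaussian kernel is positive definite. -/
theorem integral_mul_mul_gaussKernel_nonneg {a : ℝ} (ha : 0 < a) {f : EuclideanSpace ℝ ι → ℝ}
    (hf : Continuous f) (hf' : HasCompactSupport f) :
    0 ≤ ∫ p : EuclideanSpace ℝ ι × EuclideanSpace ℝ ι,
      f p.1 * f p.2 * gaussKernel a (p.1 - p.2) := by
  have hπ := Real.pi_pos
  set e : ℝ := ∫ w : EuclideanSpace ℝ ι, Real.exp (-(4 * a) * ‖w‖ ^ 2) with he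
  have he0 : 0 < e := by
    rw [he, integral_exp_neg_mul_norm_sq (by positivity)]
    positivity
  -- Integrating $F$ over $w$ first gives the quadratic form up to a positive constant; integrating
  -- over the pair first gives the square $(\int f(x)e^{-2a|x-w|^2}dx)^2$.
  let F : (EuclideanSpace ℝ ι × EuclideanSpace ℝ ι) × EuclideanSpace ℝ ι → ℝ := fun q =>
    f q.1.1 * f q.1.2 *
      (Real.exp (-(2 * a) * ‖q.1.1 - q.2‖ ^ 2) * Real.exp (-(2 * a) * ‖q.1.2 - q.2‖ ^ 2))
  have hFc : Continuous F := by fun_prop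
  have hker : ∀ p : EuclideanSpace ℝ ι × EuclideanSpace ℝ ι, ∫ w, F (p, w) =
      f p.1 * f p.2 * (Real.exp (-a * ‖p.1 - p.2‖ ^ 2) * e) := fun p => by
    simp only [F]
    rw [integral_const_mul, integral_exp_mul_exp]
  have hkerInt : ∀ p : EuclideanSpace ℝ ι × EuclideanSpace ℝ ι, Integrable fun w =>
      Real.exp (-(2 * a) * ‖p.1 - w‖ ^ 2) * Real.exp (-(2 * a) * ‖p.2 - w‖ ^ 2) := fun p => by
    refine Integrable.of_integral_ne_zero ?_
    rw [integral_exp_mul_exp, ← he]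
    positivity
  set c : ℝ := (a / Real.pi) ^ ((Fintype.card ι : ℝ) / 2) with hc
  have hc0 : 0 < c := by positivity
  have hgauss : ∀ p : EuclideanSpace ℝ ι × EuclideanSpace ℝ ι, ∫ w, F (p, w) =
      e / c * (f p.1 * f p.2 * gaussKernel a (p.1 - p.2)) := fun p => by
    rw [hker, gaussKernel, ← hc]
    field_simp
  -- The same identity for $|F|$ reduces absolute integrability to that of $f(x)f(y)G_a(x-y)$,
  -- continuous with compact support.
  have hFi : Integrable F (volume.prod volume) := by
    rw [integrable_prod_iff hFc.aestronglyMeasurable]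
    refine ⟨Eventually.of_forall fun p => (hkerInt p).const_mul (f p.1 * f p.2), ?_⟩
    have h1 : ∀ p : EuclideanSpace ℝ ι × EuclideanSpace ℝ ι, ∫ w, ‖F (p, w)‖ =
        e / c * (‖f p.1 * f p.2 * gaussKernel a (p.1 - p.2)‖) := fun p => by
      have h2 : ∀ w, ‖F (p, w)‖ = ‖f p.1 * f p.2‖ *
        (Real.exp (-(2 * a) * ‖p.1 - w‖ ^ 2) * Real.exp (-(2 * a) * ‖p.2 - w‖ ^ 2)) :=
        fun w => by
          simp only [F]
          rw [norm_mul, Real.norm_of_nonneg (by positivity :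
            0 ≤ Real.exp (-(2 * a) * ‖p.1 - w‖ ^ 2) * Real.exp (-(2 * a) * ‖p.2 - w‖ ^ 2))]
      simp_rw [h2]
      rw [integral_const_mul, integral_exp_mul_exp, ← he, norm_mul _ (gaussKernel a _),
        Real.norm_of_nonneg (gaussKernel_nonneg ha _), gaussKernel, ← hc]
      field_simp
    simp_rw [h1]
    exact ((integrable_mul_mul_gaussKernel hf hf' hf hf').norm).const_mul _
  have hswap : ∫ p, ∫ w, F (p, w) = ∫ w, ∫ p, F (p, w) :=
    integral_integral_swap (f := fun p w => F (p, w)) hFi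
  have hsq : ∀ w, ∫ p, F (p, w) = (∫ x, f x * Real.exp (-(2 * a) * ‖x - w‖ ^ 2)) ^ 2 := by
    intro w
    rw [sq, ← integral_prod_mul]
    refine integral_congr_ae (Eventually.of_forall fun p => ?_)
    simp only [F]
    ring
  simp_rw [hgauss, hsq, integral_const_mul] at hswap
  have h3 : 0 ≤ e / c * ∫ p : EuclideanSpace ℝ ι × EuclideanSpace ℝ ι,
      f p.1 * f p.2 * gaussKernel a (p.1 - p.2) := by
    rw [hswap]
    exact integral_nonneg fun w => sq_nonneg _
  exact nonneg_of_mul_nonneg_right h3 (by positivity)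

end PositiveDefinite

/-! ### Inequalities for the Gaussian energy of two functions -/

section GaussEnergy

variable {ι : Type} [Fintype ι]

theorem measurable_gaussEnergy_integrand (a : ℝ) {f g : EuclideanSpace ℝ ι → ℝ} (hf : Measurable f)
    (hg : Measurable g) : Measurable fun p : EuclideanSpace ℝ ι × EuclideanSpace ℝ ι =>
      ENNReal.ofReal ((f p.1 - g p.2) ^ 2) * ENNReal.ofReal (gaussKernel a (p.1 - p.2)) := by
  have := measurable_gaussKernel (ι := ι) a
  fun_prop

theorem gaussEnergy_comm (a : ℝ) {f g : EuclideanSpace ℝ ι → ℝ} (hf : Measurable f)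
    (hg : Measurable g) : gaussEnergy a f g = gaussEnergy a g f := by
  unfold gaussEnergy
  rw [lintegral_lintegral_swap (measurable_gaussEnergy_integrand a hf hg).aemeasurable]
  refine lintegral_congr fun x => lintegral_congr fun y => ?_
  rw [gaussKernel_sub_comm, show (f y - g x) ^ 2 = (g x - f y) ^ 2 by ring]

theorem integrable_sq_mul_gaussKernel {a : ℝ} (ha : 0 < a) {f : EuclideanSpace ℝ ι → ℝ}
    (hf : Continuous f) (hf' : HasCompactSupport f) :
    (Integrable fun p : EuclideanSpace ℝ ι × EuclideanSpace ℝ ι =>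
      f p.1 ^ 2 * gaussKernel a (p.1 - p.2)) ∧
    (Integrable fun p : EuclideanSpace ℝ ι × EuclideanSpace ℝ ι =>
      f p.2 ^ 2 * gaussKernel a (p.1 - p.2)) := by
  have h1 : Integrable fun x => f x ^ 2 := (hf.memLp_of_hasCompactSupport hf').integrable_sq
  have h2 : Integrable (fun p : EuclideanSpace ℝ ι × EuclideanSpace ℝ ι =>
      f p.2 ^ 2 * gaussKernel a (p.1 - p.2)) (volume.prod volume) := by
    simpa using h1.convolution_integrand (ContinuousLinearMap.mul ℝ ℝ) (integrable_gaussKernel ha)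
  refine ⟨?_, h2⟩
  have h3 := h2.swap
  refine h3.congr (Eventually.of_forall fun p => ?_)
  simp only [Function.comp, Prod.fst_swap, Prod.snd_swap]
  rw [gaussKernel_sub_comm]

theorem integrable_gaussEnergy {a : ℝ} (ha : 0 < a) {f g : EuclideanSpace ℝ ι → ℝ}
    (hf : Continuous f) (hf' : HasCompactSupport f) (hg : Continuous g)
    (hg' : HasCompactSupport g) :
    Integrable fun p : EuclideanSpace ℝ ι × EuclideanSpace ℝ ι =>
      (f p.1 - g p.2) ^ 2 * gaussKernel a (p.1 - p.2) := by
  have h := ((integrable_sq_mul_gaussKernel ha hf hf').1.sub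
    ((integrable_mul_mul_gaussKernel (a := a) hf hf' hg hg').const_mul 2)).add
    (integrable_sq_mul_gaussKernel ha hg hg').2
  refine h.congr (Eventually.of_forall fun p => ?_)
  simp only [Pi.add_apply, Pi.sub_apply]
  ring

theorem gaussEnergy_eq_ofReal {a : ℝ} (ha : 0 < a) {f g : EuclideanSpace ℝ ι → ℝ}
    (hf : Continuous f) (hf' : HasCompactSupport f) (hg : Continuous g)
    (hg' : HasCompactSupport g) :
    gaussEnergy a f g = ENNReal.ofReal (∫ p : EuclideanSpace ℝ ι × EuclideanSpace ℝ ι,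
      (f p.1 - g p.2) ^ 2 * gaussKernel a (p.1 - p.2)) := by
  have hnn : ∀ p : EuclideanSpace ℝ ι × EuclideanSpace ℝ ι,
      0 ≤ (f p.1 - g p.2) ^ 2 * gaussKernel a (p.1 - p.2) := fun p =>
    mul_nonneg (sq_nonneg _) (gaussKernel_nonneg ha _)
  rw [ofReal_integral_eq_lintegral_ofReal (integrable_gaussEnergy ha hf hf' hg hg')
    (Eventually.of_forall hnn), gaussEnergy, Measure.volume_eq_prod,
    ← lintegral_prod _ (measurable_gaussEnergy_integrand a hf.measurable hg.measurable).aemeasurable]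
  refine lintegral_congr fun p => ?_
  rw [ENNReal.ofReal_mul (sq_nonneg _)]

/-- The squares cancel: $E(f,g)+E(g,f)-E(f,f)-E(g,g)$ is twice the Gaussian quadratic form of $f-g$,
which is nonnegative. -/
theorem gaussEnergy_self_add_self_le {a : ℝ} (ha : 0 < a) {f g : EuclideanSpace ℝ ι → ℝ}
    (hf : Continuous f) (hf' : HasCompactSupport f) (hg : Continuous g)
    (hg' : HasCompactSupport g) :
    gaussEnergy a f f + gaussEnergy a g g ≤ 2 * gaussEnergy a f g := by
  have hnn : ∀ f g : EuclideanSpace ℝ ι → ℝ,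
      0 ≤ ∫ p : EuclideanSpace ℝ ι × EuclideanSpace ℝ ι,
        (f p.1 - g p.2) ^ 2 * gaussKernel a (p.1 - p.2) := fun f g =>
    integral_nonneg fun p => mul_nonneg (sq_nonneg _) (gaussKernel_nonneg ha _)
  rw [two_mul]
  nth_rewrite 2 [gaussEnergy_comm a hf.measurable hg.measurable]
  rw [gaussEnergy_eq_ofReal ha hf hf' hf hf', gaussEnergy_eq_ofReal ha hg hg' hg hg',
    gaussEnergy_eq_ofReal ha hf hf' hg hg', gaussEnergy_eq_ofReal ha hg hg' hf hf',
    ← ENNReal.ofReal_add (hnn _ _) (hnn _ _), ← ENNReal.ofReal_add (hnn _ _) (hnn _ _)]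
  apply ENNReal.ofReal_le_ofReal
  have hd : Continuous fun x => f x - g x := hf.sub hg
  have hd' : HasCompactSupport fun x => f x - g x := hf'.sub hg'
  have hpos := integral_mul_mul_gaussKernel_nonneg ha hd hd'
  have h1 := integrable_gaussEnergy ha hf hf' hf hf'
  have h2 := integrable_gaussEnergy ha hg hg' hg hg'
  have h3 := integrable_gaussEnergy ha hf hf' hg hg'
  have h4 := integrable_gaussEnergy ha hg hg' hf hf'
  have h5 := integrable_mul_mul_gaussKernel (a := a) hd hd' hd hd'
  have key : (∫ p : EuclideanSpace ℝ ι × EuclideanSpace ℝ ι,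
        (f p.1 - g p.2) ^ 2 * gaussKernel a (p.1 - p.2)) +
      (∫ p : EuclideanSpace ℝ ι × EuclideanSpace ℝ ι,
        (g p.1 - f p.2) ^ 2 * gaussKernel a (p.1 - p.2)) =
      (∫ p : EuclideanSpace ℝ ι × EuclideanSpace ℝ ι,
        (f p.1 - f p.2) ^ 2 * gaussKernel a (p.1 - p.2)) +
      (∫ p : EuclideanSpace ℝ ι × EuclideanSpace ℝ ι,
        (g p.1 - g p.2) ^ 2 * gaussKernel a (p.1 - p.2)) +
      2 * ∫ p : EuclideanSpace ℝ ι × EuclideanSpace ℝ ι,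
        (f p.1 - g p.1) * (f p.2 - g p.2) * gaussKernel a (p.1 - p.2) := by
    have h12 : Integrable fun p : EuclideanSpace ℝ ι × EuclideanSpace ℝ ι =>
        (f p.1 - f p.2) ^ 2 * gaussKernel a (p.1 - p.2) +
          (g p.1 - g p.2) ^ 2 * gaussKernel a (p.1 - p.2) := h1.add h2
    rw [← integral_const_mul, ← integral_add h3 h4, ← integral_add h1 h2,
      ← integral_add h12 (h5.const_mul 2)]
    refine integral_congr_ae (Eventually.of_forall fun p => ?_)
    ring
  linarith

/-- This controls the energy between two slices of a tensor product. After symmetrising in $x$ and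
$y$ the inequality holds pointwise; the first term on the right is
$(\alpha-\beta)^2\iint(w(x)^2+w(y)^2)G_a(x-y)$, since the kernel has mass one. -/
theorem gaussEnergy_const_mul_le {a : ℝ} (ha : 0 < a) (α β : ℝ) {w : EuclideanSpace ℝ ι → ℝ}
    (hw : Measurable w) :
    gaussEnergy a (fun x => α * w x) (fun x => β * w x) +
        gaussEnergy a (fun x => α * w x) (fun x => β * w x) ≤
      2 * ENNReal.ofReal ((α - β) ^ 2) * (∫⁻ x, ENNReal.ofReal (w x ^ 2)) +
        (ENNReal.ofReal (α ^ 2) + ENNReal.ofReal (β ^ 2)) * gaussEnergy a w w := by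
  have hα : Measurable fun x => α * w x := hw.const_mul α
  have hβ : Measurable fun x => β * w x := hw.const_mul β
  have hG := measurable_gaussKernel (ι := ι) a
  nth_rewrite 2 [gaussEnergy_comm a hα hβ]
  have e1 : ∫⁻ x, ∫⁻ y, ENNReal.ofReal (w x ^ 2) * ENNReal.ofReal (gaussKernel a (x - y)) =
      ∫⁻ x, ENNReal.ofReal (w x ^ 2) := by
    refine lintegral_congr fun x => ?_
    rw [lintegral_const_mul' _ _ ENNReal.ofReal_ne_top, lintegral_gaussKernel_sub_left ha, mul_one]
  have e2 : ∫⁻ x, ∫⁻ y, ENNReal.ofReal (w y ^ 2) * ENNReal.ofReal (gaussKernel a (x - y)) =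
      ∫⁻ x, ENNReal.ofReal (w x ^ 2) := by
    rw [lintegral_lintegral_swap (by fun_prop)]
    refine lintegral_congr fun x => ?_
    rw [lintegral_const_mul' _ _ ENNReal.ofReal_ne_top, lintegral_gaussKernel_sub_right ha, mul_one]
  have hm : ∀ f g : EuclideanSpace ℝ ι → ℝ, Measurable f → Measurable g →
      gaussEnergy a f g = ∫⁻ p : EuclideanSpace ℝ ι × EuclideanSpace ℝ ι,
        ENNReal.ofReal ((f p.1 - g p.2) ^ 2) * ENNReal.ofReal (gaussKernel a (p.1 - p.2)) :=
    fun f g hf hg => by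
      rw [gaussEnergy, Measure.volume_eq_prod, lintegral_prod _
        (measurable_gaussEnergy_integrand a hf hg).aemeasurable]
  have e1' : ∫⁻ p : EuclideanSpace ℝ ι × EuclideanSpace ℝ ι,
      ENNReal.ofReal (w p.1 ^ 2) * ENNReal.ofReal (gaussKernel a (p.1 - p.2)) =
      ∫⁻ x, ENNReal.ofReal (w x ^ 2) := by
    rw [← e1, Measure.volume_eq_prod, lintegral_prod _ (by fun_prop)]
  have e2' : ∫⁻ p : EuclideanSpace ℝ ι × EuclideanSpace ℝ ι,
      ENNReal.ofReal (w p.2 ^ 2) * ENNReal.ofReal (gaussKernel a (p.1 - p.2)) =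
      ∫⁻ x, ENNReal.ofReal (w x ^ 2) := by
    rw [← e2, Measure.volume_eq_prod, lintegral_prod _ (by fun_prop)]
  set N := ∫⁻ x, ENNReal.ofReal (w x ^ 2)
  have hrhs : 2 * ENNReal.ofReal ((α - β) ^ 2) * N =
      ENNReal.ofReal ((α - β) ^ 2) * (N + N) := by ring
  rw [hrhs]
  nth_rewrite 1 [← e1']
  nth_rewrite 1 [← e2']
  rw [hm _ _ hα hβ, hm _ _ hβ hα, hm _ _ hw hw,
    ← lintegral_add_left (measurable_gaussEnergy_integrand a hα hβ),
    ← lintegral_add_left (by fun_prop), ← lintegral_const_mul' _ _ ENNReal.ofReal_ne_top,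
    ← lintegral_const_mul' _ _ (ENNReal.add_ne_top.mpr
      ⟨ENNReal.ofReal_ne_top, ENNReal.ofReal_ne_top⟩),
    ← lintegral_add_left (by fun_prop)]
  refine lintegral_mono fun p => ?_
  have hg := gaussKernel_nonneg ha (p.1 - p.2)
  rw [← ENNReal.ofReal_add (sq_nonneg α) (sq_nonneg β)]
  simp only [← ENNReal.ofReal_mul (sq_nonneg _), ← ENNReal.ofReal_mul (add_nonneg (sq_nonneg α)
    (sq_nonneg β))]
  rw [← ENNReal.ofReal_add (by positivity) (by positivity),
    ← ENNReal.ofReal_add (by positivity) (by positivity),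
    ← ENNReal.ofReal_mul (by positivity), ← ENNReal.ofReal_add (by positivity) (by positivity)]
  apply ENNReal.ofReal_le_ofReal
  -- This is exactly the difference between the two sides.
  have h1 : 0 ≤ (α - β) ^ 2 * (w p.1 - w p.2) ^ 2 * gaussKernel a (p.1 - p.2) := by positivity
  nlinarith [h1]

end GaussEnergy

/-! ### Gaussian energy on a product of Euclidean spaces -/

section Product

variable {ι κ : Type} [Fintype ι] [Fintype κ]

/-- The identification of `ℝ^ι × ℝ^κ` with `ℝ^(ι ⊕ κ)`. -/
def euclideanPair (x : EuclideanSpace ℝ ι) (y : EuclideanSpace ℝ κ) :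
    EuclideanSpace ℝ (ι ⊕ κ) :=
  WithLp.toLp 2 (Sum.elim x y)

theorem euclideanPair_sub {ι κ : Type} (x x' : EuclideanSpace ℝ ι) (y y' : EuclideanSpace ℝ κ) :
    euclideanPair x y - euclideanPair x' y' = euclideanPair (x - x') (y - y') := by
  ext i
  rcases i with i | i <;> simp [euclideanPair]

theorem norm_euclideanPair_sq (x : EuclideanSpace ℝ ι) (y : EuclideanSpace ℝ κ) :
    ‖euclideanPair x y‖ ^ 2 = ‖x‖ ^ 2 + ‖y‖ ^ 2 := by
  simp [EuclideanSpace.norm_sq_eq, euclideanPair]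

theorem euclideanPair_surjective {ι κ : Type} (z : EuclideanSpace ℝ (ι ⊕ κ)) :
    euclideanPair (WithLp.toLp 2 fun i => z (Sum.inl i)) (WithLp.toLp 2 fun j => z (Sum.inr j))
      = z := by
  ext i
  rcases i with i | i <;> simp [euclideanPair]

/-- This factorisation is the reason for using Gaussians: the power kernel itself does not split
over a product. -/
theorem gaussKernel_euclideanPair {a : ℝ} (ha : 0 < a) (x : EuclideanSpace ℝ ι)
    (y : EuclideanSpace ℝ κ) :
    gaussKernel a (euclideanPair x y) = gaussKernel a x * gaussKernel a y := by
  have hπ := Real.pi_pos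
  have h1 : ((Fintype.card (ι ⊕ κ) : ℕ) : ℝ) / 2 =
      (Fintype.card ι : ℝ) / 2 + (Fintype.card κ : ℝ) / 2 := by
    rw [Fintype.card_sum]; push_cast; ring
  rw [gaussKernel, gaussKernel, gaussKernel, norm_euclideanPair_sq, h1,
    Real.rpow_add (by positivity), mul_add, Real.exp_add]
  ring

theorem measurePreserving_euclideanPair :
    MeasurePreserving (fun p : EuclideanSpace ℝ ι × EuclideanSpace ℝ κ => euclideanPair p.1 p.2)
      (volume.prod volume) volume := by
  have h1 := (PiLp.volume_preserving_ofLp ι).prod (PiLp.volume_preserving_ofLp κ)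
  have h2 := volume_measurePreserving_sumPiEquivProdPi_symm (fun _ : ι ⊕ κ => ℝ)
  have h3 := ((PiLp.volume_preserving_toLp (ι ⊕ κ)).comp h2).comp h1
  have h4 : (fun p : EuclideanSpace ℝ ι × EuclideanSpace ℝ κ => euclideanPair p.1 p.2) =
      (WithLp.toLp 2 ∘ (MeasurableEquiv.sumPiEquivProdPi fun _ : ι ⊕ κ => ℝ).symm) ∘
        Prod.map WithLp.ofLp WithLp.ofLp := by
    funext p
    ext i
    rcases i with i | i <;> rfl
  rw [h4]
  exact h3

theorem continuous_euclideanPair {ι κ : Type} :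
    Continuous fun p : EuclideanSpace ℝ ι × EuclideanSpace ℝ κ => euclideanPair p.1 p.2 := by
  refine (PiLp.continuous_toLp 2 _).comp (continuous_pi fun i => ?_)
  rcases i with i | i
  · simp only [Sum.elim_inl]; fun_prop
  · simp only [Sum.elim_inr]; fun_prop

theorem measurable_euclideanPair :
    Measurable fun p : EuclideanSpace ℝ ι × EuclideanSpace ℝ κ => euclideanPair p.1 p.2 :=
  continuous_euclideanPair.measurable

theorem lintegral_euclideanPair {F : EuclideanSpace ℝ (ι ⊕ κ) → ℝ≥0∞} (hF : Measurable F) :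
    ∫⁻ z, F z = ∫⁻ x : EuclideanSpace ℝ ι, ∫⁻ y : EuclideanSpace ℝ κ, F (euclideanPair x y) := by
  rw [← measurePreserving_euclideanPair.lintegral_comp hF, lintegral_prod]
  exact (hF.comp measurable_euclideanPair).aemeasurable

/-- The Gaussian energy on a product, in terms of the energies between slices. -/
theorem gaussEnergy_euclideanPair {a : ℝ} (ha : 0 < a) {f : EuclideanSpace ℝ (ι ⊕ κ) → ℝ}
    (hf : Measurable f) :
    gaussEnergy a f f = ∫⁻ x : EuclideanSpace ℝ ι, ∫⁻ x' : EuclideanSpace ℝ ι,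
      ENNReal.ofReal (gaussKernel a (x - x')) *
        gaussEnergy a (fun y => f (euclideanPair x y)) (fun y => f (euclideanPair x' y)) := by
  have hG := measurable_gaussKernel (ι := ι ⊕ κ) a
  have hGκ := measurable_gaussKernel (ι := κ) a
  have hpair := measurable_euclideanPair (ι := ι) (κ := κ)
  have hm := measurable_gaussEnergy_integrand a hf hf
  unfold gaussEnergy
  rw [lintegral_euclideanPair hm.lintegral_prod_right']
  refine lintegral_congr fun x => ?_
  have h1 : ∀ y : EuclideanSpace ℝ κ, ∫⁻ z, ENNReal.ofReal ((f (euclideanPair x y) - f z) ^ 2) *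
      ENNReal.ofReal (gaussKernel a (euclideanPair x y - z)) =
      ∫⁻ x' : EuclideanSpace ℝ ι, ∫⁻ y' : EuclideanSpace ℝ κ,
        ENNReal.ofReal (gaussKernel a (x - x')) *
        (ENNReal.ofReal ((f (euclideanPair x y) - f (euclideanPair x' y')) ^ 2) *
          ENNReal.ofReal (gaussKernel a (y - y'))) := fun y => by
    rw [lintegral_euclideanPair (by fun_prop)]
    refine lintegral_congr fun x' => lintegral_congr fun y' => ?_
    rw [euclideanPair_sub, gaussKernel_euclideanPair ha,
      ENNReal.ofReal_mul (gaussKernel_nonneg ha _)]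
    ring
  simp_rw [h1]
  have hA : Measurable fun q : (EuclideanSpace ℝ κ × EuclideanSpace ℝ ι) × EuclideanSpace ℝ κ =>
      ENNReal.ofReal (gaussKernel a (x - q.1.2)) *
        (ENNReal.ofReal ((f (euclideanPair x q.1.1) - f (euclideanPair q.1.2 q.2)) ^ 2) *
          ENNReal.ofReal (gaussKernel a (q.1.1 - q.2))) := by
    have hGι := measurable_gaussKernel (ι := ι) a
    have m1' : Measurable fun q : (EuclideanSpace ℝ κ × EuclideanSpace ℝ ι) × EuclideanSpace ℝ κ =>
        (x, q.1.1) := by fun_prop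
    have m2' : Measurable fun q : (EuclideanSpace ℝ κ × EuclideanSpace ℝ ι) × EuclideanSpace ℝ κ =>
        (q.1.2, q.2) := by fun_prop
    have m1 : Measurable fun q : (EuclideanSpace ℝ κ × EuclideanSpace ℝ ι) × EuclideanSpace ℝ κ =>
        f (euclideanPair x q.1.1) := hf.comp (hpair.comp m1')
    have m2 : Measurable fun q : (EuclideanSpace ℝ κ × EuclideanSpace ℝ ι) × EuclideanSpace ℝ κ =>
        f (euclideanPair q.1.2 q.2) := hf.comp (hpair.comp m2')
    fun_prop
  rw [lintegral_lintegral_swap (f := fun (y : EuclideanSpace ℝ κ) (x' : EuclideanSpace ℝ ι) =>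
    ∫⁻ y' : EuclideanSpace ℝ κ,
        ENNReal.ofReal (gaussKernel a (x - x')) *
        (ENNReal.ofReal ((f (euclideanPair x y) - f (euclideanPair x' y')) ^ 2) *
          ENNReal.ofReal (gaussKernel a (y - y')))) hA.lintegral_prod_right'.aemeasurable]
  refine lintegral_congr fun x' => ?_
  rw [← lintegral_const_mul' _ _ ENNReal.ofReal_ne_top]
  refine lintegral_congr fun y => ?_
  rw [← lintegral_const_mul' _ _ ENNReal.ofReal_ne_top]

end Product

/-! ### Slicing and tensor product inequalities for the fractional energy -/

section ProductEnergy

variable {ι κ : Type} [Fintype ι] [Fintype κ]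

theorem isometry_euclideanPair_right (x : EuclideanSpace ℝ ι) :
    Isometry fun y : EuclideanSpace ℝ κ => euclideanPair x y := by
  refine Isometry.of_dist_eq fun y y' => ?_
  rw [dist_eq_norm, dist_eq_norm, euclideanPair_sub, sub_self,
    ← sq_eq_sq₀ (norm_nonneg _) (norm_nonneg _), norm_euclideanPair_sq]
  simp

theorem hasCompactSupport_slice {f : EuclideanSpace ℝ (ι ⊕ κ) → ℝ} (hf : HasCompactSupport f)
    (x : EuclideanSpace ℝ ι) : HasCompactSupport fun y => f (euclideanPair x y) :=
  hf.comp_isClosedEmbedding (isometry_euclideanPair_right x).isClosedEmbedding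

theorem measurable_gaussEnergy_slice {f : EuclideanSpace ℝ (ι ⊕ κ) → ℝ} (hf : Measurable f) :
    Measurable fun q : ℝ × EuclideanSpace ℝ ι =>
      gaussEnergy q.1 (fun y : EuclideanSpace ℝ κ => f (euclideanPair q.2 y))
        (fun y => f (euclideanPair q.2 y)) := by
  have hpair := measurable_euclideanPair (ι := ι) (κ := κ)
  have hK := measurable_gaussKernel_uncurry (ι := κ)
  have n1 : Measurable fun q : ((ℝ × EuclideanSpace ℝ ι) × EuclideanSpace ℝ κ) ×
      EuclideanSpace ℝ κ => (q.1.1.2, q.1.2) := by fun_prop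
  have n2 : Measurable fun q : ((ℝ × EuclideanSpace ℝ ι) × EuclideanSpace ℝ κ) ×
      EuclideanSpace ℝ κ => (q.1.1.2, q.2) := by fun_prop
  have n3 : Measurable fun q : ((ℝ × EuclideanSpace ℝ ι) × EuclideanSpace ℝ κ) ×
      EuclideanSpace ℝ κ => (q.1.1.1, q.1.2 - q.2) := by fun_prop
  have m1 : Measurable fun q : ((ℝ × EuclideanSpace ℝ ι) × EuclideanSpace ℝ κ) ×
      EuclideanSpace ℝ κ => f (euclideanPair q.1.1.2 q.1.2) := hf.comp (hpair.comp n1)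
  have m2 : Measurable fun q : ((ℝ × EuclideanSpace ℝ ι) × EuclideanSpace ℝ κ) ×
      EuclideanSpace ℝ κ => f (euclideanPair q.1.1.2 q.2) := hf.comp (hpair.comp n2)
  have m3 : Measurable fun q : ((ℝ × EuclideanSpace ℝ ι) × EuclideanSpace ℝ κ) ×
      EuclideanSpace ℝ κ => gaussKernel q.1.1.1 (q.1.2 - q.2) := hK.comp n3
  have hm : Measurable fun q : ((ℝ × EuclideanSpace ℝ ι) × EuclideanSpace ℝ κ) ×
      EuclideanSpace ℝ κ =>
      ENNReal.ofReal ((f (euclideanPair q.1.1.2 q.1.2) - f (euclideanPair q.1.1.2 q.2)) ^ 2) *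
        ENNReal.ofReal (gaussKernel q.1.1.1 (q.1.2 - q.2)) :=
    ((m1.sub m2).pow_const 2).ennreal_ofReal.mul m3.ennreal_ofReal
  unfold gaussEnergy
  exact hm.lintegral_prod_right'.lintegral_prod_right'

theorem measurable_gaussEnergy {f : EuclideanSpace ℝ ι → ℝ} (hf : Measurable f) :
    Measurable fun a : ℝ => gaussEnergy a f f := by
  have hK := measurable_gaussKernel_uncurry (ι := ι)
  have n3 : Measurable fun q : (ℝ × EuclideanSpace ℝ ι) × EuclideanSpace ℝ ι =>
      (q.1.1, q.1.2 - q.2) := by fun_prop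
  have m3 : Measurable fun q : (ℝ × EuclideanSpace ℝ ι) × EuclideanSpace ℝ ι =>
    gaussKernel q.1.1 (q.1.2 - q.2) := hK.comp n3
  have hm : Measurable fun q : (ℝ × EuclideanSpace ℝ ι) × EuclideanSpace ℝ ι =>
      ENNReal.ofReal ((f q.1.2 - f q.2) ^ 2) * ENNReal.ofReal (gaussKernel q.1.1 (q.1.2 - q.2)) := by
    fun_prop
  unfold gaussEnergy
  exact hm.lintegral_prod_right'.lintegral_prod_right'

/-- Twice the energy between the slices at $x$ and $x'$ is at least the sum of their own energies
(`gaussEnergy_self_add_self_le`). Since $G_a(x-x')$ has mass one in either variable, integration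
returns twice the integral of the slice energies. -/
theorem lintegral_gaussEnergy_slice_le {a : ℝ} (ha : 0 < a) {f : EuclideanSpace ℝ (ι ⊕ κ) → ℝ}
    (hf : Continuous f) (hf' : HasCompactSupport f) :
    ∫⁻ x : EuclideanSpace ℝ ι, gaussEnergy a (fun y : EuclideanSpace ℝ κ => f (euclideanPair x y))
      (fun y => f (euclideanPair x y)) ≤ gaussEnergy a f f := by
  set S : EuclideanSpace ℝ ι → ℝ≥0∞ := fun x =>
    gaussEnergy a (fun y : EuclideanSpace ℝ κ => f (euclideanPair x y))
      (fun y => f (euclideanPair x y)) with hS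
  have hSm : Measurable S :=
    (measurable_gaussEnergy_slice (ι := ι) (κ := κ) hf.measurable).of_uncurry_left
      (f := fun a (x : EuclideanSpace ℝ ι) =>
        gaussEnergy a (fun y : EuclideanSpace ℝ κ => f (euclideanPair x y))
          (fun y => f (euclideanPair x y)))
  have hG := measurable_gaussKernel (ι := ι) a
  have hc : ∀ x : EuclideanSpace ℝ ι, Continuous fun y : EuclideanSpace ℝ κ =>
    f (euclideanPair x y) := fun x => hf.comp (isometry_euclideanPair_right x).continuous
  have h2 : ∫⁻ x, ∫⁻ x', ENNReal.ofReal (gaussKernel a (x - x')) * (S x + S x') ≤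
      2 * gaussEnergy a f f := by
    rw [gaussEnergy_euclideanPair ha hf.measurable, ← lintegral_const_mul' _ _ (by norm_num)]
    refine lintegral_mono fun x => ?_
    rw [← lintegral_const_mul' _ _ (by norm_num)]
    refine lintegral_mono fun x' => ?_
    rw [mul_left_comm]
    gcongr
    exact gaussEnergy_self_add_self_le ha (hc x) (hasCompactSupport_slice hf' x) (hc x')
      (hasCompactSupport_slice hf' x')
  have h3 : ∫⁻ x, ∫⁻ x', ENNReal.ofReal (gaussKernel a (x - x')) * (S x + S x') =
      2 * ∫⁻ x, S x := by
    have e1 : ∀ x, ∫⁻ x', ENNReal.ofReal (gaussKernel a (x - x')) * (S x + S x') =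
        S x + ∫⁻ x', ENNReal.ofReal (gaussKernel a (x - x')) * S x' := fun x => by
      simp_rw [mul_add]
      rw [lintegral_add_left (by fun_prop), lintegral_mul_const _ (by fun_prop),
        lintegral_gaussKernel_sub_left ha, one_mul]
    simp_rw [e1]
    rw [lintegral_add_left hSm, lintegral_lintegral_swap (by fun_prop), two_mul]
    congr 1
    refine lintegral_congr fun x => ?_
    rw [lintegral_mul_const _ (by fun_prop), lintegral_gaussKernel_sub_right ha, one_mul]
  rw [h3] at h2
  exact (ENNReal.mul_le_mul_iff_right (by norm_num) (by norm_num)).mp h2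

/-- The fractional energy of a function dominates the integral of the energies of its slices. -/
theorem lintegral_fracEnergy_slice_le {s : ℝ} (hs0 : 0 < s) (hs1 : s < 1)
    {f : EuclideanSpace ℝ (ι ⊕ κ) → ℝ} (hf : Continuous f) (hfc : HasCompactSupport f) :
    ∫⁻ x : EuclideanSpace ℝ ι, fracEnergy s (fun y : EuclideanSpace ℝ κ => f (euclideanPair x y)) ≤
      fracEnergy s f := by
  have hc : ∀ x : EuclideanSpace ℝ ι, Measurable fun y : EuclideanSpace ℝ κ =>
    f (euclideanPair x y) := fun x => (hf.comp (isometry_euclideanPair_right x).continuous).measurable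
  have hw : Measurable fun a : ℝ =>
      ENNReal.ofReal ((4 : ℝ) ^ s / |Real.Gamma (-s)| * a ^ (s - 1)) := by fun_prop
  have hm := measurable_gaussEnergy_slice (ι := ι) hf.measurable
  have hm₁ : Measurable fun q : EuclideanSpace ℝ ι × ℝ =>
      gaussEnergy q.2 (fun y : EuclideanSpace ℝ κ => f (euclideanPair q.1 y))
        (fun y => f (euclideanPair q.1 y)) := by
    simpa only [Function.comp_def, Prod.fst_swap, Prod.snd_swap] using hm.comp measurable_swap
  have hm' : Measurable fun q : EuclideanSpace ℝ ι × ℝ =>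
      ENNReal.ofReal ((4 : ℝ) ^ s / |Real.Gamma (-s)| * q.2 ^ (s - 1)) *
      gaussEnergy q.2 (fun y : EuclideanSpace ℝ κ => f (euclideanPair q.1 y))
        (fun y => f (euclideanPair q.1 y)) :=
    (hw.comp measurable_snd).mul hm₁
  simp_rw [fun x => fracEnergy_eq_lintegral_gaussEnergy hs0 hs1 (hc x)]
  rw [fracEnergy_eq_lintegral_gaussEnergy hs0 hs1 hf.measurable,
    lintegral_lintegral_swap hm'.aemeasurable]
  refine setLIntegral_mono' measurableSet_Ioi fun a ha => ?_
  rw [lintegral_const_mul' _ _ ENNReal.ofReal_ne_top]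
  gcongr
  exact lintegral_gaussEnergy_slice_le ha hf hfc

/-- The tensor product of two functions. -/
def tensorFun {ι κ : Type} (Ψ : EuclideanSpace ℝ ι → ℝ) (w : EuclideanSpace ℝ κ → ℝ)
    (z : EuclideanSpace ℝ (ι ⊕ κ)) : ℝ :=
  Ψ (WithLp.toLp 2 fun i => z (Sum.inl i)) * w (WithLp.toLp 2 fun j => z (Sum.inr j))

theorem tensorFun_euclideanPair {ι κ : Type} (Ψ : EuclideanSpace ℝ ι → ℝ) (w : EuclideanSpace ℝ κ → ℝ)
    (x : EuclideanSpace ℝ ι) (y : EuclideanSpace ℝ κ) :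
    tensorFun Ψ w (euclideanPair x y) = Ψ x * w y := rfl

theorem measurable_tensorFun {ι κ : Type} {Ψ : EuclideanSpace ℝ ι → ℝ} {w : EuclideanSpace ℝ κ → ℝ}
    (hΨ : Measurable Ψ) (hw : Measurable w) : Measurable (tensorFun Ψ w) := by
  unfold tensorFun
  fun_prop

theorem lintegral_tensorFun_sq {Ψ : EuclideanSpace ℝ ι → ℝ} {w : EuclideanSpace ℝ κ → ℝ}
    (hΨ : Measurable Ψ) (hw : Measurable w) :
    ∫⁻ z, ENNReal.ofReal (tensorFun Ψ w z ^ 2) =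
      (∫⁻ x, ENNReal.ofReal (Ψ x ^ 2)) * ∫⁻ y, ENNReal.ofReal (w y ^ 2) := by
  have hm := measurable_tensorFun hΨ hw
  rw [lintegral_euclideanPair (by fun_prop), ← lintegral_mul_const _ (by fun_prop)]
  refine lintegral_congr fun x => ?_
  rw [← lintegral_const_mul' _ _ ENNReal.ofReal_ne_top]
  refine lintegral_congr fun y => ?_
  rw [tensorFun_euclideanPair, mul_pow, ENNReal.ofReal_mul (sq_nonneg _)]

/-- The slices are the multiples $\Psi(x)w$ and $\Psi(x')w$, so `gaussEnergy_const_mul_le` applies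
with $\alpha=\Psi(x)$, $\beta=\Psi(x')$. Integration against $G_a(x-x')$ turns $(\alpha-\beta)^2$
into the energy of $\Psi$ and $\alpha^2+\beta^2$ into twice its square norm. -/
theorem gaussEnergy_tensorFun_le {a : ℝ} (ha : 0 < a) {Ψ : EuclideanSpace ℝ ι → ℝ}
    {w : EuclideanSpace ℝ κ → ℝ} (hΨ : Measurable Ψ) (hw : Measurable w) :
    gaussEnergy a (tensorFun Ψ w) (tensorFun Ψ w) ≤
      gaussEnergy a Ψ Ψ * (∫⁻ y, ENNReal.ofReal (w y ^ 2)) +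
        (∫⁻ x, ENNReal.ofReal (Ψ x ^ 2)) * gaussEnergy a w w := by
  have hG := measurable_gaussKernel (ι := ι) a
  set N := ∫⁻ y, ENNReal.ofReal (w y ^ 2)
  set g := gaussEnergy a w w
  have h1 : 2 * gaussEnergy a (tensorFun Ψ w) (tensorFun Ψ w) ≤
      ∫⁻ x, ∫⁻ x', ((2 * N) * (ENNReal.ofReal ((Ψ x - Ψ x') ^ 2) *
        ENNReal.ofReal (gaussKernel a (x - x'))) +
        (ENNReal.ofReal (Ψ x ^ 2) * ENNReal.ofReal (gaussKernel a (x - x')) * g +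
        ENNReal.ofReal (Ψ x' ^ 2) * ENNReal.ofReal (gaussKernel a (x - x')) * g)) := by
    rw [gaussEnergy_euclideanPair ha (measurable_tensorFun hΨ hw),
      ← lintegral_const_mul' _ _ (by norm_num)]
    refine lintegral_mono fun x => ?_
    rw [← lintegral_const_mul' _ _ (by norm_num)]
    refine lintegral_mono fun x' => ?_
    simp only [tensorFun_euclideanPair]
    have h := gaussEnergy_const_mul_le ha (Ψ x) (Ψ x') hw
    rw [← two_mul] at h
    rw [mul_left_comm]
    calc _ ≤ ENNReal.ofReal (gaussKernel a (x - x')) * _ := mul_le_mul_right h _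
      _ = _ := by ring
  have e1 : ∫⁻ x, ∫⁻ x', (2 * N) * (ENNReal.ofReal ((Ψ x - Ψ x') ^ 2) *
      ENNReal.ofReal (gaussKernel a (x - x'))) = (2 * N) * gaussEnergy a Ψ Ψ := by
    have hm := measurable_gaussEnergy_integrand a hΨ hΨ
    rw [gaussEnergy, ← lintegral_const_mul _ hm.lintegral_prod_right']
    refine lintegral_congr fun x => ?_
    rw [lintegral_const_mul _ (by fun_prop)]
  have e2 : ∫⁻ x, ∫⁻ x', ENNReal.ofReal (Ψ x ^ 2) * ENNReal.ofReal (gaussKernel a (x - x')) * g =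
      (∫⁻ x, ENNReal.ofReal (Ψ x ^ 2)) * g := by
    rw [← lintegral_mul_const _ (by fun_prop)]
    refine lintegral_congr fun x => ?_
    rw [lintegral_mul_const _ (by fun_prop), lintegral_const_mul' _ _ ENNReal.ofReal_ne_top,
      lintegral_gaussKernel_sub_left ha, mul_one]
  have e3 : ∫⁻ x, ∫⁻ x', ENNReal.ofReal (Ψ x' ^ 2) * ENNReal.ofReal (gaussKernel a (x - x')) * g =
      (∫⁻ x, ENNReal.ofReal (Ψ x ^ 2)) * g := by
    rw [lintegral_lintegral_swap (by fun_prop), ← lintegral_mul_const _ (by fun_prop)]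
    refine lintegral_congr fun x => ?_
    rw [lintegral_mul_const _ (by fun_prop), lintegral_const_mul' _ _ ENNReal.ofReal_ne_top,
      lintegral_gaussKernel_sub_right ha, mul_one]
  have m1 : Measurable fun p : EuclideanSpace ℝ ι × EuclideanSpace ℝ ι =>
      (2 * N) * (ENNReal.ofReal ((Ψ p.1 - Ψ p.2) ^ 2) *
        ENNReal.ofReal (gaussKernel a (p.1 - p.2))) := by fun_prop
  have m2 : Measurable fun p : EuclideanSpace ℝ ι × EuclideanSpace ℝ ι =>
      ENNReal.ofReal (Ψ p.1 ^ 2) * ENNReal.ofReal (gaussKernel a (p.1 - p.2)) * g := by fun_prop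
  have e4 : ∀ x, ∫⁻ x', ((2 * N) * (ENNReal.ofReal ((Ψ x - Ψ x') ^ 2) *
        ENNReal.ofReal (gaussKernel a (x - x'))) +
        (ENNReal.ofReal (Ψ x ^ 2) * ENNReal.ofReal (gaussKernel a (x - x')) * g +
        ENNReal.ofReal (Ψ x' ^ 2) * ENNReal.ofReal (gaussKernel a (x - x')) * g)) =
      (∫⁻ x', (2 * N) * (ENNReal.ofReal ((Ψ x - Ψ x') ^ 2) *
        ENNReal.ofReal (gaussKernel a (x - x')))) +
      ((∫⁻ x', ENNReal.ofReal (Ψ x ^ 2) * ENNReal.ofReal (gaussKernel a (x - x')) * g) +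
        ∫⁻ x', ENNReal.ofReal (Ψ x' ^ 2) * ENNReal.ofReal (gaussKernel a (x - x')) * g) :=
    fun x => by
      rw [lintegral_add_left (by fun_prop), lintegral_add_left (by fun_prop)]
  simp_rw [e4] at h1
  rw [lintegral_add_left m1.lintegral_prod_right', lintegral_add_left m2.lintegral_prod_right',
    e1, e2, e3] at h1
  refine (ENNReal.mul_le_mul_iff_right (a := 2) (by norm_num) (by norm_num)).mp (h1.trans_eq ?_)
  ring

/-- Subadditivity of the fractional energy over tensor products. -/
theorem fracEnergy_tensorFun_le {s : ℝ} (hs0 : 0 < s) (hs1 : s < 1) {Ψ : EuclideanSpace ℝ ι → ℝ}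
    {w : EuclideanSpace ℝ κ → ℝ} (hΨ : Measurable Ψ) (hw : Measurable w) :
    fracEnergy s (tensorFun Ψ w) ≤ fracEnergy s Ψ * (∫⁻ y, ENNReal.ofReal (w y ^ 2)) +
      (∫⁻ x, ENNReal.ofReal (Ψ x ^ 2)) * fracEnergy s w := by
  have hk : Measurable fun a : ℝ =>
      ENNReal.ofReal ((4 : ℝ) ^ s / |Real.Gamma (-s)| * a ^ (s - 1)) := by fun_prop
  have h1 := measurable_gaussEnergy hΨ
  have h2 := measurable_gaussEnergy hw
  rw [fracEnergy_eq_lintegral_gaussEnergy hs0 hs1 (measurable_tensorFun hΨ hw),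
    fracEnergy_eq_lintegral_gaussEnergy hs0 hs1 hΨ, fracEnergy_eq_lintegral_gaussEnergy hs0 hs1 hw,
    ← lintegral_mul_const _ (by fun_prop), ← lintegral_const_mul _ (by fun_prop),
    ← lintegral_add_left (by fun_prop)]
  refine setLIntegral_mono' measurableSet_Ioi fun a ha => ?_
  calc _ ≤ ENNReal.ofReal ((4 : ℝ) ^ s / |Real.Gamma (-s)| * a ^ (s - 1)) * _ :=
        mul_le_mul_right (gaussEnergy_tensorFun_le ha hΨ hw) _
    _ = _ := by ring

end ProductEnergy

/-! ### Dilations -/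

section Scaling

variable {ι : Type} [Fintype ι]

theorem lintegral_comp_smul_euclidean {c : ℝ} (hc : 0 < c) {F : EuclideanSpace ℝ ι → ℝ≥0∞}
    (hF : Measurable F) :
    ∫⁻ x, F (c • x) = ENNReal.ofReal ((c ^ Fintype.card ι)⁻¹) * ∫⁻ x, F x := by
  have h1 : ∫⁻ x, F (c • x) = ∫⁻ x, F x ∂(Measure.map (c • ·) volume) := by
    rw [lintegral_map hF (by fun_prop)]
  rw [h1, Measure.map_addHaar_smul volume hc.ne', lintegral_smul_measure, smul_eq_mul,
    finrank_euclideanSpace, abs_of_pos (by positivity)]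

/-- The factor $c^{-n}$ is kept apart because the square $L^2$ norm scales by it too, so Rayleigh
quotients scale by $c^{2s}$ alone. -/
theorem gagliardoSq_comp_smul (s : ℝ) {c : ℝ} (hc : 0 < c) {u : EuclideanSpace ℝ ι → ℝ}
    (hu : Measurable u) :
    gagliardoSq s (fun x => u (c • x)) = ENNReal.ofReal (c ^ (2 * s)) *
      (ENNReal.ofReal ((c ^ Fintype.card ι)⁻¹) * gagliardoSq s u) := by
  set r : ℝ := (Fintype.card ι : ℝ) + 2 * s with hr
  have hpt : ∀ x y, ENNReal.ofReal ((u (c • x) - u (c • y)) ^ 2 / ‖x - y‖ ^ r) =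
      ENNReal.ofReal (c ^ r) *
        ENNReal.ofReal ((u (c • x) - u (c • y)) ^ 2 / ‖c • x - c • y‖ ^ r) := by
    intro x y
    rw [← ENNReal.ofReal_mul (by positivity), ← smul_sub, norm_smul, Real.norm_of_nonneg hc.le,
      Real.mul_rpow hc.le (norm_nonneg _)]
    congr 1
    have : c ^ r ≠ 0 := by positivity
    field_simp
  have hm : Measurable fun p : EuclideanSpace ℝ ι × EuclideanSpace ℝ ι =>
      ENNReal.ofReal ((u p.1 - u p.2) ^ 2 / ‖p.1 - p.2‖ ^ r) := by fun_prop
  have h1 : ∀ x, ∫⁻ y, ENNReal.ofReal ((u (c • x) - u (c • y)) ^ 2 / ‖x - y‖ ^ r) =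
      ENNReal.ofReal (c ^ r) * (ENNReal.ofReal ((c ^ Fintype.card ι)⁻¹) *
        ∫⁻ y, ENNReal.ofReal ((u (c • x) - u y) ^ 2 / ‖c • x - y‖ ^ r)) := fun x => by
    simp_rw [hpt]
    rw [lintegral_const_mul' _ _ ENNReal.ofReal_ne_top]
    congr 1
    exact lintegral_comp_smul_euclidean hc
      (F := fun y => ENNReal.ofReal ((u (c • x) - u y) ^ 2 / ‖c • x - y‖ ^ r)) (by fun_prop)
  unfold gagliardoSq
  simp_rw [← hr, h1]
  rw [lintegral_const_mul' _ _ ENNReal.ofReal_ne_top,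
    lintegral_const_mul' _ _ ENNReal.ofReal_ne_top,
    lintegral_comp_smul_euclidean hc (F := fun x => ∫⁻ y,
      ENNReal.ofReal ((u x - u y) ^ 2 / ‖x - y‖ ^ r)) hm.lintegral_prod_right',
    ← mul_assoc (ENNReal.ofReal (c ^ r)), ← ENNReal.ofReal_mul (by positivity)]
  congr 2
  rw [hr, Real.rpow_add hc, Real.rpow_natCast]
  field_simp

end Scaling

/-- The min-max principle, with the trial space given by its coordinates. -/
theorem exists_linearIndependent_formEigenvectors {K L : Type*} [NormedAddCommGroup K]
    [InnerProductSpace ℝ K] [CompleteSpace K] [NormedAddCommGroup L] [InnerProductSpace ℝ L]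
    [CompleteSpace L] {J : K →L[ℝ] L} (hJ : IsCompactOperator J)
    (hinj : Function.Injective J) {k : ℕ} {v : Fin k → K}
    (hv : ∀ c : Fin k → ℝ, ∑ j, c j • v j = 0 → ∀ j, c j = 0)
    {t t' : ℝ} (ht' : 0 < t') (htt' : t < t')
    (hle : ∀ c : Fin k → ℝ, ‖∑ j, c j • v j‖ ^ 2 ≤ t * ‖J (∑ j, c j • v j)‖ ^ 2) :
    ∃ u : Fin k → K, LinearIndependent ℝ (fun i => J (u i)) ∧
      ∀ i, ∃ μ ≤ t', IsFormEigenvector J μ (u i) := by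
  obtain ⟨u, hu, hμ⟩ := exists_formEigenvectors_of_rayleigh_le hJ hinj
    (Fintype.linearIndependent_iff.mpr hv) ht' htt' (fun x hx => by
      obtain ⟨c, rfl⟩ := (Submodule.mem_span_range_iff_exists_fun ℝ).mp hx
      exact hle c)
  exact ⟨u, hu.map' (J : K →ₗ[ℝ] L) (LinearMap.ker_eq_bot.mpr hinj), hμ⟩

/-! ### Rayleigh quotients, the Poincaré constant and Dirichlet eigenvalues -/

section Rayleigh

open scoped InnerProductSpace

variable {ι : Type} [Fintype ι] {s : ℝ} {Ω : Set (EuclideanSpace ℝ ι)}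

theorem ofReal_norm_sq_eq_lintegral {α : Type*} [MeasurableSpace α] {μ : Measure α}
    (u : Lp ℝ 2 μ) : ENNReal.ofReal (‖u‖ ^ 2) = ∫⁻ x, ENNReal.ofReal (u x ^ 2) ∂μ := by
  rw [lintegral_ofReal_sq_eq_eLpNorm_sq, ← Lp.enorm_def, ENNReal.ofReal_pow (norm_nonneg _),
    ofReal_norm]

theorem ofReal_norm_fst_sq {z : GraphSpace ι} {f : EuclideanSpace ℝ ι → ℝ}
    (hf : z.fst =ᵐ[volume] f) :
    ENNReal.ofReal (‖z.fst‖ ^ 2) = ∫⁻ x, ENNReal.ofReal (f x ^ 2) := by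
  rw [ofReal_norm_sq_eq_lintegral]
  refine lintegral_congr_ae ?_
  filter_upwards [hf] with x hx
  rw [hx]

theorem ofReal_norm_snd_sq {z : GraphSpace ι} (hz : z ∈ formDomain s Ω)
    {f : EuclideanSpace ℝ ι → ℝ} (hf : z.fst =ᵐ[volume] f) :
    ENNReal.ofReal (‖z.snd‖ ^ 2) = gagliardoSq s f := by
  have hfm : AEStronglyMeasurable f volume := (Lp.aestronglyMeasurable z.fst).congr hf
  rw [gagliardoSq_eq_lintegral s hfm, ofReal_norm_sq_eq_lintegral]
  refine lintegral_congr_ae ?_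
  filter_upwards [(ae_eq_of_mem_formDomain hz).1, fracDiff_congr_ae s hf] with p h1 h2
  rw [h1, h2]

theorem fracForm_self {z : GraphSpace ι} (hz : z ∈ formDomain s Ω) :
    fracForm s z.fst z.fst = fracLaplaceConst (Fintype.card ι) s / 2 * ‖z.snd‖ ^ 2 := by
  rw [fracForm_eq_inner hz hz, real_inner_self_eq_norm_sq]

theorem setIntegral_sq {z : GraphSpace ι} (hz : z ∈ formDomain s Ω) :
    ∫ x in Ω, z.fst x ^ 2 = ‖z.fst‖ ^ 2 := by
  rw [← real_inner_self_eq_norm_sq, ← setIntegral_mul_eq_inner hz]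
  simp only [sq]

theorem rayleigh_nonneg [Nonempty ι] (hs0 : 0 < s) (hs1 : s < 1)
    {u : Lp ℝ 2 (volume : Measure (EuclideanSpace ℝ ι))} (hu : u ∈ fracSobolev s Ω) :
    0 ≤ fracForm s u u / ∫ x in Ω, (u x) ^ 2 := by
  obtain ⟨z, hz, rfl⟩ := (mem_fracSobolev_iff hs0 hs1).mp hu
  rw [fracForm_self hz, setIntegral_sq hz]
  have := fracLaplaceConst_pos (Fintype.card ι) hs0 hs1
  positivity

theorem poincareConst_nonneg [Nonempty ι] (hs0 : 0 < s) (hs1 : s < 1) :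
    0 ≤ poincareConst s Ω := by
  refine Real.sInf_nonneg ?_
  rintro r ⟨u, hu, -, rfl⟩
  exact rayleigh_nonneg hs0 hs1 hu

theorem poincareConst_mul_norm_sq_le [Nonempty ι] (hs0 : 0 < s) (hs1 : s < 1) {z : GraphSpace ι}
    (hz : z ∈ formDomain s Ω) :
    poincareConst s Ω * ‖z.fst‖ ^ 2 ≤
      fracLaplaceConst (Fintype.card ι) s / 2 * ‖z.snd‖ ^ 2 := by
  have hC := fracLaplaceConst_pos (Fintype.card ι) hs0 hs1
  by_cases h0 : z.fst = 0
  · rw [h0]; simp; positivity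
  · have hpos : 0 < ‖z.fst‖ ^ 2 := by have := norm_pos_iff.mpr h0; positivity
    rw [← le_div_iff₀ hpos]
    refine csInf_le ⟨0, ?_⟩ ⟨z.fst, (mem_fracSobolev_iff hs0 hs1).mpr ⟨z, hz, rfl⟩, h0, ?_⟩
    · rintro r ⟨u, hu, -, rfl⟩
      exact rayleigh_nonneg hs0 hs1 hu
    · rw [fracForm_self hz, setIntegral_sq hz]

/-- The factor 2 appears because `fracEnergy` lacks the $\frac12$ of the bilinear form. -/
theorem IsTestFunction.two_mul_poincareConst_mul_le [Nonempty ι] (hs0 : 0 < s) (hs1 : s < 1)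
    {φ : EuclideanSpace ℝ ι → ℝ} (hφ : IsTestFunction Ω φ) :
    ENNReal.ofReal (2 * poincareConst s Ω) * ∫⁻ x, ENNReal.ofReal (φ x ^ 2) ≤ fracEnergy s φ := by
  have hC := fracLaplaceConst_pos (Fintype.card ι) hs0 hs1
  have hP := poincareConst_nonneg (Ω := Ω) hs0 hs1
  have hz := hφ.toGraph_mem hs0 hs1
  have hf : (hφ.toGraph hs0 hs1).fst =ᵐ[volume] φ := hφ.memLp.coeFn_toLp
  rw [fracEnergy, ← ofReal_norm_fst_sq hf, ← ofReal_norm_snd_sq hz hf,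
    ← ENNReal.ofReal_mul (by positivity), ← ENNReal.ofReal_mul hC.le]
  apply ENNReal.ofReal_le_ofReal
  have := poincareConst_mul_norm_sq_le hs0 hs1 hz
  linarith

theorem exists_isTestFunction_eq_one (hΩ : IsOpen Ω) {c : EuclideanSpace ℝ ι} (hc : c ∈ Ω) :
    ∃ φ, IsTestFunction Ω φ ∧ φ c = 1 := by
  obtain ⟨φ, h1, h2, h3, -, h5⟩ :=
    exists_contDiff_tsupport_subset (n := (⊤ : ℕ∞)) (hΩ.mem_nhds hc)
  exact ⟨φ, ⟨h3, h2, h1⟩, h5⟩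

theorem IsTestFunction.lintegral_sq_ne_zero {φ : EuclideanSpace ℝ ι → ℝ}
    (hφ : IsTestFunction Ω φ) {c : EuclideanSpace ℝ ι} (hc : φ c ≠ 0) :
    ∫⁻ x, ENNReal.ofReal (φ x ^ 2) ≠ 0 := by
  have hcont := hφ.continuous
  rw [Ne, lintegral_eq_zero_iff (by fun_prop)]
  intro h
  have h1 : φ =ᵐ[volume] fun _ => (0 : ℝ) := by
    filter_upwards [h] with x hx
    simp only [Pi.zero_apply, ENNReal.ofReal_eq_zero] at hx
    exact pow_eq_zero_iff (two_ne_zero) |>.mp (le_antisymm hx (sq_nonneg _))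
  have h2 := (hcont.ae_eq_iff_eq volume continuous_const).mp h1
  exact hc (congrFun h2 c)

theorem IsTestFunction.lintegral_sq_ne_top {φ : EuclideanSpace ℝ ι → ℝ}
    (hφ : IsTestFunction Ω φ) : ∫⁻ x, ENNReal.ofReal (φ x ^ 2) ≠ ∞ := by
  rw [lintegral_ofReal_sq_eq_eLpNorm_sq]
  exact ENNReal.pow_ne_top hφ.memLp.eLpNorm_ne_top

/-- The Poincaré constant is approached by the Rayleigh quotients of test functions. -/
theorem exists_isTestFunction_fracEnergy_le [Nonempty ι] (hs0 : 0 < s) (hs1 : s < 1)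
    (hΩ : IsOpen Ω) (hne : Ω.Nonempty) {ε : ℝ} (hε : 0 < ε) :
    ∃ w, IsTestFunction Ω w ∧ ∫⁻ x, ENNReal.ofReal (w x ^ 2) ≠ 0 ∧
      fracEnergy s w ≤
        ENNReal.ofReal (2 * (poincareConst s Ω + ε)) * ∫⁻ x, ENNReal.ofReal (w x ^ 2) := by
  have hC := fracLaplaceConst_pos (Fintype.card ι) hs0 hs1
  have hP := poincareConst_nonneg (Ω := Ω) hs0 hs1
  set c := fracLaplaceConst (Fintype.card ι) s with hc
  set P := poincareConst s Ω with hPdef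
  obtain ⟨z, hz, hlt⟩ : ∃ z ∈ formDomain s Ω, c / 2 * ‖z.snd‖ ^ 2 < (P + ε) * ‖z.fst‖ ^ 2 := by
    obtain ⟨x, hx⟩ := hne
    obtain ⟨φ, hφ, hφx⟩ := exists_isTestFunction_eq_one hΩ hx
    -- The infimum of an empty set of reals defaults to 0, so near-minimisers exist only once a
    -- nonzero element of the space is exhibited.
    have hnonempty : {r | ∃ u ∈ fracSobolev s Ω, u ≠ 0 ∧
        r = fracForm s u u / ∫ x in Ω, (u x) ^ 2}.Nonempty := by
      refine ⟨_, (hφ.toGraph hs0 hs1).fst, (mem_fracSobolev_iff hs0 hs1).mpr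
        ⟨_, hφ.toGraph_mem hs0 hs1, rfl⟩, ?_, rfl⟩
      intro h0
      have hf : (hφ.toGraph hs0 hs1).fst =ᵐ[volume] φ := hφ.memLp.coeFn_toLp
      have h1 := ofReal_norm_fst_sq hf
      rw [h0] at h1
      have := hφ.lintegral_sq_ne_zero (c := x) (by rw [hφx]; exact one_ne_zero)
      rw [← h1] at this
      simp at this
    obtain ⟨r, ⟨u, hu, hu0, rfl⟩, hr⟩ :=
      exists_lt_of_csInf_lt hnonempty (show sInf _ < P + ε from lt_add_of_pos_right P hε)
    obtain ⟨z, hz, rfl⟩ := (mem_fracSobolev_iff hs0 hs1).mp hu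
    refine ⟨z, hz, ?_⟩
    have hpos : 0 < ‖z.fst‖ ^ 2 := by have := norm_pos_iff.mpr hu0; positivity
    rwa [fracForm_self hz, setIntegral_sq hz, div_lt_iff₀ hpos] at hr
  -- A strict bound on the quotient is an open condition in the graph norm, so it is met by some
  -- test function.
  have hopen : IsOpen {z : GraphSpace ι | c / 2 * ‖z.snd‖ ^ 2 < (P + ε) * ‖z.fst‖ ^ 2} := by
    have h1 : Continuous fun z : GraphSpace ι => z.fst := (WithLp.fstL 2 ℝ _ _).continuous
    have h2 : Continuous fun z : GraphSpace ι => z.snd := (WithLp.sndL 2 ℝ _ _).continuous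
    exact isOpen_lt (by fun_prop) (by fun_prop)
  obtain ⟨y, hy, hyT⟩ := mem_closure_iff.mp hz _ hopen hlt
  have hyD : y ∈ formDomain s Ω := Submodule.le_topologicalClosure _ hyT
  obtain ⟨w, hw, h1, -⟩ := hyT
  refine ⟨w, hw, ?_, ?_⟩
  · rw [← ofReal_norm_fst_sq h1]
    intro h0
    rw [ENNReal.ofReal_eq_zero] at h0
    have h2 : c / 2 * ‖y.snd‖ ^ 2 < (P + ε) * ‖y.fst‖ ^ 2 := hy
    have h3 : 0 ≤ c / 2 * ‖y.snd‖ ^ 2 := by positivity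
    have h4 : (P + ε) * ‖y.fst‖ ^ 2 ≤ 0 := mul_nonpos_of_nonneg_of_nonpos (by positivity) h0
    linarith
  · rw [fracEnergy, ← ofReal_norm_fst_sq h1, ← ofReal_norm_snd_sq hyD h1, ← hc,
      ← ENNReal.ofReal_mul hC.le, ← ENNReal.ofReal_mul (by positivity)]
    apply ENNReal.ofReal_le_ofReal
    have h2 : c / 2 * ‖y.snd‖ ^ 2 < (P + ε) * ‖y.fst‖ ^ 2 := hy
    linarith

/-- Only finitely many Dirichlet eigenvalues of a bounded set lie below a given level. -/
theorem finite_dirichletEigenvalues_le [Nonempty ι] (hs0 : 0 < s) (hs1 : s < 1)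
    (hΩ : Bornology.IsBounded Ω) (t : ℝ) :
    {μ : ℝ | μ ≤ t ∧ ∃ u, IsDirichletEigenfunction s Ω μ u}.Finite := by
  have hc : 0 < fracLaplaceConst (Fintype.card ι) s / 2 :=
    half_pos (fracLaplaceConst_pos _ hs0 hs1)
  set c := fracLaplaceConst (Fintype.card ι) s / 2 with hcdef
  have hinj : Function.Injective fun μ : ℝ => 1 + μ / c := fun μ ν h => by
    have h' : μ / c = ν / c := add_left_cancel h
    exact (div_left_inj' hc.ne').mp h'
  refine ((finite_formEigenvalues_le (isCompactOperator_formEmbedding (Ω := Ω) hs0 hΩ)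
    (1 + t / c)).preimage hinj.injOn).subset ?_
  rintro μ ⟨hμ, u, hu⟩
  obtain ⟨z, -, hz⟩ := (isDirichletEigenfunction_iff hs0 hs1).mp hu
  exact ⟨show 1 + μ / c ≤ 1 + t / c by gcongr, z, hz⟩

theorem isLeast_dirichletEigenvalue [Nonempty ι] (hs0 : 0 < s) (hs1 : s < 1)
    (hΩ : Bornology.IsBounded Ω) {k : ℕ} (hk : 1 ≤ k) (hne : (eigenvalueLevels s Ω k).Nonempty) :
    IsLeast (eigenvalueLevels s Ω k) (dirichletEigenvalue s Ω k) :=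
  isLeast_sInf_levels (IsDirichletEigenfunction s Ω) (finite_dirichletEigenvalues_le hs0 hs1 hΩ)
    hk hne

theorem IsFormEigenvector.isDirichletEigenfunction [Nonempty ι] (hs0 : 0 < s) (hs1 : s < 1) {μ : ℝ}
    {z : formDomain s Ω} (hz : IsFormEigenvector (formEmbedding s Ω) μ z) :
    IsDirichletEigenfunction s Ω ((μ - 1) * (fracLaplaceConst (Fintype.card ι) s / 2))
      (formEmbedding s Ω z) := by
  have hc : 0 < fracLaplaceConst (Fintype.card ι) s / 2 :=
    half_pos (fracLaplaceConst_pos _ hs0 hs1)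
  have e : 1 + (μ - 1) * (fracLaplaceConst (Fintype.card ι) s / 2) /
      (fracLaplaceConst (Fintype.card ι) s / 2) = μ := by
    rw [mul_div_cancel_right₀ _ hc.ne', add_sub_cancel]
  refine (isDirichletEigenfunction_iff hs0 hs1).mpr ⟨z, rfl, ?_⟩
  rwa [e]

/-- The min-max principle for the Dirichlet eigenvalues. -/
theorem mem_eigenvalueLevels_of_rayleigh_le [Nonempty ι] (hs0 : 0 < s) (hs1 : s < 1)
    (hΩ : Bornology.IsBounded Ω) {k : ℕ} {v : Fin k → GraphSpace ι}
    (hvD : ∀ j, v j ∈ formDomain s Ω)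
    (hv : ∀ c : Fin k → ℝ, ∑ j, c j • v j = 0 → ∀ j, c j = 0) {T T' : ℝ} (hT : 0 ≤ T)
    (hTT' : T < T')
    (hle : ∀ c : Fin k → ℝ, fracLaplaceConst (Fintype.card ι) s / 2 *
      ‖(∑ j, c j • v j).snd‖ ^ 2 ≤ T * ‖(∑ j, c j • v j).fst‖ ^ 2) :
    T' ∈ eigenvalueLevels s Ω k := by
  have hc : 0 < fracLaplaceConst (Fintype.card ι) s / 2 :=
    half_pos (fracLaplaceConst_pos _ hs0 hs1)
  set c := fracLaplaceConst (Fintype.card ι) s / 2 with hcdef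
  have hT' : 0 < T' := hT.trans_lt hTT'
  have hcoe : ∀ a : Fin k → ℝ, ((∑ j, a j • (⟨v j, hvD j⟩ : formDomain s Ω) : formDomain s Ω) :
      GraphSpace ι) = ∑ j, a j • v j := fun a => by simp
  -- The levels are shifted to $1+T/c$ and $1+T'/c$ because the graph norm squared is
  -- $\|u\|_{L^2}^2+c^{-1}\mathcal E(u,u)$.
  obtain ⟨u, hu, hμ⟩ := exists_linearIndependent_formEigenvectors
    (isCompactOperator_formEmbedding (Ω := Ω) hs0 hΩ) formEmbedding_injective
    (v := fun j => ⟨v j, hvD j⟩) (t := 1 + T / c) (t' := 1 + T' / c)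
    (fun a ha => hv a (by rw [← hcoe a, ha, Submodule.coe_zero]))
    (by positivity) (by gcongr) (fun a => by
      have h1 := hle a
      have h2 := WithLp.prod_norm_sq_eq_of_L2 (∑ j, a j • v j)
      rw [formEmbedding_apply, Submodule.coe_norm, hcoe a, h2, add_mul, one_mul]
      gcongr
      rw [div_mul_eq_mul_div, le_div_iff₀ hc]
      linarith)
  refine ⟨fun i => formEmbedding s Ω (u i), hu, fun i => ?_⟩
  obtain ⟨μ, hμ', hEig⟩ := hμ i
  refine ⟨(μ - 1) * c, ?_, hEig.isDirichletEigenfunction hs0 hs1⟩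
  rw [← le_div_iff₀ hc]
  linarith

/-- A lower bound for the form is a lower bound for the levels. -/
theorem le_of_mem_eigenvalueLevels [Nonempty ι] (hs0 : 0 < s) (hs1 : s < 1) {P t : ℝ} {k : ℕ}
    (hk : 1 ≤ k) (hP : ∀ z ∈ formDomain s Ω, P * ‖z.fst‖ ^ 2 ≤
      fracLaplaceConst (Fintype.card ι) s / 2 * ‖z.snd‖ ^ 2)
    (ht : t ∈ eigenvalueLevels s Ω k) : P ≤ t := by
  obtain ⟨u, -, hu⟩ := ht
  obtain ⟨μ, hμ, hmem, hu0, hEig⟩ := hu ⟨0, hk⟩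
  refine le_trans ?_ hμ
  obtain ⟨z, hz, hzu⟩ := (mem_fracSobolev_iff hs0 hs1).mp hmem
  have h1 := hEig _ hmem
  rw [← hzu] at h1 hu0
  simp only [← sq] at h1
  rw [fracForm_self hz, setIntegral_sq hz] at h1
  have hpos : 0 < ‖z.fst‖ ^ 2 := by have := norm_pos_iff.mpr hu0; positivity
  have h2 := hP z hz
  rw [h1] at h2
  exact le_of_mul_le_mul_right h2 hpos

end Rayleigh

/-! ### Disjointly supported trial functions and their dilates -/

section TrialFunctions

variable {ι : Type} [Fintype ι]

/-- Test functions of the cube `(-1, 1)^ι` with disjoint supports. -/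
theorem exists_disjoint_testFunctions [Nonempty ι] (k : ℕ) :
    ∃ ψ : Fin k → EuclideanSpace ℝ ι → ℝ,
      (∀ j, IsTestFunction {x : EuclideanSpace ℝ ι | ∀ i, x i ∈ Ioo (-1 : ℝ) 1} (ψ j)) ∧
      (∀ j, ∫⁻ x, ENNReal.ofReal (ψ j x ^ 2) ≠ 0) ∧
      ∀ j l, j ≠ l → ∀ x, ψ j x * ψ l x = 0 := by
  -- Boxes of side $1/k$ along the diagonal of the unit cube: any single coordinate separates two of
  -- them.
  let U : Fin k → Set (EuclideanSpace ℝ ι) := fun j =>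
    {x | ∀ i, x i ∈ Ioo ((j : ℝ) / k) (((j : ℝ) + 1) / k)}
  have hU : ∀ j, IsOpen (U j) := fun j => by
    simp only [U, ofPred_forall]
    exact isOpen_iInter_of_finite fun i => isOpen_Ioo.preimage (by fun_prop)
  have hk : ∀ j : Fin k, (0 : ℝ) < k := fun j => by exact_mod_cast j.pos
  have hc : ∀ j, WithLp.toLp 2 (fun _ : ι => ((j : ℝ) + 1 / 2) / k) ∈ U j := fun j i => by
    have := hk j
    constructor
    · simp only; gcongr; linarith
    · simp only; gcongr; linarith
  choose ψ hψ hψc using fun j => exists_isTestFunction_eq_one (hU j) (hc j)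
  refine ⟨ψ, fun j => ⟨(hψ j).1, (hψ j).2.1, (hψ j).2.2.trans ?_⟩, fun j => ?_, ?_⟩
  · intro x hx i
    have h0 := hk j
    have h1 := (hx i).1
    have h2 := (hx i).2
    have h3 : (0 : ℝ) ≤ (j : ℝ) / k := by positivity
    have h4 : ((j : ℝ) + 1) / k ≤ 1 := by
      rw [div_le_one h0]
      exact_mod_cast j.2
    constructor <;> linarith
  · exact (hψ j).lintegral_sq_ne_zero (by rw [hψc]; exact one_ne_zero)
  · intro j l hjl x
    by_contra hne
    have h1 : x ∈ U j := by
      by_contra h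
      exact hne (by rw [(hψ j).eq_zero h, zero_mul])
    have h2 : x ∈ U l := by
      by_contra h
      exact hne (by rw [(hψ l).eq_zero h, mul_zero])
    obtain ⟨i⟩ := ‹Nonempty ι›
    have h0 := hk j
    have a1 := h1 i
    have a2 := h2 i
    have b1 : (j : ℝ) / k < ((l : ℝ) + 1) / k := a1.1.trans a2.2
    have b2 : (l : ℝ) / k < ((j : ℝ) + 1) / k := a2.1.trans a1.2
    rw [div_lt_div_iff_of_pos_right h0] at b1 b2
    have c1 : (j : ℕ) < l + 1 := by exact_mod_cast b1
    have c2 : (l : ℕ) < j + 1 := by exact_mod_cast b2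
    exact hjl (Fin.ext (by omega))

theorem lintegral_sum_sq_of_disjoint {k : ℕ} {ψ : Fin k → EuclideanSpace ℝ ι → ℝ}
    (hm : ∀ j, Measurable (ψ j)) (hdis : ∀ j l, j ≠ l → ∀ x, ψ j x * ψ l x = 0) (c : Fin k → ℝ) :
    ∫⁻ x, ENNReal.ofReal ((∑ j, c j * ψ j x) ^ 2) =
      ∑ j, ENNReal.ofReal (c j ^ 2) * ∫⁻ x, ENNReal.ofReal (ψ j x ^ 2) := by
  have h1 : ∀ x, (∑ j, c j * ψ j x) ^ 2 = ∑ j, c j ^ 2 * ψ j x ^ 2 := fun x => by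
    rw [sq, Finset.sum_mul_sum]
    refine Finset.sum_congr rfl fun j _ => ?_
    rw [Finset.sum_eq_single j]
    · ring
    · intro l _ hl
      have := hdis j l hl.symm x
      linear_combination c j * c l * this
    · simp
  have h2 : ∀ x, ENNReal.ofReal ((∑ j, c j * ψ j x) ^ 2) =
      ∑ j, ENNReal.ofReal (c j ^ 2) * ENNReal.ofReal (ψ j x ^ 2) := fun x => by
    rw [h1, ENNReal.ofReal_sum_of_nonneg fun j _ => by positivity]
    exact Finset.sum_congr rfl fun j _ => ENNReal.ofReal_mul (sq_nonneg _)
  simp_rw [h2]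
  rw [lintegral_finsetSum _ fun j _ => by have := hm j; fun_prop]
  exact Finset.sum_congr rfl fun j _ => lintegral_const_mul' _ _ ENNReal.ofReal_ne_top

/-- The energy is nonlocal, so disjoint supports do not remove the cross terms; Cauchy–Schwarz
bounds them at the cost of a factor $k$. -/
theorem gagliardoSq_sum_le (s : ℝ) {k : ℕ} {ψ : Fin k → EuclideanSpace ℝ ι → ℝ}
    (hm : ∀ j, Measurable (ψ j)) (c : Fin k → ℝ) :
    gagliardoSq s (fun x => ∑ j, c j * ψ j x) ≤
      k * ∑ j, ENNReal.ofReal (c j ^ 2) * gagliardoSq s (ψ j) := by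
  have hpt : ∀ p : EuclideanSpace ℝ ι × EuclideanSpace ℝ ι,
      ENNReal.ofReal (fracDiff s (fun x => ∑ j, c j * ψ j x) p ^ 2) ≤
        k * ∑ j, ENNReal.ofReal (c j ^ 2) * ENNReal.ofReal (fracDiff s (ψ j) p ^ 2) := by
    intro p
    have h1 : fracDiff s (fun x => ∑ j, c j * ψ j x) p = ∑ j, c j * fracDiff s (ψ j) p := by
      simp only [fracDiff]
      rw [← Finset.sum_sub_distrib, Finset.sum_div]
      exact Finset.sum_congr rfl fun j _ => by ring
    have h2 := sq_sum_le_card_mul_sum_sq (s := (Finset.univ : Finset (Fin k)))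
      (f := fun j => c j * fracDiff s (ψ j) p)
    rw [Finset.card_univ, Fintype.card_fin] at h2
    rw [h1]
    refine (ENNReal.ofReal_le_ofReal h2).trans_eq ?_
    rw [ENNReal.ofReal_mul (by positivity), ENNReal.ofReal_natCast,
      ENNReal.ofReal_sum_of_nonneg fun j _ => sq_nonneg _]
    congr 1
    refine Finset.sum_congr rfl fun j _ => ?_
    rw [mul_pow, ENNReal.ofReal_mul (sq_nonneg _)]
  have hsm : Measurable fun x => ∑ j, c j * ψ j x :=
    Finset.measurable_sum _ fun j _ => (hm j).const_mul _
  have hjm : ∀ j, AEMeasurable (fracDiff s (ψ j)) volume := fun j =>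
    (aestronglyMeasurable_fracDiff s (hm j).aestronglyMeasurable).aemeasurable
  rw [gagliardoSq_eq_lintegral s hsm.aestronglyMeasurable]
  refine (lintegral_mono hpt).trans_eq ?_
  rw [lintegral_const_mul' _ _ (by simp), lintegral_finsetSum' _ fun j _ =>
    (((hjm j).pow_const 2).ennreal_ofReal).const_mul _]
  congr 1
  refine Finset.sum_congr rfl fun j _ => ?_
  rw [lintegral_const_mul' _ _ ENNReal.ofReal_ne_top,
    gagliardoSq_eq_lintegral s (hm j).aestronglyMeasurable]

/-- One constant bounds the quotient on the whole span: square norms add up by disjointness, and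
$M=k\sum_jq_j$ with $q_j$ the quotient of $\psi_j$. -/
theorem exists_gagliardoSq_sum_le [Nonempty ι] {s : ℝ} (hs0 : 0 < s) (hs1 : s < 1)
    {Ω : Set (EuclideanSpace ℝ ι)} {k : ℕ} {ψ : Fin k → EuclideanSpace ℝ ι → ℝ}
    (hψ : ∀ j, IsTestFunction Ω (ψ j)) (hψ0 : ∀ j, ∫⁻ x, ENNReal.ofReal (ψ j x ^ 2) ≠ 0)
    (hdis : ∀ j l, j ≠ l → ∀ x, ψ j x * ψ l x = 0) :
    ∃ M : ℝ, 0 ≤ M ∧ ∀ c : Fin k → ℝ, gagliardoSq s (fun x => ∑ j, c j * ψ j x) ≤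
      ENNReal.ofReal M * ∫⁻ x, ENNReal.ofReal ((∑ j, c j * ψ j x) ^ 2) := by
  let q : Fin k → ℝ≥0∞ := fun j => gagliardoSq s (ψ j) / ∫⁻ x, ENNReal.ofReal (ψ j x ^ 2)
  have hq : ∀ j, q j ≠ ∞ := fun j =>
    (ENNReal.div_lt_top ((hψ j).gagliardoSq_lt_top hs0 hs1).ne (hψ0 j)).ne
  have hm : ∀ j, Measurable (ψ j) := fun j => (hψ j).continuous.measurable
  have hfin : (k : ℝ≥0∞) * ∑ j, q j ≠ ∞ :=
    ENNReal.mul_ne_top (by simp) (ENNReal.sum_ne_top.mpr fun j _ => hq j)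
  refine ⟨((k : ℝ≥0∞) * ∑ j, q j).toReal, ENNReal.toReal_nonneg, fun c => ?_⟩
  rw [ENNReal.ofReal_toReal hfin, lintegral_sum_sq_of_disjoint hm hdis, mul_assoc]
  refine (gagliardoSq_sum_le s hm c).trans ?_
  gcongr
  rw [Finset.mul_sum]
  refine Finset.sum_le_sum fun j _ => ?_
  calc ENNReal.ofReal (c j ^ 2) * gagliardoSq s (ψ j)
      = ENNReal.ofReal (c j ^ 2) * (q j * ∫⁻ x, ENNReal.ofReal (ψ j x ^ 2)) := by
        rw [ENNReal.div_mul_cancel (hψ0 j) (hψ j).lintegral_sq_ne_top]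
    _ = q j * (ENNReal.ofReal (c j ^ 2) * ∫⁻ x, ENNReal.ofReal (ψ j x ^ 2)) := by ring
    _ ≤ _ := by
        gcongr
        exact Finset.single_le_sum (f := q) (fun _ _ => zero_le) (Finset.mem_univ j)

/-- This is the source of the decay in $\ell$: the factor $\ell^n$ is common to both sides, and
$\ell^{-2s}$ remains. -/
theorem gagliardoSq_dilate_le {s M ℓ : ℝ} (hM : 0 ≤ M) (hℓ : 0 < ℓ) {u : EuclideanSpace ℝ ι → ℝ}
    (hu : Measurable u)
    (h : gagliardoSq s u ≤ ENNReal.ofReal M * ∫⁻ x, ENNReal.ofReal (u x ^ 2)) :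
    gagliardoSq s (fun x => u (ℓ⁻¹ • x)) ≤
      ENNReal.ofReal (M * ℓ ^ (-(2 * s))) * ∫⁻ x, ENNReal.ofReal (u (ℓ⁻¹ • x) ^ 2) := by
  have hℓ' : 0 < ℓ⁻¹ := by positivity
  rw [gagliardoSq_comp_smul s hℓ' hu,
    lintegral_comp_smul_euclidean hℓ' (F := fun x => ENNReal.ofReal (u x ^ 2)) (by fun_prop),
    Real.inv_rpow hℓ.le, ← Real.rpow_neg hℓ.le, ENNReal.ofReal_mul hM]
  calc _ ≤ ENNReal.ofReal (ℓ ^ (-(2 * s))) * (ENNReal.ofReal ((ℓ⁻¹ ^ Fintype.card ι)⁻¹) *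
        (ENNReal.ofReal M * ∫⁻ x, ENNReal.ofReal (u x ^ 2))) := by gcongr
    _ = _ := by ring

end TrialFunctions

/-! ### Bounds on the long cylinder -/

section LongCylinder

variable {m d : ℕ} {ω : Set (EuclideanSpace ℝ (Fin d))}

theorem euclideanPair_mem_longCylinder {ℓ : ℝ} {x : EuclideanSpace ℝ (Fin m)}
    {y : EuclideanSpace ℝ (Fin d)} :
    euclideanPair x y ∈ longCylinder m ω ℓ ↔ (∀ i, x i ∈ Ioo (-ℓ) ℓ) ∧ y ∈ ω := Iff.rfl

theorem isBounded_longCylinder (hω : Bornology.IsBounded ω) (ℓ : ℝ) :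
    Bornology.IsBounded (longCylinder m ω ℓ) := by
  obtain ⟨R, hR⟩ := hω.exists_norm_le
  refine isBounded_iff_forall_norm_le.mpr ⟨√(m * ℓ ^ 2 + R ^ 2), fun z hz => ?_⟩
  rw [← euclideanPair_surjective z] at hz ⊢
  obtain ⟨h1, h2⟩ := euclideanPair_mem_longCylinder.mp hz
  refine Real.le_sqrt_of_sq_le ?_
  rw [norm_euclideanPair_sq]
  refine add_le_add ?_ (pow_le_pow_left₀ (norm_nonneg _) (hR _ h2) 2)
  rw [EuclideanSpace.norm_sq_eq]
  refine (Finset.sum_le_card_nsmul _ _ (ℓ ^ 2) fun i _ => ?_).trans_eq (by simp)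
  rw [Real.norm_eq_abs, sq_abs]
  exact sq_le_sq' (h1 i).1.le (h1 i).2.le

theorem IsTestFunction.slice {ℓ : ℝ} {φ : EuclideanSpace ℝ (Fin m ⊕ Fin d) → ℝ}
    (hφ : IsTestFunction (longCylinder m ω ℓ) φ) (x : EuclideanSpace ℝ (Fin m)) :
    IsTestFunction ω fun y => φ (euclideanPair x y) := by
  refine ⟨hφ.1.comp (contDiff_euclidean.mpr fun i => ?_), hasCompactSupport_slice hφ.2.1 x,
    fun y hy => ?_⟩
  · rcases i with i | i
    · exact contDiff_const
    · exact contDiff_euclidean.mp contDiff_id i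
  · have h := tsupport_comp_subset_preimage φ (isometry_euclideanPair_right x).continuous hy
    exact (euclideanPair_mem_longCylinder.mp (hφ.2.2 h)).2

theorem IsTestFunction.tensorFun {ℓ : ℝ} {Ψ : EuclideanSpace ℝ (Fin m) → ℝ}
    {w : EuclideanSpace ℝ (Fin d) → ℝ}
    (hΨ : IsTestFunction {x : EuclideanSpace ℝ (Fin m) | ∀ i, x i ∈ Ioo (-ℓ) ℓ} Ψ)
    (hw : IsTestFunction ω w) : IsTestFunction (longCylinder m ω ℓ) (tensorFun Ψ w) := by
  have hK : IsCompact ((fun p : EuclideanSpace ℝ (Fin m) × EuclideanSpace ℝ (Fin d) =>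
      euclideanPair p.1 p.2) '' (tsupport Ψ ×ˢ tsupport w)) :=
    (hΨ.2.1.isCompact.prod hw.2.1.isCompact).image continuous_euclideanPair
  have hsub : Function.support (_root_.tensorFun Ψ w) ⊆
      (fun p : EuclideanSpace ℝ (Fin m) × EuclideanSpace ℝ (Fin d) =>
      euclideanPair p.1 p.2) '' (tsupport Ψ ×ˢ tsupport w) := by
    intro z hz
    exact ⟨(_, _), ⟨subset_tsupport _ (left_ne_zero_of_mul hz),
      subset_tsupport _ (right_ne_zero_of_mul hz)⟩, euclideanPair_surjective z⟩
  refine ⟨?_, HasCompactSupport.of_support_subset_isCompact hK hsub,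
    (closure_minimal hsub hK.isClosed).trans ?_⟩
  · refine (hΨ.1.comp (contDiff_euclidean.mpr fun i => ?_)).mul
      (hw.1.comp (contDiff_euclidean.mpr fun i => ?_))
    · exact contDiff_euclidean.mp contDiff_id (Sum.inl i)
    · exact contDiff_euclidean.mp contDiff_id (Sum.inr i)
  · rintro _ ⟨⟨x, y⟩, ⟨hx, hy⟩, rfl⟩
    exact euclideanPair_mem_longCylinder.mpr ⟨hΨ.2.2 hx, hw.2.2 hy⟩

theorem IsTestFunction.dilate {ι : Type} [Fintype ι] {ℓ : ℝ} (hℓ : 0 < ℓ)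
    {u : EuclideanSpace ℝ ι → ℝ}
    (hu : IsTestFunction {x : EuclideanSpace ℝ ι | ∀ i, x i ∈ Ioo (-1 : ℝ) 1} u) :
    IsTestFunction {x : EuclideanSpace ℝ ι | ∀ i, x i ∈ Ioo (-ℓ) ℓ} fun x => u (ℓ⁻¹ • x) := by
  refine ⟨hu.1.comp (contDiff_const_smul _), hu.2.1.comp_smul (inv_ne_zero hℓ.ne'),
    fun x hx i => ?_⟩
  have h := hu.2.2 (tsupport_comp_subset_preimage u (continuous_const_smul ℓ⁻¹) hx) i
  simp only [PiLp.smul_apply, smul_eq_mul, mem_Ioo] at h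
  rw [inv_mul_eq_div, lt_div_iff₀ hℓ, div_lt_iff₀ hℓ] at h
  constructor <;> linarith [h.1, h.2]

variable {s : ℝ}

/-- The Poincaré inequality on a cylinder, with the constant of its cross section. -/
theorem poincareConst_mul_norm_sq_le_of_longCylinder [Nonempty (Fin d)] [Nonempty (Fin m)]
    (hs0 : 0 < s) (hs1 : s < 1)
    {ℓ : ℝ} {z : GraphSpace (Fin m ⊕ Fin d)} (hz : z ∈ formDomain s (longCylinder m ω ℓ)) :
    poincareConst s ω * ‖z.fst‖ ^ 2 ≤
      fracLaplaceConst (Fintype.card (Fin m ⊕ Fin d)) s / 2 * ‖z.snd‖ ^ 2 := by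
  have hC := fracLaplaceConst_pos (Fintype.card (Fin m ⊕ Fin d)) hs0 hs1
  have hP := poincareConst_nonneg (Ω := ω) hs0 hs1
  -- The inequality is a closed condition in the graph norm, so test functions suffice; for these
  -- the Poincaré inequality on $\omega$ is integrated over the slices.
  have hclosed : IsClosed {z : GraphSpace (Fin m ⊕ Fin d) | poincareConst s ω * ‖z.fst‖ ^ 2 ≤
      fracLaplaceConst (Fintype.card (Fin m ⊕ Fin d)) s / 2 * ‖z.snd‖ ^ 2} := by
    have h1 : Continuous fun z : GraphSpace (Fin m ⊕ Fin d) => z.fst :=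
      (WithLp.fstL 2 ℝ _ _).continuous
    have h2 : Continuous fun z : GraphSpace (Fin m ⊕ Fin d) => z.snd :=
      (WithLp.sndL 2 ℝ _ _).continuous
    exact isClosed_le (by fun_prop) (by fun_prop)
  refine closure_minimal (fun y hy => ?_) hclosed hz
  have hyD : y ∈ formDomain s (longCylinder m ω ℓ) := Submodule.le_topologicalClosure _ hy
  obtain ⟨φ, hφ, h1, -⟩ := hy
  have hc := hφ.continuous
  have h2 : ENNReal.ofReal (2 * poincareConst s ω) * ∫⁻ z, ENNReal.ofReal (φ z ^ 2) ≤
      fracEnergy s φ := by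
    refine le_trans ?_ (lintegral_fracEnergy_slice_le (ι := Fin m) (κ := Fin d) hs0 hs1 hc hφ.2.1)
    rw [lintegral_euclideanPair (by fun_prop), ← lintegral_const_mul' _ _ ENNReal.ofReal_ne_top]
    exact lintegral_mono fun x => (hφ.slice x).two_mul_poincareConst_mul_le hs0 hs1
  rw [fracEnergy, ← ofReal_norm_fst_sq h1, ← ofReal_norm_snd_sq hyD h1,
    ← ENNReal.ofReal_mul hC.le, ← ENNReal.ofReal_mul (by positivity),
    ENNReal.ofReal_le_ofReal_iff (by positivity)] at h2
  change poincareConst s ω * ‖y.fst‖ ^ 2 ≤ _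
  linarith

theorem IsTestFunction.sum_smul_toGraph_fst_ae_eq {ι : Type} [Fintype ι] [Nonempty ι]
    {Ω : Set (EuclideanSpace ℝ ι)} (hs0 : 0 < s) (hs1 : s < 1) {α : Type*} (F : Finset α)
    {φ : α → EuclideanSpace ℝ ι → ℝ} (hφ : ∀ j, IsTestFunction Ω (φ j)) (c : α → ℝ) :
    (∑ j ∈ F, c j • (hφ j).toGraph hs0 hs1).fst =ᵐ[volume] fun x => ∑ j ∈ F, c j * φ j x := by
  classical
  induction F using Finset.induction_on with
  | empty =>
    simp only [Finset.sum_empty]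
    exact Lp.coeFn_zero ℝ 2 volume
  | insert a F ha ih =>
    simp only [Finset.sum_insert ha]
    rw [WithLp.add_fst, WithLp.smul_fst]
    filter_upwards [ih, Lp.coeFn_add (c a • ((hφ a).toGraph hs0 hs1).fst)
      (∑ j ∈ F, c j • (hφ j).toGraph hs0 hs1).fst,
      Lp.coeFn_smul (c a) ((hφ a).toGraph hs0 hs1).fst, (hφ a).memLp.coeFn_toLp] with x h1 h2 h3 h4
    rw [h2, Pi.add_apply, h1, h3, Pi.smul_apply, smul_eq_mul]
    congr 2

/-- Trial functions `Ψ ⊗ w`, with `Ψ` dilated from the unit cube and `w` nearly minimal on the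
cross section, bound the eigenvalues of a cylinder from above. -/
theorem mem_eigenvalueLevels_longCylinder [Nonempty (Fin m)] [Nonempty (Fin d)] (hs0 : 0 < s)
    (hs1 : s < 1) (hω_open : IsOpen ω) (hω_bdd : Bornology.IsBounded ω) (hω_ne : ω.Nonempty)
    {k : ℕ} {ψ : Fin k → EuclideanSpace ℝ (Fin m) → ℝ}
    (hψ : ∀ j, IsTestFunction {x : EuclideanSpace ℝ (Fin m) | ∀ i, x i ∈ Ioo (-1 : ℝ) 1} (ψ j))
    (hψ0 : ∀ j, ∫⁻ x, ENNReal.ofReal (ψ j x ^ 2) ≠ 0)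
    (hdis : ∀ j l, j ≠ l → ∀ x, ψ j x * ψ l x = 0) {M : ℝ} (hM : 0 ≤ M)
    (hψM : ∀ c : Fin k → ℝ, gagliardoSq s (fun x => ∑ j, c j * ψ j x) ≤
      ENNReal.ofReal M * ∫⁻ x, ENNReal.ofReal ((∑ j, c j * ψ j x) ^ 2))
    {ℓ T : ℝ} (hℓ : 0 < ℓ)
    (hT : poincareConst s ω +
      fracLaplaceConst (Fintype.card (Fin m)) s / 2 * (M * ℓ ^ (-(2 * s))) < T) :
    T ∈ eigenvalueLevels s (longCylinder m ω ℓ) k := by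
  have hCm := fracLaplaceConst_pos (Fintype.card (Fin m)) hs0 hs1
  have hC := fracLaplaceConst_pos (Fintype.card (Fin m ⊕ Fin d)) hs0 hs1
  have hP := poincareConst_nonneg (Ω := ω) hs0 hs1
  set P := poincareConst s ω
  set Q := fracLaplaceConst (Fintype.card (Fin m)) s / 2 * (M * ℓ ^ (-(2 * s))) with hQdef
  have hQ : 0 ≤ Q := by positivity
  -- Half of the gap goes to the choice of $w$, since the infimum $P$ need not be attained by a test
  -- function; the other half keeps the strict inequality required by min-max.
  obtain ⟨ε, hε, hεT⟩ : ∃ ε, 0 < ε ∧ P + ε + Q < T :=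
    ⟨(T - (P + Q)) / 2, by linarith, by linarith⟩
  obtain ⟨w, hw, hw0, hwE⟩ := exists_isTestFunction_fracEnergy_le hs0 hs1 hω_open hω_ne hε
  have hχ := fun j => (hψ j).dilate hℓ
  have hφ := fun j => (hχ j).tensorFun hw
  set v : Fin k → GraphSpace (Fin m ⊕ Fin d) := fun j => (hφ j).toGraph hs0 hs1 with hv
  have hvD : ∀ j, v j ∈ formDomain s (longCylinder m ω ℓ) := fun j => (hφ j).toGraph_mem hs0 hs1
  have hsum : ∀ c : Fin k → ℝ, (∑ j, c j • v j).fst =ᵐ[volume]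
      tensorFun (fun x => ∑ j, c j * ψ j (ℓ⁻¹ • x)) w := by
    intro c
    refine (IsTestFunction.sum_smul_toGraph_fst_ae_eq hs0 hs1 Finset.univ hφ c).trans
      (Eventually.of_forall fun z => ?_)
    simp only [tensorFun, Finset.sum_mul, mul_assoc]
  have hχm : ∀ j, Measurable fun x => ψ j (ℓ⁻¹ • x) := fun j => (hχ j).continuous.measurable
  have hΨm : ∀ c : Fin k → ℝ, Measurable fun x => ∑ j, c j * ψ j (ℓ⁻¹ • x) := fun c =>
    Finset.measurable_fun_sum _ fun j _ => (hχm j).const_mul (c j)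
  have hnorm : ∀ c : Fin k → ℝ, ENNReal.ofReal (‖(∑ j, c j • v j).fst‖ ^ 2) =
      (∫⁻ x, ENNReal.ofReal ((∑ j, c j * ψ j (ℓ⁻¹ • x)) ^ 2)) *
        ∫⁻ y, ENNReal.ofReal (w y ^ 2) := fun c => by
    rw [ofReal_norm_fst_sq (hsum c), lintegral_tensorFun_sq (hΨm c) hw.continuous.measurable]
  -- By disjointness the square norm of the combination is
  -- $\|w\|^2\sum_jc_j^2\|\psi_j(\cdot/\ell)\|^2$, with $\|w\|$ and all $\|\psi_j(\cdot/\ell)\|$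
  -- nonzero.
  have hli : ∀ c : Fin k → ℝ, ∑ j, c j • v j = 0 → ∀ j, c j = 0 := by
    intro c hc j
    have h1 := hnorm c
    rw [hc, WithLp.zero_fst, norm_zero, zero_pow two_ne_zero,
      ENNReal.ofReal_zero, eq_comm, mul_eq_zero, or_iff_left hw0,
      lintegral_sum_sq_of_disjoint hχm (fun i l hil x => hdis i l hil _) c,
      Finset.sum_eq_zero_iff] at h1
    have h2 := h1 j (Finset.mem_univ j)
    have hψm := (hψ j).continuous
    rw [lintegral_comp_smul_euclidean (inv_pos.mpr hℓ)
      (F := fun x => ENNReal.ofReal (ψ j x ^ 2)) (by fun_prop), mul_eq_zero, mul_eq_zero,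
      or_iff_left (hψ0 j)] at h2
    rcases h2 with h2 | h2
    · rw [ENNReal.ofReal_eq_zero] at h2
      exact pow_eq_zero_iff two_ne_zero |>.mp (le_antisymm h2 (sq_nonneg _))
    · rw [ENNReal.ofReal_eq_zero] at h2
      exact absurd h2 (not_le.mpr (by positivity))
  refine mem_eigenvalueLevels_of_rayleigh_le hs0 hs1 (isBounded_longCylinder hω_bdd ℓ) hvD hli
    (T := P + ε + Q) (by positivity) hεT fun c => ?_
  have hzD : ∑ j, c j • v j ∈ formDomain s (longCylinder m ω ℓ) :=
    Submodule.sum_mem _ fun j _ => Submodule.smul_mem _ _ (hvD j)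
  set z := ∑ j, c j • v j with hz
  set Ψ : EuclideanSpace ℝ (Fin m) → ℝ := fun x => ∑ j, c j * ψ j (ℓ⁻¹ • x) with hΨ
  have hum : Measurable fun x => ∑ j, c j * ψ j x :=
    Finset.measurable_fun_sum _ fun j _ => (hψ j).continuous.measurable.const_mul (c j)
  have hE : fracEnergy s Ψ ≤ ENNReal.ofReal (2 * Q) * ∫⁻ x, ENNReal.ofReal (Ψ x ^ 2) := by
    have h2Q : 2 * Q = fracLaplaceConst (Fintype.card (Fin m)) s * (M * ℓ ^ (-(2 * s))) := by
      rw [hQdef]; ring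
    have hdil := gagliardoSq_dilate_le hM hℓ hum (hψM c)
    rw [h2Q, ENNReal.ofReal_mul hCm.le, mul_assoc, fracEnergy]
    exact mul_le_mul_right hdil _
  have h1 : fracEnergy s (tensorFun Ψ w) ≤
      ENNReal.ofReal (2 * Q + 2 * (P + ε)) * ENNReal.ofReal (‖z.fst‖ ^ 2) := by
    rw [hnorm c, ENNReal.ofReal_add (by positivity) (by positivity), add_mul]
    refine (fracEnergy_tensorFun_le hs0 hs1 (hΨm c) hw.continuous.measurable).trans ?_
    refine add_le_add ?_ ?_
    · rw [← mul_assoc]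
      gcongr
    · rw [mul_left_comm]
      gcongr
  rw [fracEnergy, ← ofReal_norm_snd_sq hzD (hsum c), ← ENNReal.ofReal_mul hC.le,
    ← ENNReal.ofReal_mul (by positivity), ENNReal.ofReal_le_ofReal_iff (by positivity)] at h1
  linarith

end LongCylinder

end

/-! ### Proof of the theorem -/

theorem theorem1p7 (m d : ℕ) (hm : 1 ≤ m) (hd : 1 ≤ d)
    (ω : Set (EuclideanSpace ℝ (Fin d))) (hω_open : IsOpen ω)
    (hω_bdd : Bornology.IsBounded ω) (hω_ne : ω.Nonempty)
    (s : ℝ) (hs0 : 0 < s) (hs1 : s < 1) (k : ℕ) (hk : 1 ≤ k) :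
    -- the `k`-th eigenvalue of each cylinder exists (and is a minimum)
    (∀ ℓ : ℝ, 0 < ℓ → IsLeast (eigenvalueLevels s (longCylinder m ω ℓ) k)
      (dirichletEigenvalue s (longCylinder m ω ℓ) k)) ∧
    (∀ ℓ : ℝ, 0 < ℓ → poincareConst s ω ≤ dirichletEigenvalue s (longCylinder m ω ℓ) k) ∧
    (∀ ℓ₀ : ℝ, 0 < ℓ₀ → ∃ A : ℝ, ∀ ℓ : ℝ, ℓ₀ ≤ ℓ →
      dirichletEigenvalue s (longCylinder m ω ℓ) k ≤ poincareConst s ω + A * ℓ ^ (-s)) ∧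
    Tendsto (fun ℓ : ℝ => dirichletEigenvalue s (longCylinder m ω ℓ) k) atTop
      (𝓝 (poincareConst s ω)) := by
  have : Nonempty (Fin m) := ⟨⟨0, hm⟩⟩
  have : Nonempty (Fin d) := ⟨⟨0, hd⟩⟩
  obtain ⟨ψ, hψ, hψ0, hdis⟩ := exists_disjoint_testFunctions (ι := Fin m) k
  obtain ⟨M, hM, hψM⟩ := exists_gagliardoSq_sum_le hs0 hs1 hψ hψ0 hdis
  have hmem : ∀ ℓ T : ℝ, 0 < ℓ → poincareConst s ω +
      fracLaplaceConst (Fintype.card (Fin m)) s / 2 * (M * ℓ ^ (-(2 * s))) < T →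
      T ∈ eigenvalueLevels s (longCylinder m ω ℓ) k := fun ℓ T hℓ hT =>
    mem_eigenvalueLevels_longCylinder hs0 hs1 hω_open hω_bdd hω_ne hψ hψ0 hdis hM hψM hℓ hT
  have hleast : ∀ ℓ : ℝ, 0 < ℓ → IsLeast (eigenvalueLevels s (longCylinder m ω ℓ) k)
      (dirichletEigenvalue s (longCylinder m ω ℓ) k) := fun ℓ hℓ =>
    isLeast_dirichletEigenvalue hs0 hs1 (isBounded_longCylinder hω_bdd ℓ) hk
      ⟨_, hmem ℓ _ hℓ (lt_add_one _)⟩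
  have hlower : ∀ ℓ : ℝ, 0 < ℓ →
      poincareConst s ω ≤ dirichletEigenvalue s (longCylinder m ω ℓ) k := fun ℓ hℓ =>
    le_of_mem_eigenvalueLevels hs0 hs1 hk
      (fun _ hz => poincareConst_mul_norm_sq_le_of_longCylinder hs0 hs1 hz) (hleast ℓ hℓ).1
  have hupper : ∀ ℓ₀ : ℝ, 0 < ℓ₀ → ∃ A : ℝ, ∀ ℓ : ℝ, ℓ₀ ≤ ℓ →
      dirichletEigenvalue s (longCylinder m ω ℓ) k ≤ poincareConst s ω + A * ℓ ^ (-s) := by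
    intro ℓ₀ hℓ₀
    have hCm := fracLaplaceConst_pos (Fintype.card (Fin m)) hs0 hs1
    -- The trial functions give the rate $\ell^{-2s}$, and $\ell^{-2s}\le\ell_0^{-s}\ell^{-s}$ for
    -- $\ell\ge\ell_0$.
    refine ⟨fracLaplaceConst (Fintype.card (Fin m)) s / 2 * (M * ℓ₀ ^ (-s)), fun ℓ hℓ => ?_⟩
    have hℓ0 : 0 < ℓ := hℓ₀.trans_le hℓ
    -- Every $T$ above the right-hand side is a level; letting $T$ decrease to it removes the slack.
    have h1 : dirichletEigenvalue s (longCylinder m ω ℓ) k ≤ poincareConst s ω +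
        fracLaplaceConst (Fintype.card (Fin m)) s / 2 * (M * ℓ ^ (-(2 * s))) :=
      le_of_forall_gt_imp_ge_of_dense fun T hT => (hleast ℓ hℓ0).2 (hmem ℓ T hℓ0 hT)
    refine h1.trans ?_
    rw [show -(2 * s) = -s + -s by ring, Real.rpow_add hℓ0, ← mul_assoc M, ← mul_assoc _ _ (ℓ ^ _)]
    have h2 : ℓ ^ (-s) ≤ ℓ₀ ^ (-s) := Real.rpow_le_rpow_of_nonpos hℓ₀ hℓ (by linarith)
    gcongr
  refine ⟨hleast, hlower, hupper, ?_⟩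
  obtain ⟨A, hA⟩ := hupper 1 one_pos
  refine tendsto_of_tendsto_of_tendsto_of_le_of_le' tendsto_const_nhds
    (h := fun ℓ : ℝ => poincareConst s ω + A * ℓ ^ (-s)) ?_ ?_ ?_
  · simpa using ((tendsto_rpow_neg_atTop hs0).const_mul A).const_add (poincareConst s ω)
  · filter_upwards [eventually_gt_atTop 0] with ℓ hℓ using hlower ℓ hℓ
  · filter_upwards [eventually_ge_atTop 1] with ℓ hℓ using hA ℓ hℓ
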